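/- **Setting.** In a diagram every region and every wire carries a finite nonempty label set; an unshaded region, or a wire without index (for instance one bordering a shaded region), has a one-element label set. Regions sit in columns $c\in\mathbb Z$, and wire $c$ separates the regions in columns $c$ and $c+1$. A *brickwork circuit* on $\mathbb Z$ consists of rows $s=0,1,2,\dots$; row $s$ has one four-valent vertex $U$ in each column $c$ with $c+s$ even. It maps labels $(w_1,m,w_2)$ (lower left wire, lower region, lower right wire) to $(w_1',m',w_2')$ (upper left wire, upper region, upper right wire), and depends in addition on the labels $l,r$ of the regions to its left and right. The vertex is *biunitary* if for all $l,r$ the matrix $U_{(w_1',m',w_2'),(w_1,m,w_2)}$ is unitary, and there is $\lambda>0$ such that for all $m,m'$ the matrix $\widetilde U_{(l,w_1,w_1'),(r,w_2,w_2')}$ with the same entries satisfies $\widetilde U\widetilde U^\dagger=\lambda\mathbb 1$ and $\widetilde U^\dagger\widetilde U=\lambda\mathbb 1$. **Initial states.** Let $(\mathcal N_j)_{j\in\mathbb Z}$ be vertices $\mathcal N_j=\mathcal N^{(p,m,q)}_{(a,\alpha),(c,\gamma)}$, where $p,q$ label the physical wires $2j,2j+1$, the labels $a,m,c$ belong to the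 regions in columns $2j,2j+1,2j+2$, and $\alpha,\gamma$ label the left and right auxiliary wires. The label sets match those at the bottom of the circuit, and neighbouring vertices are contracted along auxiliary wires and share the region between them. The first row of gates thus joins the right wire of $\mathcal N_{j-1}$ to the left wire of $\mathcal N_j$. The state is *solvable* if: 1. (horizontal unitarity) for each $j$ there is $\kappa>0$ such that for every $m$ the matrix $M_{(a,\alpha,p),(c,\gamma,q)}=\mathcal N^{(p,m,q)}_{(a,\alpha),(c,\gamma)}$ satisfies $MM^\dagger=\kappa\mathbb 1$ and $M^\dagger M=\kappa\mathbb 1$; 2. (leading eigenvalue) let $E(\mathcal N)_{(a,\alpha,\alpha'),(c,\gamma,\gamma')}=\sum_{p,m,q}\mathcal N^{(p,m,q)}_{(a,\alpha),(c,\gamma)}\overline{\mathcal N^{(p,m,q)}_{(a,\alpha'),(c,\gamma')}}$ be the transfer matrix. For each of the two directions there is a finite cell $(T_0,\dots,T_{p-1})$ such that $E(T_0)\cdots E(T_{p-1})$, after rescaling, has eigenvalue $1$ with algebraic multiplicity one and all other eigenvalues of modulus less than $1$, and such that, arbitrarily far out in this direction, arbitrarily many consecutive copies of the cell occur in $(\mathcal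 N_j)$. (If all $\mathcal N_j$ equal one vertex $\mathcal N$, one may take $p=1$, $T_0=\mathcal N$, and the requirement is the nondegeneracy of the leading eigenvalue of $E(\mathcal N)$.) **Reduced density matrices.** For $a,b\in\mathbb N$ take the finite state made of $\mathcal N_{-a},\dots,\mathcal N_{b-1}$, with the outermost regions and auxiliary wires contracted with an arbitrary nonzero boundary tensor $B_{a,b}$, and apply those gates of the first $t$ rows whose past light cone lies in this window. Let $A$ be the set of $\ell\ge1$ neighbouring wires $x,\dots,x+\ell-1$ at time $t$. Let $\rho_A^{(a,b)}(t)$ be the partial trace, over all wires and regions outside $A$, of the resulting pure state, normalized to trace one. The two regions $x$ and $x+\ell$ bounding $A$ are open regions of the diagram of $\rho_A$, common to the state and its conjugate, so $\rho_A^{(a,b)}(t)$ is block diagonal in their labels. Let $\rho_A(t)$ be the limit as $a,b\to\infty$ and $q_A$ the dimension of the space on which it acts. A second version, $\rho_A^{\rm in}(t)$, in which the bounding regions are traced out as well, acts on a space of dimension $q_A^{\rm in}$. **Theorem (exact thermalization).** Let the initial state be solvable and let all vertices in the first $t$ rows of the circuit be biunitary. If $t\ge \ell/2$, then for every position $x$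 and every choice of nonzero boundary tensors the limit $\rho_A(t)$ exists and $$\rho_A(t)=\mathbb 1_A/q_A .$$ Consequently the von Neumann entropy $-\mathrm{Tr}[\rho_A\ln\rho_A]$ and all Rényi entropies $\frac1{1-n}\ln \mathrm{Tr}[\rho_A^n]$, $n\in\mathbb N$, $n\ne1$, equal $\ln q_A$, which is their maximal value among all density matrices (positive semidefinite matrices of trace one) on the same space. The same statements hold for $\rho_A^{\rm in}(t)$ with $q_A^{\rm in}$. -/

import Mathlib

open Filter Topology
open scoped Matrix ComplexOrder

noncomputable section

namespace Biunitary

/-!  Conventions.  Every region and every wire of a diagram carries a finite label set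
`{0, …, d - 1}`; only its size `d` is recorded and labels are natural numbers below `d`.
An unshaded region has `d = 1`; a wire that carries no index (for example a wire which borders
a shaded region) has `d = 1`.  (A wire next to a shaded region is allowed, but not required, to carry a nontrivial
index, so diagrams in which only bare wires carry an index are a special case.)  Values of tensors on labels out of range are never used.

Regions sit in columns `c : ℤ`; wire number `c` separates the regions in columns `c` and `c + 1`.
Time `s` is the horizontal slice below row number `s` of gates (rows are numbered `0, 1, 2, …`).
The gates of row `s` sit in the columns `c` with `c + s` even.  The gate in column `c` has the
region `c - 1` on its left, the region `c + 1` on its right, replaces the region in column `c`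
below it by a new region above it, and maps the wires `c - 1`, `c` below it to the wires
`c - 1`, `c` above it. -/

/-- A (shaded) brickwork circuit on the infinite lattice `ℤ`.  The number
`gate s c l r (w₁', m', w₂') (w₁, m, w₂)` is the value of the vertex in row `s`, column `c`, where
`l`, `r` label the left and right regions, `m'`, `m` the regions above and below, `w₁'`, `w₂'` the
left and right outgoing (upper) wires and `w₁`, `w₂` the left and right incoming (lower) wires. -/
structure Circuit where
  regDim : ℕ → ℤ → ℕ
  wireDim : ℕ → ℤ → ℕ
  gate : ℕ → ℤ → ℕ → ℕ → (ℕ × ℕ × ℕ) → (ℕ × ℕ × ℕ) → ℂ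
  regDim_pos : ∀ s c, 0 < regDim s c
  wireDim_pos : ∀ s c, 0 < wireDim s c
  /-- if row `s` has no gate in column `c`, the region in that column continues upwards -/
  regDim_succ : ∀ (s : ℕ) (c : ℤ), ¬ Even (c + (s : ℤ)) → regDim (s + 1) c = regDim s c

namespace Circuit

variable (C : Circuit)

/-- The vertex read from bottom to top, for given labels of the left and right regions. -/
def vert (s : ℕ) (c : ℤ) (l r : ℕ) :
    Matrix (Fin (C.wireDim (s + 1) (c - 1)) × Fin (C.regDim (s + 1) c) × Fin (C.wireDim (s + 1) c))
      (Fin (C.wireDim s (c - 1)) × Fin (C.regDim s c) × Fin (C.wireDim s c)) ℂ :=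
  Matrix.of fun y x => C.gate s c l r (y.1, y.2.1, y.2.2) (x.1, x.2.1, x.2.2)

/-- The vertex read sideways, for given labels `m'`, `m` of the upper and lower regions. -/
def horiz (s : ℕ) (c : ℤ) (m' m : ℕ) :
    Matrix (Fin (C.regDim s (c - 1)) × Fin (C.wireDim s (c - 1)) × Fin (C.wireDim (s + 1) (c - 1)))
      (Fin (C.regDim s (c + 1)) × Fin (C.wireDim s c) × Fin (C.wireDim (s + 1) c)) ℂ :=
  Matrix.of fun y x => C.gate s c y.1 x.1 (y.2.2, m', x.2.2) (y.2.1, m, x.2.1)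

/-- Vertical unitarity, and horizontal unitarity up to one positive constant. -/
def IsBiunitaryAt (s : ℕ) (c : ℤ) : Prop :=
  (∀ l < C.regDim s (c - 1), ∀ r < C.regDim s (c + 1),
      C.vert s c l r * (C.vert s c l r)ᴴ = 1 ∧ (C.vert s c l r)ᴴ * C.vert s c l r = 1) ∧
  ∃ κ : ℝ, 0 < κ ∧ ∀ m' < C.regDim (s + 1) c, ∀ m < C.regDim s c,
      C.horiz s c m' m * (C.horiz s c m' m)ᴴ = (κ : ℂ) • 1 ∧
      (C.horiz s c m' m)ᴴ * C.horiz s c m' m = (κ : ℂ) • 1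

/-- The first `t` rows consist of biunitary vertices. -/
def IsBiunitary (t : ℕ) : Prop :=
  ∀ s < t, ∀ c : ℤ, Even (c + (s : ℤ)) → C.IsBiunitaryAt s c

/-- The action of the gate in row `s`, column `c` on a wave function, which is a function of the
labels of all regions and all wires of a slice. -/
def applyGate (s : ℕ) (c : ℤ) (ψ : (ℤ → ℕ) → (ℤ → ℕ) → ℂ) : (ℤ → ℕ) → (ℤ → ℕ) → ℂ := fun r w =>
  ∑ x ∈ Finset.range (C.wireDim s (c - 1)) ×ˢ Finset.range (C.regDim s c) ×ˢ
      Finset.range (C.wireDim s c),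
    C.gate s c (r (c - 1)) (r (c + 1)) (w (c - 1), r c, w c) x *
      ψ (Function.update r c x.2.1)
        (Function.update (Function.update w (c - 1) x.1) c x.2.2)

/-- The action of `k` consecutive gates of row `s`, in the columns `c, c + 2, …, c + 2 (k - 1)`. -/
def applyRow (s : ℕ) (c : ℤ) (k : ℕ) (ψ : (ℤ → ℕ) → (ℤ → ℕ) → ℂ) : (ℤ → ℕ) → (ℤ → ℕ) → ℂ :=
  match k with
  | 0 => ψ
  | k + 1 => C.applyGate s (c + 2 * (k : ℤ)) (applyRow s c k ψ)

/-- Evolution through the first `t` rows of a wave function on the window of columns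
`-2a, …, 2b`: of each row those gates act whose past light cone stays inside the window, that is,
in row `s` the gates in the columns `c` with `-2a + 2 + s ≤ c ≤ 2b - 2 - s`. -/
def evolve (a b : ℕ) (ψ : (ℤ → ℕ) → (ℤ → ℕ) → ℂ) (t : ℕ) : (ℤ → ℕ) → (ℤ → ℕ) → ℂ :=
  match t with
  | 0 => ψ
  | s + 1 => C.applyRow s (-2 * (a : ℤ) + 2 + (s : ℤ)) (a + b - 1 - s) (evolve a b ψ s)

/-- Size of the label set of the region in column `c` on the upper boundary of the evolved window;
near the two ends of the window regions (and wires, below) leave the circuit before time `t`. -/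
def outRegDim (a b t : ℕ) (c : ℤ) : ℕ :=
  C.regDim (min t (min (c + 2 * (a : ℤ)).toNat (2 * (b : ℤ) - c).toNat)) c

/-- Size of the label set of wire `c` on the upper boundary of the evolved window. -/
def outWireDim (a b t : ℕ) (c : ℤ) : ℕ :=
  C.wireDim (min t (min (c + 2 * (a : ℤ)).toNat (2 * (b : ℤ) - 1 - c).toNat)) c

end Circuit

/-- A vertex of the initial state.  It has a left region, a left auxiliary wire, a left physical
wire, a top region, a right physical wire, a right auxiliary wire and a right region, and
`amp` takes the seven labels in this order (the region below the state is unshaded). -/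
structure StateTensor where
  leftReg : ℕ
  leftAux : ℕ
  leftWire : ℕ
  topReg : ℕ
  rightWire : ℕ
  rightAux : ℕ
  rightReg : ℕ
  amp : ℕ → ℕ → ℕ → ℕ → ℕ → ℕ → ℕ → ℂ

namespace StateTensor

/-- The vertex read sideways, for a given label of the top region. -/
def horiz (T : StateTensor) (m : ℕ) :
    Matrix (Fin T.leftReg × Fin T.leftAux × Fin T.leftWire)
      (Fin T.rightReg × Fin T.rightAux × Fin T.rightWire) ℂ :=
  Matrix.of fun y x => T.amp y.1 y.2.1 y.2.2 m x.2.2 x.2.1 x.1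

/-- Horizontal unitarity, up to one positive constant. -/
def IsHorizontallyUnitary (T : StateTensor) : Prop :=
  ∃ κ : ℝ, 0 < κ ∧ ∀ m < T.topReg,
    T.horiz m * (T.horiz m)ᴴ = (κ : ℂ) • 1 ∧ (T.horiz m)ᴴ * T.horiz m = (κ : ℂ) • 1

/-- The transfer matrix of a vertex, obtained by contracting the vertex with its conjugate along
the physical wires and the top region.  Its indices are `(region, auxiliary wire, conjugate
auxiliary wire)` on the left and on the right; a region is shared by the vertex and its
conjugate, an auxiliary wire is not. -/
def transfer (T : StateTensor) (y x : ℕ × ℕ × ℕ) : ℂ :=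
  ∑ m ∈ Finset.range T.topReg, ∑ p ∈ Finset.range T.leftWire, ∑ q ∈ Finset.range T.rightWire,
    T.amp y.1 y.2.1 p m q x.2.1 x.1 * star (T.amp y.1 y.2.2 p m q x.2.2 x.1)

/-- Matrix product of the transfer matrices of `T 0, …, T (k - 1)`. -/
def cellTransfer (T : ℕ → StateTensor) : ℕ → (ℕ × ℕ × ℕ) → (ℕ × ℕ × ℕ) → ℂ
  | 0 => fun y x => if y = x then 1 else 0
  | k + 1 => fun y x =>
      ∑ z ∈ Finset.range (T k).leftReg ×ˢ Finset.range (T k).leftAux ×ˢ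
          Finset.range (T k).leftAux,
        cellTransfer T k y z * (T k).transfer z x

/-- The transfer matrix of the cell `T 0, …, T (p - 1)`, for a cell that can be repeated, i.e.
whose last right region and auxiliary wire have the same sizes as the first left ones. -/
def cellMatrix (T : ℕ → StateTensor) (p : ℕ) :
    Matrix (Fin (T 0).leftReg × Fin (T 0).leftAux × Fin (T 0).leftAux)
      (Fin (T 0).leftReg × Fin (T 0).leftAux × Fin (T 0).leftAux) ℂ :=
  Matrix.of fun y x => cellTransfer T p (y.1, y.2.1, y.2.2) (x.1, x.2.1, x.2.2)

end StateTensor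

/-- After rescaling, `M` has the eigenvalue `1` with algebraic multiplicity one and all its other
eigenvalues have absolute value less than one. -/
def HasNondegenerateLeadingEigenvalue {ι : Type*} [Fintype ι] [DecidableEq ι]
    (M : Matrix ι ι ℂ) : Prop :=
  ∃ μ : ℂ, μ ≠ 0 ∧ M.charpoly.rootMultiplicity μ = 1 ∧
    ∀ ν : ℂ, M.charpoly.IsRoot ν → ν ≠ μ → ‖ν‖ < ‖μ‖

/-- An infinite row of vertices `N j`, `j : ℤ`, that can be composed with each other along
auxiliary wires and with the circuit `C` placed above it; `N j` emits the wires `2j`, `2j + 1`,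
and its left, top and right regions are those in the columns `2j`, `2j + 1`, `2j + 2`. -/
structure FitsBelow (N : ℤ → StateTensor) (C : Circuit) : Prop where
  leftReg : ∀ j, (N j).leftReg = C.regDim 0 (2 * j)
  leftWire : ∀ j, (N j).leftWire = C.wireDim 0 (2 * j)
  topReg : ∀ j, (N j).topReg = C.regDim 0 (2 * j + 1)
  rightWire : ∀ j, (N j).rightWire = C.wireDim 0 (2 * j + 1)
  rightReg : ∀ j, (N j).rightReg = C.regDim 0 (2 * j + 2)
  aux : ∀ j, (N j).rightAux = (N (j + 1)).leftAux
  aux_pos : ∀ j, 0 < (N j).leftAux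

/-- A solvable row of vertices: every vertex is horizontally unitary, and arbitrarily far out on
either side a finite cell of vertices, whose transfer matrix has a nondegenerate leading
eigenvalue, is repeated arbitrarily often.  (If all `N j` equal one vertex `N`, this
is: `N` is horizontally unitary and its transfer matrix has a nondegenerate leading
eigenvalue.) -/
structure IsSolvable (N : ℤ → StateTensor) : Prop where
  unitary : ∀ j, (N j).IsHorizontallyUnitary
  right : ∃ (p : ℕ) (T : ℕ → StateTensor), 0 < p ∧
    HasNondegenerateLeadingEigenvalue (StateTensor.cellMatrix T p) ∧
    ∀ R : ℕ, ∃ K : ℤ, (R : ℤ) ≤ K ∧ ∀ i < R * p, N (K + (i : ℤ)) = T (i % p)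
  left : ∃ (p : ℕ) (T : ℕ → StateTensor), 0 < p ∧
    HasNondegenerateLeadingEigenvalue (StateTensor.cellMatrix T p) ∧
    ∀ R : ℕ, ∃ K : ℤ, K + (R * p : ℕ) ≤ -(R : ℤ) ∧ ∀ i < R * p, N (K + (i : ℤ)) = T (i % p)

/-- The matrix product of the vertices `N m, …, N (m + k - 1)` at given labels `r`, `w` of
the regions and physical wires; the two remaining arguments label the outer auxiliary wires. -/
def chain (N : ℤ → StateTensor) (m : ℤ) (r w : ℤ → ℕ) : ℕ → ℕ → ℕ → ℂ
  | 0 => fun ξ η => if ξ = η then 1 else 0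
  | k + 1 => fun ξ η => ∑ ζ ∈ Finset.range (N (m + (k : ℤ))).leftAux,
      chain N m r w k ξ ζ *
        (N (m + (k : ℤ))).amp (r (2 * (m + (k : ℤ)))) ζ (w (2 * (m + (k : ℤ))))
          (r (2 * (m + (k : ℤ)) + 1)) (w (2 * (m + (k : ℤ)) + 1)) η (r (2 * (m + (k : ℤ)) + 2))

/-- The (unnormalized) state made of `N (-a), …, N (b - 1)`, closed by the boundary tensor
`B`, whose arguments label the leftmost region, the leftmost auxiliary wire, the rightmost
auxiliary wire and the rightmost region.  Product boundary vectors and periodic closure are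
special cases. -/
def windowState (N : ℤ → StateTensor) (a b : ℕ) (B : ℕ → ℕ → ℕ → ℕ → ℂ) :
    (ℤ → ℕ) → (ℤ → ℕ) → ℂ := fun r w =>
  ∑ ξ ∈ Finset.range (N (-(a : ℤ))).leftAux, ∑ η ∈ Finset.range (N (b : ℤ)).leftAux,
    B (r (-2 * (a : ℤ))) ξ η (r (2 * (b : ℤ))) * chain N (-(a : ℤ)) r w (a + b) ξ η

/-- The boundary tensor has a nonzero entry. -/
def BoundaryNonzero (N : ℤ → StateTensor) (a b : ℕ) (B : ℕ → ℕ → ℕ → ℕ → ℂ) : Prop :=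
  ∃ l < (N (-(a : ℤ))).leftReg, ∃ ξ < (N (-(a : ℤ))).leftAux,
    ∃ η < (N (b : ℤ)).leftAux, ∃ r < (N (b : ℤ)).leftReg, B l ξ η r ≠ 0

/-! The subsystem `A` consists of the `ℓ ≥ 1` neighbouring wires `x, …, x + ℓ - 1` at time `t`.
It has the `ℓ - 1` inner regions `x + 1, …, x + ℓ - 1`, and is bounded by the regions `x` and
`x + ℓ`. -/

/-- Labels of the inner regions and of the wires of `A`. -/
abbrev InnerLabels (C : Circuit) (t : ℕ) (x : ℤ) (ℓ : ℕ) : Type :=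
  ((i : Fin (ℓ - 1)) → Fin (C.regDim t (x + 1 + (i : ℕ)))) ×
    ((i : Fin ℓ) → Fin (C.wireDim t (x + (i : ℕ))))

/-- Labels of the left and right bounding regions of `A`. -/
abbrev OuterLabels (C : Circuit) (t : ℕ) (x : ℤ) (ℓ : ℕ) : Type :=
  Fin (C.regDim t x) × Fin (C.regDim t (x + ℓ))

/-- Labels of the regions of the window `[-2a, 2b]` that neither belong to `A` nor bound it. -/
abbrev EnvRegions (C : Circuit) (a b t : ℕ) (x : ℤ) (ℓ : ℕ) : Type :=
  (c : {c : ℤ // c ∈ Finset.Icc (-2 * (a : ℤ)) (2 * (b : ℤ)) \ Finset.Icc x (x + ℓ)}) →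
    Fin (C.outRegDim a b t c)

/-- Labels of the wires of the window that do not belong to `A`. -/
abbrev EnvWires (C : Circuit) (a b t : ℕ) (x : ℤ) (ℓ : ℕ) : Type :=
  (c : {c : ℤ // c ∈ Finset.Ico (-2 * (a : ℤ)) (2 * (b : ℤ)) \ Finset.Ico x (x + ℓ)}) →
    Fin (C.outWireDim a b t c)

section ReducedDensityMatrix

variable (C : Circuit) (N : ℤ → StateTensor) (a b : ℕ) (B : ℕ → ℕ → ℕ → ℕ → ℂ)
  (t : ℕ) (x : ℤ) (ℓ : ℕ)

/-- Assemble the labels of all regions of the slice. -/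
def allRegions (u : InnerLabels C t x ℓ) (v : OuterLabels C t x ℓ) (e : EnvRegions C a b t x ℓ) :
    ℤ → ℕ := fun c =>
  if c = x then v.1
  else if c = x + ℓ then v.2
  else if h : (c - x - 1).toNat < ℓ - 1 ∧ x < c then u.1 ⟨(c - x - 1).toNat, h.1⟩
  else if h : c ∈ Finset.Icc (-2 * (a : ℤ)) (2 * (b : ℤ)) \ Finset.Icc x (x + ℓ) then e ⟨c, h⟩
  else 0

/-- Assemble the labels of all wires of the slice. -/
def allWires (u : InnerLabels C t x ℓ) (f : EnvWires C a b t x ℓ) : ℤ → ℕ := fun c =>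
  if h : (c - x).toNat < ℓ ∧ x ≤ c then u.2 ⟨(c - x).toNat, h.1⟩
  else if h : c ∈ Finset.Ico (-2 * (a : ℤ)) (2 * (b : ℤ)) \ Finset.Ico x (x + ℓ) then f ⟨c, h⟩
  else 0

/-- Amplitude of the time-evolved state of the window. -/
def evolvedAmp (u : InnerLabels C t x ℓ) (v : OuterLabels C t x ℓ)
    (e : EnvRegions C a b t x ℓ) (f : EnvWires C a b t x ℓ) : ℂ :=
  C.evolve a b (windowState N a b B) t (allRegions C a b t x ℓ u v e) (allWires C a b t x ℓ u f)

/-- The partial trace of `|Ψ(t)⟩⟨Ψ(t)|` over all regions and wires outside `A`, for given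
labels `v` of the two bounding regions. -/
def tracedBlock (v : OuterLabels C t x ℓ) : Matrix (InnerLabels C t x ℓ) (InnerLabels C t x ℓ) ℂ :=
  Matrix.of fun u u' => ∑ e : EnvRegions C a b t x ℓ, ∑ f : EnvWires C a b t x ℓ,
    evolvedAmp C N a b B t x ℓ u v e f * star (evolvedAmp C N a b B t x ℓ u' v e f)

/-- The reduced density matrix of `A` in the shaded calculus, normalized to trace one.  The
two bounding regions are open regions of the diagram, each common to the state and its
conjugate, so the matrix is the direct sum over their labels. -/
def reducedDensity :
    Matrix (InnerLabels C t x ℓ × OuterLabels C t x ℓ)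
      (InnerLabels C t x ℓ × OuterLabels C t x ℓ) ℂ :=
  (Matrix.trace (Matrix.blockDiagonal (tracedBlock C N a b B t x ℓ)))⁻¹ •
    Matrix.blockDiagonal (tracedBlock C N a b B t x ℓ)

/-- The reduced density matrix of the wires and inner regions of `A` only, the two bounding
regions being traced out as part of the complement; normalized to trace one. -/
def innerReducedDensity : Matrix (InnerLabels C t x ℓ) (InnerLabels C t x ℓ) ℂ :=
  (Matrix.trace (∑ v, tracedBlock C N a b B t x ℓ v))⁻¹ • ∑ v, tracedBlock C N a b B t x ℓ v

end ReducedDensityMatrix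

section Entropy

variable {ι : Type*} [Fintype ι] [DecidableEq ι]

/-- Positive semidefinite matrices of trace one. -/
def IsDensityMatrix (ρ : Matrix ι ι ℂ) : Prop := ρ.PosSemidef ∧ ρ.trace = 1

/-- `- Tr (ρ ln ρ)`, with the logarithm of a Hermitian matrix given by functional calculus. -/
def vonNeumannEntropy (ρ : Matrix ι ι ℂ) : ℝ := -(ρ * cfc Real.log ρ).trace.re

/-- The Rényi entropy `(1 - n)⁻¹ ln Tr (ρ ^ n)`. -/
def renyiEntropy (n : ℕ) (ρ : Matrix ι ι ℂ) : ℝ := 1 / (1 - (n : ℝ)) * Real.log (ρ ^ n).trace.re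

/-- `ρ` is `1 / q` with `q` the dimension, its von Neumann and Rényi entropies equal `ln q`, and
these values are maximal among all density matrices. -/
def IsThermal (ρ : Matrix ι ι ℂ) : Prop :=
  ρ = (1 / (Fintype.card ι : ℂ)) • 1 ∧
  vonNeumannEntropy ρ = Real.log (Fintype.card ι) ∧
  (∀ n : ℕ, n ≠ 1 → renyiEntropy n ρ = Real.log (Fintype.card ι)) ∧
  ∀ σ : Matrix ι ι ℂ, IsDensityMatrix σ →
    vonNeumannEntropy σ ≤ vonNeumannEntropy ρ ∧
    ∀ n : ℕ, n ≠ 1 → renyiEntropy n σ ≤ renyiEntropy n ρ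

end Entropy

end Biunitary

end

noncomputable section

namespace Biunitary

/-! ### Entropy of the maximally mixed state. -/

section

section Entropy

variable {ι : Type*} [Fintype ι] [DecidableEq ι]

/-! Three mechanisms combine: gates outside the light cone cancel, the far ends of the state forget
the boundary tensor, and what is left is unravelled from the sides.

Cancellation. For a fixed subsystem, the traced state of a window is a linear functional `Tform` of
the boundary density `B ⊗ B̄` placed on the two outermost cuts. A window with one more vertex
differs by that vertex and by one diagonal of gates. If the diagonal lies outside the backward light
cone of the subsystem, all its sites are traced and vertical unitarity cancels it against its
conjugate (`tr_evOp_left`, `tr_evOp_right`); the vertex then acts on the boundary density by its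
transfer matrix alone (`Tform_left`, `Tform_right`). Hence a large window equals a fixed window with
boundary density `pushKernel` (`Tform_pushKernel`).

Forgetting. Horizontal unitarity of a vertex says that `diag`, which joins the auxiliary wire to its
conjugate and is uniform over the region, is a left and a right eigenvector of the transfer matrix,
with positive eigenvalues. Complete positivity bounds all entries of a product of transfer matrices
by such an eigenvalue (`IsCP.norm_le_of_diag`). With a nondegenerate leading eigenvalue of the
repeated cell, long runs of the cell approach a multiple of the rank one kernel `diag ⊗ diag`
(`tendsto_pow_of_nondegenerate`, `cell_converges`). Whatever lies beyond such a run only supplies a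
positive density of nonzero trace, so every boundary tensor yields `Λ • diag ⊗ diag` up to small
relative error (`joint_limit`).

Unravelling. With boundary density `diag ⊗ diag` the fixed window, `Dform`, is computed exactly.
Horizontal unitarity removes the end vertex and then, one after the other, the gates of the diagonal
that ends at the subsystem; what emerges is an identity on the outermost wire of the subsystem times
the same object for a window shorter by one vertex and a subsystem shorter by one wire
(`Dform_left`, `Dform_right`). Peeling both sides and then conjugating by a row of gates inside the
subsystem, where vertical unitarity preserves the identity, gives an induction on the number of rows
(`Dform_isScalarOn`): `2t` wires are maximally mixed after `t` rows. Shorter subsystems follow by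
partial trace.

Normalization is continuous at a nonzero multiple of the identity and insensitive to the scale `Λ`,
so the limit exists and is maximally mixed; Jensen's inequality gives maximality of the entropies.
-/

theorem trace_cfc {σ : Matrix ι ι ℂ} (h : σ.IsHermitian) (f : ℝ → ℝ) :
    (cfc f σ).trace = ∑ i, (f (h.eigenvalues i) : ℂ) := by
  rw [h.cfc_eq, Matrix.IsHermitian.cfc, Unitary.conjStarAlgAut_apply, Matrix.trace_mul_comm,
    ← mul_assoc]
  simp [Matrix.trace_diagonal]

/-- A matrix has finite spectrum, so the continuity demanded by the functional calculus is
automatic, even for `Real.log` at `0`. -/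
theorem continuousOn_spectrum (σ : Matrix ι ι ℂ) (f : ℝ → ℝ) : ContinuousOn f (spectrum ℝ σ) := by
  have : Finite (spectrum ℝ σ) := Matrix.finite_real_spectrum
  exact (Set.toFinite (spectrum ℝ σ)).continuousOn f

theorem vonNeumannEntropy_eq {σ : Matrix ι ι ℂ} (h : σ.IsHermitian) :
    vonNeumannEntropy σ = ∑ i, Real.negMulLog (h.eigenvalues i) := by
  have hs : IsSelfAdjoint σ := h
  have h1 : σ * cfc Real.log σ = cfc (fun x => x * Real.log x) σ := by
    rw [cfc_mul (fun x : ℝ => x) Real.log σ (continuousOn_spectrum _ _)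
      (continuousOn_spectrum _ _), cfc_id' ℝ σ]
  rw [vonNeumannEntropy, h1, trace_cfc h]
  simp [Real.negMulLog]

theorem trace_pow_eq {σ : Matrix ι ι ℂ} (h : σ.IsHermitian) (n : ℕ) :
    (σ ^ n).trace.re = ∑ i, h.eigenvalues i ^ n := by
  have hs : IsSelfAdjoint σ := h
  rw [← cfc_pow_id (R := ℝ) σ n, trace_cfc h]
  simp only [Complex.re_sum, Complex.ofReal_re]

theorem sum_eigenvalues_eq_one {σ : Matrix ι ι ℂ} (h : IsDensityMatrix σ) :
    ∑ i, h.1.isHermitian.eigenvalues i = 1 := by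
  have := trace_pow_eq h.1.isHermitian 1
  simpa [h.2] using this.symm

/-- Jensen's inequality for the concave function `-x ln x`, with uniform weights on the eigenvalues,
whose mean is `1/q`. -/
theorem vonNeumannEntropy_le [Nonempty ι] {σ : Matrix ι ι ℂ} (h : IsDensityMatrix σ) :
    vonNeumannEntropy σ ≤ Real.log (Fintype.card ι) := by
  rw [vonNeumannEntropy_eq h.1.isHermitian]
  have hq : (0 : ℝ) < Fintype.card ι := by exact_mod_cast Fintype.card_pos
  have hj := Real.concaveOn_negMulLog.le_map_sum (t := Finset.univ)
    (w := fun _ : ι => (Fintype.card ι : ℝ)⁻¹) (p := h.1.isHermitian.eigenvalues)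
    (fun _ _ => by positivity) (by simp [hq.ne'])
    (fun i _ => h.1.eigenvalues_nonneg i)
  simp only [smul_eq_mul, ← Finset.mul_sum, sum_eigenvalues_eq_one h, mul_one] at hj
  rw [Real.negMulLog, Real.log_inv] at hj
  rw [← mul_le_mul_iff_right₀ (inv_pos.2 hq)]
  linarith

/-- Convexity of `x ^ n` gives `Tr σ ^ n ≥ q ^ (1 - n)`; for `n ≥ 2` the prefactor `1 / (1 - n)` is
negative and reverses the inequality. For `n = 0` the entropy is `ln q` for every `σ`. -/
theorem renyiEntropy_le [Nonempty ι] {σ : Matrix ι ι ℂ} (h : IsDensityMatrix σ) (n : ℕ)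
    (hn : n ≠ 1) : renyiEntropy n σ ≤ Real.log (Fintype.card ι) := by
  rcases Nat.eq_zero_or_pos n with rfl | hpos
  · simp [renyiEntropy]
  have hn2 : 2 ≤ n := by omega
  rw [renyiEntropy, trace_pow_eq h.1.isHermitian]
  have hq : (0 : ℝ) < Fintype.card ι := by exact_mod_cast Fintype.card_pos
  have hj := Real.pow_arith_mean_le_arith_mean_pow Finset.univ
    (fun _ : ι => (Fintype.card ι : ℝ)⁻¹) h.1.isHermitian.eigenvalues
    (fun _ _ => by positivity) (by simp [hq.ne'])
    (fun i _ => h.1.eigenvalues_nonneg i) n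
  simp only [← Finset.mul_sum, sum_eigenvalues_eq_one h, mul_one] at hj
  have hlow : ((Fintype.card ι : ℝ)⁻¹) ^ (n - 1) ≤ ∑ i, h.1.isHermitian.eigenvalues i ^ n := by
    obtain ⟨k, rfl⟩ : ∃ k, n = k + 1 := ⟨n - 1, by omega⟩
    rw [pow_succ, mul_comm] at hj
    simpa using le_of_mul_le_mul_left hj (inv_pos.2 hq)
  have hlog := Real.log_le_log (by positivity) hlow
  rw [Real.log_pow, Real.log_inv, Nat.cast_sub (by omega), Nat.cast_one] at hlog
  have hn1 : (0 : ℝ) < (n : ℝ) - 1 := by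
    have : (2 : ℝ) ≤ n := by exact_mod_cast hn2
    linarith
  rw [show (1 : ℝ) - n = -((n : ℝ) - 1) by ring, one_div, inv_neg, neg_mul,
    neg_le, ← mul_le_mul_iff_right₀ hn1, ← mul_assoc, mul_inv_cancel₀ hn1.ne', one_mul]
  linarith

theorem isThermal_maximallyMixed [Nonempty ι] :
    IsThermal ((1 / (Fintype.card ι : ℂ)) • (1 : Matrix ι ι ℂ)) := by
  have hq : (0 : ℝ) < Fintype.card ι := by exact_mod_cast Fintype.card_pos
  have hqc : (Fintype.card ι : ℂ) ≠ 0 := by exact_mod_cast hq.ne'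
  have hv : vonNeumannEntropy ((1 / (Fintype.card ι : ℂ)) • (1 : Matrix ι ι ℂ)) =
      Real.log (Fintype.card ι) := by
    have h1 : (1 / (Fintype.card ι : ℂ)) • (1 : Matrix ι ι ℂ) =
        algebraMap ℝ _ ((Fintype.card ι : ℝ)⁻¹) := by
      rw [Algebra.algebraMap_eq_smul_one]
      ext i j
      simp [Matrix.one_apply]
    have h2 : cfc Real.log ((1 / (Fintype.card ι : ℂ)) • (1 : Matrix ι ι ℂ)) =
        algebraMap ℝ _ (Real.log ((Fintype.card ι : ℝ)⁻¹)) := by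
      rw [h1, cfc_algebraMap]
    rw [vonNeumannEntropy, h2, h1, ← map_mul, Algebra.algebraMap_eq_smul_one, Matrix.trace_smul,
      Matrix.trace_one, Real.log_inv]
    simp
    field_simp
    rw [← Complex.natCast_log, Complex.ofReal_re]
  have hr : ∀ n : ℕ, n ≠ 1 →
      renyiEntropy n ((1 / (Fintype.card ι : ℂ)) • (1 : Matrix ι ι ℂ)) =
        Real.log (Fintype.card ι) := by
    intro n hn
    have h1 : (((1 / (Fintype.card ι : ℂ)) • (1 : Matrix ι ι ℂ)) ^ n).trace.re =
        ((Fintype.card ι : ℝ)⁻¹) ^ n * (Fintype.card ι : ℝ) := by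
      rw [smul_pow, one_pow, Matrix.trace_smul, Matrix.trace_one, one_div, smul_eq_mul]
      have : (Fintype.card ι : ℂ)⁻¹ ^ n * (Fintype.card ι : ℂ) =
          (((Fintype.card ι : ℝ)⁻¹ ^ n * (Fintype.card ι : ℝ) : ℝ) : ℂ) := by push_cast; rfl
      rw [this, Complex.ofReal_re]
    have hn1 : (1 : ℝ) - n ≠ 0 := by
      intro h0
      exact hn (by exact_mod_cast (sub_eq_zero.1 h0).symm)
    rw [renyiEntropy, h1, Real.log_mul (by positivity) hq.ne', Real.log_pow, Real.log_inv]
    field_simp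
    ring
  refine ⟨rfl, hv, hr, fun σ hσ => ⟨?_, fun n hn => ?_⟩⟩
  · rw [hv]; exact vonNeumannEntropy_le hσ
  · rw [hr n hn]; exact renyiEntropy_le hσ n hn

end Entropy

end

/-! ### Labellings of a slice, partial traces, and gates as operators. -/

section

/-- Sites of a slice: `Sum.inl c` is the region in column `c`, `Sum.inr c` is wire `c`. -/
abbrev Site : Type := ℤ ⊕ ℤ

/-- A labelling of all regions and wires of a slice. -/
abbrev Cfg : Type := Site → ℕ

/-- Relabel the sites of `S` by `e`. -/
def assign (S : Finset Site) (d : Site → ℕ) (e : (i : {i // i ∈ S}) → Fin (d i)) (σ : Cfg) : Cfg :=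
  fun i => if h : i ∈ S then e ⟨i, h⟩ else σ i

/-- Sum a function of two labellings over common labels of the sites of `S`. -/
def tr (S : Finset Site) (d : Site → ℕ) (F : Cfg → Cfg → ℂ) (σ σ' : Cfg) : ℂ :=
  ∑ e : (i : {i // i ∈ S}) → Fin (d i), F (assign S d e σ) (assign S d e σ')

theorem tr_empty (d : Site → ℕ) (F : Cfg → Cfg → ℂ) (σ σ' : Cfg) : tr ∅ d F σ σ' = F σ σ' := by
  have h : ∀ (e : (i : {i // i ∈ (∅ : Finset Site)}) → Fin (d i)) (σ : Cfg),
      assign ∅ d e σ = σ := fun e σ => by funext i; simp [assign]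
  simp [tr, h]

/-- Replaces the sum over dependent functions by nested sums over single labels; inductions over the
traced set rest on it. -/
theorem tr_insert {S : Finset Site} {i : Site} (hi : i ∉ S) (d : Site → ℕ) (F : Cfg → Cfg → ℂ)
    (σ σ' : Cfg) : tr (insert i S) d F σ σ' =
      ∑ k ∈ Finset.range (d i), tr S d F (Function.update σ i k) (Function.update σ' i k) := by
  let E : (Fin (d i) × ((j : {j // j ∈ S}) → Fin (d j))) ≃
      ((j : {j // j ∈ insert i S}) → Fin (d j)) :=
    { toFun := fun p j => if h : j.1 = i then Fin.cast (by rw [h]) p.1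
        else p.2 ⟨j.1, (Finset.mem_insert.1 j.2).resolve_left h⟩
      invFun := fun g => (g ⟨i, Finset.mem_insert_self i S⟩,
        fun j => g ⟨j.1, Finset.mem_insert_of_mem j.2⟩)
      left_inv := by
        rintro ⟨k, e⟩
        refine Prod.ext ?_ ?_
        · simp
        · funext j
          have : j.1 ≠ i := fun h => hi (h ▸ j.2)
          simp [this]
      right_inv := by
        intro g
        funext ⟨j, hj⟩
        by_cases h : j = i
        · subst h; simp
        · simp [h] }
  have hE : ∀ k e τ, assign (insert i S) d (E (k, e)) τ =
      assign S d e (Function.update τ i (k : ℕ)) := by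
    intro k e τ
    funext j
    by_cases h : j = i
    · subst h; simp [assign, E, hi]
    · by_cases hj : j ∈ S <;> simp [assign, E, h, hj]
  rw [Finset.sum_range]
  simp only [tr]
  rw [← Fintype.sum_prod_type', ← E.sum_comp]
  exact Fintype.sum_congr _ _ fun ⟨k, e⟩ => by simp only [hE]

theorem tr_union {S S' : Finset Site} (h : Disjoint S S') (d : Site → ℕ) (F : Cfg → Cfg → ℂ)
    (σ σ' : Cfg) : tr (S ∪ S') d F σ σ' = tr S d (tr S' d F) σ σ' := by
  induction S using Finset.induction_on generalizing σ σ' with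
  | empty => simp [tr_empty]
  | insert i S hi ih =>
    rw [Finset.disjoint_insert_left] at h
    rw [Finset.insert_union, tr_insert (by simp [hi, h.1]), tr_insert hi]
    simp only [ih h.2]

theorem tr_congr_dim {S : Finset Site} {d d' : Site → ℕ} (h : ∀ i ∈ S, d i = d' i)
    (F : Cfg → Cfg → ℂ) (σ σ' : Cfg) : tr S d F σ σ' = tr S d' F σ σ' := by
  induction S using Finset.induction_on generalizing σ σ' with
  | empty => simp [tr_empty]
  | insert i S hi ih =>
    rw [tr_insert hi, tr_insert hi, h i (by simp)]
    simp only [ih fun j hj => h j (Finset.mem_insert_of_mem hj)]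

/-- Unitarity relations hold only for labels in range and for neighbouring regions common to both
arguments. On the pairs listed in the hypothesis, the only ones that occur in the sum, these side
conditions are available. -/
theorem tr_congr {S : Finset Site} {d : Site → ℕ} {F F' : Cfg → Cfg → ℂ} {σ σ' : Cfg}
    (h : ∀ τ τ' : Cfg, (∀ i ∈ S, τ i = τ' i ∧ τ i < d i) →
      (∀ i ∉ S, τ i = σ i ∧ τ' i = σ' i) → F τ τ' = F' τ τ') :
    tr S d F σ σ' = tr S d F' σ σ' := by
  refine Finset.sum_congr rfl fun e _ => h _ _ ?_ ?_
  · intro i hi; simp [assign, hi]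
  · intro i hi; simp [assign, hi]

theorem tr_sum {α : Type*} (S : Finset Site) (d : Site → ℕ) (s : Finset α)
    (F : α → Cfg → Cfg → ℂ) (σ σ' : Cfg) :
    tr S d (fun τ τ' => ∑ a ∈ s, F a τ τ') σ σ' = ∑ a ∈ s, tr S d (F a) σ σ' :=
  Finset.sum_comm

theorem tr_mul_left (S : Finset Site) (d : Site → ℕ) (k : ℂ)
    (F : Cfg → Cfg → ℂ) (σ σ' : Cfg) :
    tr S d (fun τ τ' => k * F τ τ') σ σ' = k * tr S d F σ σ' :=
  (Finset.mul_sum ..).symm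

/-- The three sites on which a gate in column `c` acts. -/
def gateSites (c : ℤ) : Finset Site := {Sum.inr c, Sum.inr (c - 1), Sum.inl c}

/-- Relabel the three sites of a gate in column `c`. -/
def setGate (σ : Cfg) (c : ℤ) (x : ℕ × ℕ × ℕ) : Cfg :=
  Function.update (Function.update (Function.update σ (Sum.inr c) x.2.2) (Sum.inr (c - 1)) x.1)
    (Sum.inl c) x.2.1

theorem setGate_inl (σ : Cfg) (c : ℤ) (x : ℕ × ℕ × ℕ) (b : ℤ) :
    setGate σ c x (Sum.inl b) = if b = c then x.2.1 else σ (Sum.inl b) := by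
  by_cases h : b = c <;> simp [setGate, h]

theorem setGate_inr (σ : Cfg) (c : ℤ) (x : ℕ × ℕ × ℕ) (b : ℤ) :
    setGate σ c x (Sum.inr b) =
      if b = c then x.2.2 else if b = c - 1 then x.1 else σ (Sum.inr b) := by
  by_cases h : b = c
  · have h' : b ≠ b - 1 := by omega
    subst h; simp [setGate, h']
  · by_cases h' : b = c - 1
    · have h'' : c - 1 ≠ c := by omega
      subst h'; simp [setGate, h'']
    · simp [setGate, h, h']

theorem setGate_setGate (σ : Cfg) (c : ℤ) (x y : ℕ × ℕ × ℕ) :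
    setGate (setGate σ c y) c x = setGate σ c x := by
  funext i
  rcases i with b | b
  · simp only [setGate_inl]; split_ifs <;> rfl
  · simp only [setGate_inr]; split_ifs <;> rfl

theorem setGate_comm (σ : Cfg) {c c' : ℤ} (h : c + 2 ≤ c' ∨ c' + 2 ≤ c) (x y : ℕ × ℕ × ℕ) :
    setGate (setGate σ c y) c' x = setGate (setGate σ c' x) c y := by
  funext i
  rcases i with b | b
  · simp only [setGate_inl]; split_ifs <;> first | rfl | omega
  · simp only [setGate_inr]; split_ifs <;> first | rfl | omega

theorem sum_fin_triple {M : Type*} [AddCommMonoid M] (a b c : ℕ) (f : ℕ × ℕ × ℕ → M) :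
    ∑ y : Fin a × Fin b × Fin c, f (y.1, y.2.1, y.2.2) =
      ∑ x ∈ Finset.range a ×ˢ Finset.range b ×ˢ Finset.range c, f x := by
  simp only [Fintype.sum_prod_type, Finset.sum_product, Finset.sum_range]

/-- An isometry preserves inner products up to `κ`. Finite sets of labels replace index types
because tensors are functions of natural numbers. -/
theorem sum_mul_star_of_isometry {α β : Type*} [DecidableEq β] {Y : Finset α} {X : Finset β}
    {g : α → β → ℂ} {κ : ℂ}
    (h : ∀ x ∈ X, ∀ x' ∈ X, ∑ y ∈ Y, g y x * star (g y x') = if x = x' then κ else 0)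
    (a b : β → ℂ) :
    ∑ y ∈ Y, (∑ x ∈ X, g y x * a x) * star (∑ x ∈ X, g y x * b x) =
      κ * ∑ x ∈ X, a x * star (b x) := by
  have h1 : ∀ y ∈ Y, (∑ x ∈ X, g y x * a x) * star (∑ x ∈ X, g y x * b x) =
      ∑ x ∈ X, ∑ x' ∈ X, (g y x * star (g y x')) * (a x * star (b x')) := by
    intro y _
    rw [star_sum, Finset.sum_mul_sum]
    refine Finset.sum_congr rfl fun x _ => Finset.sum_congr rfl fun x' _ => ?_
    rw [star_mul']; ring
  rw [Finset.sum_congr rfl h1, Finset.sum_comm, Finset.mul_sum]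
  refine Finset.sum_congr rfl fun x hx => ?_
  rw [Finset.sum_comm]
  simp only [← Finset.sum_mul]
  rw [Finset.sum_congr rfl fun x' hx' => by rw [h x hx x' hx']]
  simp [hx]

namespace Circuit

variable (C : Circuit)

/-- Labels of the sites of a gate in column `c` at time `s`. -/
def labels (s : ℕ) (c : ℤ) : Finset (ℕ × ℕ × ℕ) :=
  Finset.range (C.wireDim s (c - 1)) ×ˢ Finset.range (C.regDim s c) ×ˢ
    Finset.range (C.wireDim s c)

/-- Labels on the left of a gate in row `s`, column `c`. -/
def leftLabels (s : ℕ) (c : ℤ) : Finset (ℕ × ℕ × ℕ) :=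
  Finset.range (C.regDim s (c - 1)) ×ˢ Finset.range (C.wireDim s (c - 1)) ×ˢ
    Finset.range (C.wireDim (s + 1) (c - 1))

/-- Labels on the right of a gate in row `s`, column `c`. -/
def rightLabels (s : ℕ) (c : ℤ) : Finset (ℕ × ℕ × ℕ) :=
  Finset.range (C.regDim s (c + 1)) ×ˢ Finset.range (C.wireDim s c) ×ˢ
    Finset.range (C.wireDim (s + 1) c)

variable {C}

theorem matrix_isometry {a b c a' b' c' : ℕ}
    {M : Matrix (Fin a × Fin b × Fin c) (Fin a' × Fin b' × Fin c') ℂ}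
    {g : ℕ × ℕ × ℕ → ℕ × ℕ × ℕ → ℂ} {κ : ℂ}
    (hM : ∀ y x, M y x = g (y.1, y.2.1, y.2.2) (x.1, x.2.1, x.2.2)) (h : Mᴴ * M = κ • 1)
    {x x' : ℕ × ℕ × ℕ} (hx : x ∈ Finset.range a' ×ˢ Finset.range b' ×ˢ Finset.range c')
    (hx' : x' ∈ Finset.range a' ×ˢ Finset.range b' ×ˢ Finset.range c') :
    ∑ y ∈ Finset.range a ×ˢ Finset.range b ×ˢ Finset.range c, g y x * star (g y x') =
      if x = x' then κ else 0 := by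
  simp only [Finset.mem_product, Finset.mem_range] at hx hx'
  rw [← sum_fin_triple]
  have := congrFun (congrFun h (⟨x'.1, hx'.1⟩, ⟨x'.2.1, hx'.2.1⟩, ⟨x'.2.2, hx'.2.2⟩))
    (⟨x.1, hx.1⟩, ⟨x.2.1, hx.2.1⟩, ⟨x.2.2, hx.2.2⟩)
  simp only [Matrix.mul_apply, Matrix.conjTranspose_apply, hM, Matrix.smul_apply, Matrix.one_apply,
    Prod.mk.injEq, Fin.mk.injEq, smul_eq_mul, mul_ite, mul_one, mul_zero] at this
  simp only [mul_comm (g _ x)]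
  rw [this]
  congr 1
  simp only [Prod.ext_iff, eq_comm]

theorem matrix_coisometry {a b c a' b' c' : ℕ}
    {M : Matrix (Fin a × Fin b × Fin c) (Fin a' × Fin b' × Fin c') ℂ}
    {g : ℕ × ℕ × ℕ → ℕ × ℕ × ℕ → ℂ} {κ : ℂ}
    (hM : ∀ y x, M y x = g (y.1, y.2.1, y.2.2) (x.1, x.2.1, x.2.2)) (h : M * Mᴴ = κ • 1)
    {y y' : ℕ × ℕ × ℕ} (hy : y ∈ Finset.range a ×ˢ Finset.range b ×ˢ Finset.range c)
    (hy' : y' ∈ Finset.range a ×ˢ Finset.range b ×ˢ Finset.range c) :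
    ∑ x ∈ Finset.range a' ×ˢ Finset.range b' ×ˢ Finset.range c', g y x * star (g y' x) =
      if y = y' then κ else 0 := by
  simp only [Finset.mem_product, Finset.mem_range] at hy hy'
  rw [← sum_fin_triple]
  have := congrFun (congrFun h (⟨y.1, hy.1⟩, ⟨y.2.1, hy.2.1⟩, ⟨y.2.2, hy.2.2⟩))
    (⟨y'.1, hy'.1⟩, ⟨y'.2.1, hy'.2.1⟩, ⟨y'.2.2, hy'.2.2⟩)
  simp only [Matrix.mul_apply, Matrix.conjTranspose_apply, hM, Matrix.smul_apply, Matrix.one_apply,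
    Prod.mk.injEq, Fin.mk.injEq, smul_eq_mul, mul_ite, mul_one, mul_zero] at this
  rw [this]
  congr 1
  simp only [Prod.ext_iff]

theorem IsBiunitaryAt.vert_isometry {s : ℕ} {c : ℤ} (h : C.IsBiunitaryAt s c) {l r : ℕ}
    (hl : l < C.regDim s (c - 1)) (hr : r < C.regDim s (c + 1)) {x x' : ℕ × ℕ × ℕ}
    (hx : x ∈ C.labels s c) (hx' : x' ∈ C.labels s c) :
    ∑ y ∈ C.labels (s + 1) c, C.gate s c l r y x * star (C.gate s c l r y x') =
      if x = x' then 1 else 0 :=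
  matrix_isometry (M := C.vert s c l r) (g := C.gate s c l r) (fun _ _ => rfl)
    (by rw [(h.1 l hl r hr).2, one_smul]) hx hx'

theorem IsBiunitaryAt.vert_coisometry {s : ℕ} {c : ℤ} (h : C.IsBiunitaryAt s c) {l r : ℕ}
    (hl : l < C.regDim s (c - 1)) (hr : r < C.regDim s (c + 1)) {y y' : ℕ × ℕ × ℕ}
    (hy : y ∈ C.labels (s + 1) c) (hy' : y' ∈ C.labels (s + 1) c) :
    ∑ x ∈ C.labels s c, C.gate s c l r y x * star (C.gate s c l r y' x) =
      if y = y' then 1 else 0 :=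
  matrix_coisometry (M := C.vert s c l r) (g := C.gate s c l r) (fun _ _ => rfl)
    (by rw [(h.1 l hl r hr).1, one_smul]) hy hy'

/-- One `κ` serves both relations and all `m'`, `m`. When gates are peeled off sideways, the lower
region is summed over, and `κ` has to factor out of that sum. -/
theorem IsBiunitaryAt.horiz_isometry {s : ℕ} {c : ℤ} (h : C.IsBiunitaryAt s c) :
    ∃ κ : ℂ, κ ≠ 0 ∧ ∀ m' < C.regDim (s + 1) c, ∀ m < C.regDim s c,
      (∀ x ∈ C.rightLabels s c, ∀ x' ∈ C.rightLabels s c, ∑ y ∈ C.leftLabels s c,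
        C.gate s c y.1 x.1 (y.2.2, m', x.2.2) (y.2.1, m, x.2.1) *
          star (C.gate s c y.1 x'.1 (y.2.2, m', x'.2.2) (y.2.1, m, x'.2.1)) =
          if x = x' then κ else 0) ∧
      (∀ y ∈ C.leftLabels s c, ∀ y' ∈ C.leftLabels s c, ∑ x ∈ C.rightLabels s c,
        C.gate s c y.1 x.1 (y.2.2, m', x.2.2) (y.2.1, m, x.2.1) *
          star (C.gate s c y'.1 x.1 (y'.2.2, m', x.2.2) (y'.2.1, m, x.2.1)) =
          if y = y' then κ else 0) := by
  obtain ⟨κ, hκ, hh⟩ := h.2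
  refine ⟨κ, by exact_mod_cast hκ.ne', fun m' hm' m hm => ⟨fun x hx x' hx' => ?_,
    fun y hy y' hy' => ?_⟩⟩
  · exact matrix_isometry (M := C.horiz s c m' m)
      (g := fun y x => C.gate s c y.1 x.1 (y.2.2, m', x.2.2) (y.2.1, m, x.2.1))
      (fun _ _ => rfl) (hh m' hm' m hm).2 hx hx'
  · exact matrix_coisometry (M := C.horiz s c m' m)
      (g := fun y x => C.gate s c y.1 x.1 (y.2.2, m', x.2.2) (y.2.1, m, x.2.1))
      (fun _ _ => rfl) (hh m' hm' m hm).1 hy hy'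

variable (C)

/-- The action of a gate on functions of labellings. -/
def gateOp (s : ℕ) (c : ℤ) (ψ : Cfg → ℂ) (σ : Cfg) : ℂ :=
  ∑ x ∈ C.labels s c,
    C.gate s c (σ (Sum.inl (c - 1))) (σ (Sum.inl (c + 1)))
      (σ (Sum.inr (c - 1)), σ (Sum.inl c), σ (Sum.inr c)) x * ψ (setGate σ c x)

/-- The action of the gates of row `s` in columns `c, c + 2, …, c + 2 (k - 1)`. -/
def rowOp (s : ℕ) (c : ℤ) : ℕ → (Cfg → ℂ) → Cfg → ℂ
  | 0, ψ => ψ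
  | k + 1, ψ => C.gateOp s (c + 2 * (k : ℤ)) (rowOp s c k ψ)

/-- Evolution through `t` rows on the window of columns `c₀, …, c₀ + 2 n`. -/
def evOp (c₀ : ℤ) (n : ℕ) (ψ : Cfg → ℂ) : ℕ → Cfg → ℂ
  | 0 => ψ
  | s + 1 => C.rowOp s (c₀ + 2 + (s : ℤ)) (n - 1 - s) (evOp c₀ n ψ s)

variable {C}

/-- Gates two or more columns apart act on disjoint sites; they share at most a neighbouring region,
which both read and neither changes. -/
theorem gateOp_comm {c c' : ℤ} (h : c + 2 ≤ c' ∨ c' + 2 ≤ c) (s s' : ℕ) (ψ : Cfg → ℂ) :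
    C.gateOp s c (C.gateOp s' c' ψ) = C.gateOp s' c' (C.gateOp s c ψ) := by
  funext σ
  simp only [gateOp, Finset.mul_sum]
  rw [Finset.sum_comm]
  refine Finset.sum_congr rfl fun x _ => Finset.sum_congr rfl fun y _ => ?_
  rw [setGate_comm σ h]
  have e1 : c' - 1 ≠ c := by omega
  have e2 : c' + 1 ≠ c := by omega
  have e3 : c' ≠ c := by omega
  have e4 : c - 1 ≠ c' := by omega
  have e5 : c + 1 ≠ c' := by omega
  have e6 : c' - 1 ≠ c - 1 := by omega
  have e7 : c' ≠ c - 1 := by omega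
  have e8 : c ≠ c' - 1 := by omega
  simp only [setGate_inl, setGate_inr, e1, e2, e3, e4, e5, e6, e7, e8, e3.symm, e6.symm, if_false]
  ring

theorem gateOp_mul {s : ℕ} {c : ℤ} {f : Cfg → ℂ} (hf : ∀ σ x, f (setGate σ c x) = f σ)
    (ψ : Cfg → ℂ) : C.gateOp s c (fun σ => f σ * ψ σ) = fun σ => f σ * C.gateOp s c ψ σ := by
  funext σ
  simp only [gateOp, hf, Finset.mul_sum]
  exact Finset.sum_congr rfl fun x _ => by ring

theorem gateOp_sum {α : Type*} (s : ℕ) (c : ℤ) (t : Finset α) (ψ : α → Cfg → ℂ) :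
    C.gateOp s c (fun σ => ∑ a ∈ t, ψ a σ) = fun σ => ∑ a ∈ t, C.gateOp s c (ψ a) σ := by
  funext σ
  simp only [gateOp, Finset.mul_sum]
  exact Finset.sum_comm

theorem rowOp_mul {s : ℕ} {c : ℤ} {k : ℕ} {f : Cfg → ℂ}
    (hf : ∀ j < k, ∀ σ x, f (setGate σ (c + 2 * (j : ℤ)) x) = f σ)
    (ψ : Cfg → ℂ) : C.rowOp s c k (fun σ => f σ * ψ σ) = fun σ => f σ * C.rowOp s c k ψ σ := by
  induction k with
  | zero => rfl
  | succ k ih =>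
    rw [rowOp, ih fun j hj => hf j (by omega), gateOp_mul (hf k (by omega))]
    rfl

theorem rowOp_sum {α : Type*} (s : ℕ) (c : ℤ) (k : ℕ) (t : Finset α) (ψ : α → Cfg → ℂ) :
    C.rowOp s c k (fun σ => ∑ a ∈ t, ψ a σ) = fun σ => ∑ a ∈ t, C.rowOp s c k (ψ a) σ := by
  induction k with
  | zero => rfl
  | succ k ih => rw [rowOp, ih, gateOp_sum]; rfl

theorem evOp_mul {c₀ : ℤ} {n t : ℕ} {f : Cfg → ℂ}
    (hf : ∀ c, c₀ + 2 ≤ c → c ≤ c₀ + 2 * (n : ℤ) - 2 → ∀ σ x, f (setGate σ c x) = f σ)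
    (ψ : Cfg → ℂ) : C.evOp c₀ n (fun σ => f σ * ψ σ) t = fun σ => f σ * C.evOp c₀ n ψ t σ := by
  induction t with
  | zero => rfl
  | succ s ih =>
    rw [evOp, ih, rowOp_mul fun j hj => hf _ (by omega) (by omega)]
    rfl

theorem evOp_sum {α : Type*} (c₀ : ℤ) (n t : ℕ) (u : Finset α) (ψ : α → Cfg → ℂ) :
    C.evOp c₀ n (fun σ => ∑ a ∈ u, ψ a σ) t = fun σ => ∑ a ∈ u, C.evOp c₀ n (ψ a) t σ := by
  induction t with
  | zero => rfl
  | succ s ih => rw [evOp, ih, rowOp_sum]; rfl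

theorem gateOp_rowOp_comm {c c' : ℤ} {k : ℕ} (h : c' + 2 ≤ c ∨ c + 2 * (k : ℤ) ≤ c')
    (s s' : ℕ) (ψ : Cfg → ℂ) :
    C.rowOp s c k (C.gateOp s' c' ψ) = C.gateOp s' c' (C.rowOp s c k ψ) := by
  induction k with
  | zero => rfl
  | succ k ih => rw [rowOp, ih (by omega), rowOp, gateOp_comm (by omega)]

theorem rowOp_succ_left (s : ℕ) (c : ℤ) (k : ℕ) (ψ : Cfg → ℂ) :
    C.rowOp s c (k + 1) ψ = C.rowOp s (c + 2) k (C.gateOp s c ψ) := by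
  induction k with
  | zero => simp [rowOp]
  | succ k ih =>
    rw [rowOp, ih, rowOp]
    congr 1
    push_cast; ring

variable (C) in
/-- Successive action of `k` gates, one in each of the rows `0, …, k - 1`, in the columns `γ`. -/
def diagOp (γ : ℕ → ℤ) : ℕ → (Cfg → ℂ) → Cfg → ℂ
  | 0, ψ => ψ
  | k + 1, ψ => C.gateOp k (γ k) (diagOp γ k ψ)

theorem rowOp_diagOp_comm {c : ℤ} {γ : ℕ → ℤ} {k j : ℕ}
    (h : ∀ i < j, γ i + 2 ≤ c ∨ c + 2 * (k : ℤ) ≤ γ i) (s : ℕ) (ψ : Cfg → ℂ) :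
    C.rowOp s c k (C.diagOp γ j ψ) = C.diagOp γ j (C.rowOp s c k ψ) := by
  induction j with
  | zero => rfl
  | succ j ih =>
    rw [diagOp, gateOp_rowOp_comm (h j (by omega)), ih fun i hi => h i (by omega)]
    rfl

/-- One more vertex on the left adds the leftmost gate of each row. These gates form a diagonal that
recedes from later rows: the inner gates of row `s` start in column `c₀ + 4 + s`, at least two
columns from every diagonal gate of an earlier row, so the diagonal can be moved past them and act
last. The bound `t ≤ n` ensures that every row has a gate to split off. -/
theorem evOp_succ_left {c₀ : ℤ} {n t : ℕ} (h : t ≤ n) (ψ : Cfg → ℂ) :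
    C.evOp c₀ (n + 1) ψ t =
      C.diagOp (fun s => c₀ + 2 + (s : ℤ)) t (C.evOp (c₀ + 2) n ψ t) := by
  induction t with
  | zero => rfl
  | succ s ih =>
    rw [evOp, ih (by omega), show n + 1 - 1 - s = (n - 1 - s) + 1 by omega, rowOp_succ_left]
    have : C.gateOp s (c₀ + 2 + (s : ℤ)) (C.diagOp (fun s => c₀ + 2 + (s : ℤ)) s
        (C.evOp (c₀ + 2) n ψ s)) = C.diagOp (fun s => c₀ + 2 + (s : ℤ)) (s + 1)
        (C.evOp (c₀ + 2) n ψ s) := rfl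
    rw [this, rowOp_diagOp_comm fun i hi => Or.inl (by omega), evOp]
    congr 2
    ring

theorem evOp_succ_right {c₀ : ℤ} {n t : ℕ} (h : t ≤ n) (ψ : Cfg → ℂ) :
    C.evOp c₀ (n + 1) ψ t =
      C.diagOp (fun s => c₀ + 2 * (n : ℤ) - (s : ℤ)) t (C.evOp c₀ n ψ t) := by
  induction t with
  | zero => rfl
  | succ s ih =>
    rw [evOp, ih (by omega), show n + 1 - 1 - s = (n - 1 - s) + 1 by omega, rowOp,
      rowOp_diagOp_comm fun i hi => Or.inr (by omega), diagOp, evOp]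
    congr 1
    omega

theorem tr_gateSites (c : ℤ) (d : Site → ℕ) (F : Cfg → Cfg → ℂ) (σ σ' : Cfg) :
    tr (gateSites c) d F σ σ' =
      ∑ y ∈ Finset.range (d (Sum.inr (c - 1))) ×ˢ Finset.range (d (Sum.inl c)) ×ˢ
        Finset.range (d (Sum.inr c)), F (setGate σ c y) (setGate σ' c y) := by
  have h1 : (Sum.inr c : Site) ∉ ({Sum.inr (c - 1), Sum.inl c} : Finset Site) := by
    simp; omega
  have h2 : (Sum.inr (c - 1) : Site) ∉ ({Sum.inl c} : Finset Site) := by simp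
  have h3 : ∀ τ τ' : Cfg, tr {Sum.inl c} d F τ τ' = ∑ k ∈ Finset.range (d (Sum.inl c)),
      F (Function.update τ (Sum.inl c) k) (Function.update τ' (Sum.inl c) k) := by
    intro τ τ'
    rw [← insert_empty_eq, tr_insert (Finset.notMem_empty _)]
    simp only [tr_empty]
  rw [gateSites, tr_insert h1]
  simp only [tr_insert h2, h3, Finset.sum_product, setGate]
  rw [Finset.sum_comm]
  exact Finset.sum_congr rfl fun x _ => Finset.sum_comm

/-- A gate whose sites are all summed over drops out, by vertical unitarity. -/
theorem tr_gateOp {s : ℕ} {c : ℤ} (hb : C.IsBiunitaryAt s c) {S : Finset Site} {d d' : Site → ℕ}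
    (hS : gateSites c ⊆ S)
    (hd : d (Sum.inl c) = C.regDim (s + 1) c ∧ d (Sum.inr (c - 1)) = C.wireDim (s + 1) (c - 1) ∧
      d (Sum.inr c) = C.wireDim (s + 1) c)
    (hd' : d' (Sum.inl c) = C.regDim s c ∧ d' (Sum.inr (c - 1)) = C.wireDim s (c - 1) ∧
      d' (Sum.inr c) = C.wireDim s c)
    (hdd : ∀ i ∈ S, i ∉ gateSites c → d i = d' i) {σ σ' : Cfg}
    (hl : (Sum.inl (c - 1) ∉ S ∧ σ (Sum.inl (c - 1)) = σ' (Sum.inl (c - 1)) ∧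
        σ (Sum.inl (c - 1)) < C.regDim s (c - 1)) ∨
      (Sum.inl (c - 1) ∈ S ∧ d (Sum.inl (c - 1)) = C.regDim s (c - 1)))
    (hr : (Sum.inl (c + 1) ∉ S ∧ σ (Sum.inl (c + 1)) = σ' (Sum.inl (c + 1)) ∧
        σ (Sum.inl (c + 1)) < C.regDim s (c + 1)) ∨
      (Sum.inl (c + 1) ∈ S ∧ d (Sum.inl (c + 1)) = C.regDim s (c + 1)))
    (ψ φ : Cfg → ℂ) :
    tr S d (fun τ τ' => C.gateOp s c ψ τ * star (C.gateOp s c φ τ')) σ σ' =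
      tr S d' (fun τ τ' => ψ τ * star (φ τ')) σ σ' := by
  have hSu : S = (S \ gateSites c) ∪ gateSites c := (Finset.sdiff_union_of_subset hS).symm
  have hdis : Disjoint (S \ gateSites c) (gateSites c) := Finset.sdiff_disjoint
  rw [hSu, tr_union hdis, tr_union hdis,
    ← tr_congr_dim (d := d) (d' := d') (S := S \ gateSites c)
      fun i hi => hdd i (Finset.mem_sdiff.1 hi).1 (Finset.mem_sdiff.1 hi).2]
  refine tr_congr fun τ τ' h1 h2 => ?_
  -- The gate and its conjugate cancel only if both see the same, admissible labels of the left and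
  -- right regions. Such a region is either traced, hence common, or fixed to equal values by
  -- hypothesis.
  have side : ∀ b : ℤ, b ≠ c → (((Sum.inl b : Site) ∉ S ∧ σ (Sum.inl b) = σ' (Sum.inl b) ∧
        σ (Sum.inl b) < C.regDim s b) ∨ (Sum.inl b ∈ S ∧ d (Sum.inl b) = C.regDim s b)) →
      τ (Sum.inl b) = τ' (Sum.inl b) ∧ τ (Sum.inl b) < C.regDim s b := by
    intro b hbc hb
    have hng : (Sum.inl b : Site) ∉ gateSites c := by simp [gateSites, hbc]
    by_cases hbS : (Sum.inl b : Site) ∈ S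
    · have := h1 (Sum.inl b) (Finset.mem_sdiff.2 ⟨hbS, hng⟩)
      rcases hb with hb | hb
      · exact absurd hbS hb.1
      · exact ⟨this.1, hb.2 ▸ this.2⟩
    · rcases hb with hb | hb
      · have := h2 (Sum.inl b) fun h => hbS (Finset.mem_sdiff.1 h).1
        rw [this.1, this.2]; exact hb.2
      · exact absurd hb.1 hbS
  obtain ⟨l1, l2⟩ := side (c - 1) (by omega) hl
  obtain ⟨r1, r2⟩ := side (c + 1) (by omega) hr
  rw [tr_gateSites, tr_gateSites, hd.1, hd.2.1, hd.2.2, hd'.1, hd'.2.1, hd'.2.2]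
  have hiso := sum_mul_star_of_isometry (Y := C.labels (s + 1) c) (X := C.labels s c)
    (g := C.gate s c (τ (Sum.inl (c - 1))) (τ (Sum.inl (c + 1)))) (κ := 1)
    (fun x hx x' hx' => hb.vert_isometry l2 r2 hx hx')
    (fun x => ψ (setGate τ c x)) (fun x => φ (setGate τ' c x))
  rw [one_mul] at hiso
  rw [← labels, ← labels, ← hiso]
  refine Finset.sum_congr rfl fun y _ => ?_
  have e1 : c - 1 ≠ c := by omega
  have e2 : c + 1 ≠ c := by omega
  simp only [gateOp, setGate_setGate, setGate_inl, setGate_inr, e1, e2, if_false, if_true, l1, r1]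

end Circuit

end

/-! ### Gates outside the light cone cancel. -/

section

/-- Row at which the region in column `c` leaves the evolved window `c₀, …, c₀ + 2 n`. -/
def regTime (c₀ : ℤ) (n t : ℕ) (c : ℤ) : ℕ :=
  min t (min (c - c₀).toNat (c₀ + 2 * (n : ℤ) - c).toNat)

/-- Row at which wire `c` leaves the evolved window `c₀, …, c₀ + 2 n`. -/
def wireTime (c₀ : ℤ) (n t : ℕ) (c : ℤ) : ℕ :=
  min t (min (c - c₀).toNat (c₀ + 2 * (n : ℤ) - 1 - c).toNat)

theorem regTime_eq {c₀ c : ℤ} {n i j : ℕ} (t : ℕ) (hi : (c - c₀).toNat = i)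
    (hj : (c₀ + 2 * (n : ℤ) - c).toNat = j) : regTime c₀ n t c = min t (min i j) := by
  rw [regTime, hi, hj]

theorem wireTime_eq {c₀ c : ℤ} {n i j : ℕ} (t : ℕ) (hi : (c - c₀).toNat = i)
    (hj : (c₀ + 2 * (n : ℤ) - 1 - c).toNat = j) : wireTime c₀ n t c = min t (min i j) := by
  rw [wireTime, hi, hj]

/-- The second alternative occurs for the left neighbour `c = c₀ + 1 + k` of gate `k`: its nominal
time advances although no gate acts in that column, and the parity recorded here shows that its
label set does not change. -/
theorem regTime_step_left {c₀ c : ℤ} {n t k : ℕ} (hc : c₀ % 2 = 0) (hk : k < t) (ht : t ≤ n)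
    (h1 : c₀ ≤ c) (h2 : c ≤ c₀ + 2 * (n : ℤ) + 2) (h3 : c ≠ c₀ + 2 + k) :
    max (regTime (c₀ + 2) n t c) (regTime c₀ (n + 1) (k + 1) c) =
        max (regTime (c₀ + 2) n t c) (regTime c₀ (n + 1) k c) ∨
      max (regTime (c₀ + 2) n t c) (regTime c₀ (n + 1) (k + 1) c) =
        max (regTime (c₀ + 2) n t c) (regTime c₀ (n + 1) k c) + 1 ∧
      (c + (max (regTime (c₀ + 2) n t c) (regTime c₀ (n + 1) k c) : ℕ)) % 2 = 1 := by
  obtain ⟨i, hi⟩ : ∃ i : ℕ, c = c₀ + i := ⟨(c - c₀).toNat, by omega⟩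
  obtain ⟨j, hj⟩ : ∃ j : ℕ, i + j = 2 * n + 2 := ⟨2 * n + 2 - i, by omega⟩
  rw [regTime_eq t (c₀ := c₀ + 2) (i := i - 2) (j := j) (by omega) (by omega),
    regTime_eq k (i := i) (j := j) (by omega) (by push_cast; omega),
    regTime_eq (k + 1) (i := i) (j := j) (by omega) (by push_cast; omega)]
  rcases lt_trichotomy i (k + 1) with h | h | h
  · left; congr 1; omega
  · right
    have e1 : max (min t (min (i - 2) j)) (min k (min i j)) = k := by omega
    have e2 : max (min t (min (i - 2) j)) (min (k + 1) (min i j)) = k + 1 := by omega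
    rw [e1, e2]; omega
  · left; omega

theorem wireTime_step_left {c₀ c : ℤ} {n t k : ℕ} (hk : k < t) (ht : t ≤ n)
    (h1 : c₀ ≤ c) (h2 : c < c₀ + 2 * (n : ℤ) + 2) (h3 : c ≠ c₀ + 2 + k) (h4 : c ≠ c₀ + 1 + k) :
    max (wireTime (c₀ + 2) n t c) (wireTime c₀ (n + 1) (k + 1) c) =
      max (wireTime (c₀ + 2) n t c) (wireTime c₀ (n + 1) k c) := by
  obtain ⟨i, hi⟩ : ∃ i : ℕ, c = c₀ + i := ⟨(c - c₀).toNat, by omega⟩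
  obtain ⟨j, hj⟩ : ∃ j : ℕ, i + j = 2 * n + 1 := ⟨2 * n + 1 - i, by omega⟩
  rw [wireTime_eq t (c₀ := c₀ + 2) (i := i - 2) (j := j) (by omega) (by omega),
    wireTime_eq k (i := i) (j := j) (by omega) (by push_cast; omega),
    wireTime_eq (k + 1) (i := i) (j := j) (by omega) (by push_cast; omega)]
  omega

theorem regTime_step_right {c₀ c : ℤ} {n t k : ℕ} (hc : c₀ % 2 = 0) (hk : k < t) (ht : t ≤ n)
    (h1 : c₀ ≤ c) (h2 : c ≤ c₀ + 2 * (n : ℤ) + 2) (h3 : c ≠ c₀ + 2 * (n : ℤ) - k) :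
    max (regTime c₀ n t c) (regTime c₀ (n + 1) (k + 1) c) =
        max (regTime c₀ n t c) (regTime c₀ (n + 1) k c) ∨
      max (regTime c₀ n t c) (regTime c₀ (n + 1) (k + 1) c) =
        max (regTime c₀ n t c) (regTime c₀ (n + 1) k c) + 1 ∧
      (c + (max (regTime c₀ n t c) (regTime c₀ (n + 1) k c) : ℕ)) % 2 = 1 := by
  obtain ⟨i, hi⟩ : ∃ i : ℕ, c = c₀ + i := ⟨(c - c₀).toNat, by omega⟩
  obtain ⟨j, hj⟩ : ∃ j : ℕ, i + j = 2 * n + 2 := ⟨2 * n + 2 - i, by omega⟩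
  rw [regTime_eq t (c₀ := c₀) (n := n) (i := i) (j := j - 2) (by omega) (by omega),
    regTime_eq k (i := i) (j := j) (by omega) (by push_cast; omega),
    regTime_eq (k + 1) (i := i) (j := j) (by omega) (by push_cast; omega)]
  rcases lt_trichotomy j (k + 1) with h | h | h
  · left; congr 1; omega
  · right
    have e1 : max (min t (min i (j - 2))) (min k (min i j)) = k := by omega
    have e2 : max (min t (min i (j - 2))) (min (k + 1) (min i j)) = k + 1 := by omega
    rw [e1, e2]; omega
  · left; omega

theorem wireTime_step_right {c₀ c : ℤ} {n t k : ℕ} (hk : k < t) (ht : t ≤ n)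
    (h1 : c₀ ≤ c) (h2 : c < c₀ + 2 * (n : ℤ) + 2) (h3 : c ≠ c₀ + 2 * (n : ℤ) - k)
    (h4 : c ≠ c₀ + 2 * (n : ℤ) - k - 1) :
    max (wireTime c₀ n t c) (wireTime c₀ (n + 1) (k + 1) c) =
      max (wireTime c₀ n t c) (wireTime c₀ (n + 1) k c) := by
  obtain ⟨i, hi⟩ : ∃ i : ℕ, c = c₀ + i := ⟨(c - c₀).toNat, by omega⟩
  obtain ⟨j, hj⟩ : ∃ j : ℕ, i + j = 2 * n + 1 := ⟨2 * n + 1 - i, by omega⟩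
  rw [wireTime_eq t (c₀ := c₀) (n := n) (i := i) (j := j - 2) (by omega) (by omega),
    wireTime_eq k (i := i) (j := j) (by omega) (by push_cast; omega),
    wireTime_eq (k + 1) (i := i) (j := j) (by omega) (by push_cast; omega)]
  omega
/-- The sites of the window `c₀, …, c₀ + 2 n` outside the subsystem with bounding regions
`x`, `y`. -/
def env (c₀ : ℤ) (n : ℕ) (x y : ℤ) : Finset Site :=
  (Finset.Icc c₀ (c₀ + 2 * (n : ℤ)) \ Finset.Icc x y).disjSum
    (Finset.Ico c₀ (c₀ + 2 * (n : ℤ)) \ Finset.Ico x y)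

theorem inl_mem_env {c₀ : ℤ} {n : ℕ} {x y c : ℤ} : (Sum.inl c : Site) ∈ env c₀ n x y ↔
    (c₀ ≤ c ∧ c ≤ c₀ + 2 * (n : ℤ)) ∧ ¬ (x ≤ c ∧ c ≤ y) := by
  simp only [env, Finset.inl_mem_disjSum, Finset.mem_sdiff, Finset.mem_Icc]

theorem inr_mem_env {c₀ : ℤ} {n : ℕ} {x y c : ℤ} : (Sum.inr c : Site) ∈ env c₀ n x y ↔
    (c₀ ≤ c ∧ c < c₀ + 2 * (n : ℤ)) ∧ ¬ (x ≤ c ∧ c < y) := by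
  simp only [env, Finset.inr_mem_disjSum, Finset.mem_sdiff, Finset.mem_Ico]

namespace Circuit

variable (C : Circuit)

/-- Sizes of the label sets on the upper boundary of an evolved window. -/
def winDim (c₀ : ℤ) (n t : ℕ) : Site → ℕ
  | Sum.inl c => C.regDim (regTime c₀ n t c) c
  | Sum.inr c => C.wireDim (wireTime c₀ n t c) c

/-- Label set sizes after the first `k` gates of the outermost diagonal of the window
`c₀, …, c₀ + 2 n` have been applied on top of the evolved window `c₀', …, c₀' + 2 n'`. -/
def stepDim (c₀ : ℤ) (n : ℕ) (c₀' : ℤ) (n' t k : ℕ) : Site → ℕ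
  | Sum.inl c => C.regDim (max (regTime c₀' n' t c) (regTime c₀ n k c)) c
  | Sum.inr c => C.wireDim (max (wireTime c₀' n' t c) (wireTime c₀ n k c)) c

variable {C}

theorem regDim_eq_of_step {c : ℤ} {s s' : ℕ} (h : s' = s ∨ (s' = s + 1 ∧ (c + s) % 2 = 1)) :
    C.regDim s' c = C.regDim s c := by
  rcases h with rfl | ⟨rfl, h⟩
  · rfl
  · exact C.regDim_succ s c (by rw [Int.not_even_iff]; exact h)

/-- A diagonal of gates whose sites are all summed over drops out. -/
theorem tr_diagOp {t : ℕ} (hbi : C.IsBiunitary t) {γ : ℕ → ℤ}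
    (hγ : ∀ k < t, Even (γ k + (k : ℤ))) {S : Finset Site} {δ : ℕ → Site → ℕ}
    (hS : ∀ k < t, gateSites (γ k) ⊆ S)
    (hd : ∀ k < t, δ (k + 1) (Sum.inl (γ k)) = C.regDim (k + 1) (γ k) ∧
      δ (k + 1) (Sum.inr (γ k - 1)) = C.wireDim (k + 1) (γ k - 1) ∧
      δ (k + 1) (Sum.inr (γ k)) = C.wireDim (k + 1) (γ k))
    (hd' : ∀ k < t, δ k (Sum.inl (γ k)) = C.regDim k (γ k) ∧
      δ k (Sum.inr (γ k - 1)) = C.wireDim k (γ k - 1) ∧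
      δ k (Sum.inr (γ k)) = C.wireDim k (γ k))
    (hdd : ∀ k < t, ∀ i ∈ S, i ∉ gateSites (γ k) → δ (k + 1) i = δ k i) {σ σ' : Cfg}
    (hn : ∀ k < t, ∀ b, b = γ k - 1 ∨ b = γ k + 1 →
      (Sum.inl b ∉ S ∧ σ (Sum.inl b) = σ' (Sum.inl b) ∧ σ (Sum.inl b) < C.regDim k b) ∨
      (Sum.inl b ∈ S ∧ δ (k + 1) (Sum.inl b) = C.regDim k b))
    (ψ φ : Cfg → ℂ) :
    tr S (δ t) (fun τ τ' => C.diagOp γ t ψ τ * star (C.diagOp γ t φ τ')) σ σ' =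
      tr S (δ 0) (fun τ τ' => ψ τ * star (φ τ')) σ σ' := by
  suffices h : ∀ k ≤ t,
      tr S (δ k) (fun τ τ' => C.diagOp γ k ψ τ * star (C.diagOp γ k φ τ')) σ σ' =
      tr S (δ 0) (fun τ τ' => ψ τ * star (φ τ')) σ σ' from h t le_rfl
  intro k hk
  induction k with
  | zero => rfl
  | succ k ih =>
    rw [← ih (by omega)]
    exact tr_gateOp (hbi k hk (γ k) (hγ k hk)) (hS k hk) (hd k hk) (hd' k hk) (hdd k hk)
      (hn k hk _ (Or.inl rfl)) (hn k hk _ (Or.inr rfl)) _ _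

/-- The two windows differ by the outer diagonal, whose top gate sits in column `c₀ + 1 + t`. Under
`c₀ + 2 + t ≤ x` all its sites are traced, so it cancels gate by gate from the top. The sites of the
dropped vertex stay in the traced set and keep their label sets from time `0`. -/
theorem tr_evOp_left {t : ℕ} (hbi : C.IsBiunitary t) {c₀ : ℤ} {n : ℕ} {x y : ℤ}
    (hc : c₀ % 2 = 0) (hxy : x < y) (hx : c₀ + 2 + (t : ℤ) ≤ x)
    (hy : y + (t : ℤ) ≤ c₀ + 2 * (n : ℤ) + 2) {σ σ' : Cfg}
    (hσx : σ (Sum.inl x) = σ' (Sum.inl x)) (hσx' : σ (Sum.inl x) < C.regDim t x)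
    (ψ φ : Cfg → ℂ) :
    tr (env c₀ (n + 1) x y) (C.winDim c₀ (n + 1) t)
        (fun τ τ' => C.evOp c₀ (n + 1) ψ t τ * star (C.evOp c₀ (n + 1) φ t τ')) σ σ' =
      tr (env c₀ (n + 1) x y) (C.winDim (c₀ + 2) n t)
        (fun τ τ' => C.evOp (c₀ + 2) n ψ t τ * star (C.evOp (c₀ + 2) n φ t τ')) σ σ' := by
  have ht : t ≤ n := by omega
  rw [evOp_succ_left ht, evOp_succ_left ht]
  have e1 : C.winDim c₀ (n + 1) t = C.stepDim c₀ (n + 1) (c₀ + 2) n t t := by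
    funext i
    rcases i with c | c
    · simp only [winDim, stepDim, regTime]; congr 1; push_cast; omega
    · simp only [winDim, stepDim, wireTime]; congr 1; push_cast; omega
  have e2 : C.winDim (c₀ + 2) n t = C.stepDim c₀ (n + 1) (c₀ + 2) n t 0 := by
    funext i
    rcases i with c | c
    · simp only [winDim, stepDim, regTime]; congr 1; push_cast; omega
    · simp only [winDim, stepDim, wireTime]; congr 1; push_cast; omega
  rw [e1, e2]
  refine tr_diagOp hbi (δ := C.stepDim c₀ (n + 1) (c₀ + 2) n t) ?_ ?_ ?_ ?_ ?_ ?_ _ _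
  · intro k _; rw [Int.even_iff]; omega
  · intro k hk i hi
    simp only [gateSites, Finset.mem_insert, Finset.mem_singleton] at hi
    rcases hi with rfl | rfl | rfl
    · rw [inr_mem_env]; push_cast; omega
    · rw [inr_mem_env]; push_cast; omega
    · rw [inl_mem_env]; push_cast; omega
  · intro k hk
    simp only [stepDim, regTime, wireTime]
    refine ⟨?_, ?_, ?_⟩ <;> congr 1 <;> push_cast <;> omega
  · intro k hk
    simp only [stepDim, regTime, wireTime]
    refine ⟨?_, ?_, ?_⟩ <;> congr 1 <;> push_cast <;> omega
  · intro k hk i hi hg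
    simp only [gateSites, Finset.mem_insert, Finset.mem_singleton, not_or] at hg
    rcases i with c | c
    · simp only [Sum.inl.injEq, reduceCtorEq, not_false_eq_true, true_and] at hg
      rw [inl_mem_env] at hi
      push_cast at hi
      exact regDim_eq_of_step
        (regTime_step_left hc hk ht (by omega) (by omega) (by rintro rfl; exact hg rfl))
    · simp only [Sum.inr.injEq, reduceCtorEq, not_false_eq_true, and_true] at hg
      rw [inr_mem_env] at hi
      push_cast at hi
      exact congrArg (C.wireDim · c) (wireTime_step_left hk ht (by omega) (by omega)
        (by rintro rfl; exact hg.1 rfl) (by rintro rfl; exact hg.2 (by ring)))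
  · intro k hk b hb
    -- The open region `x` can only be the right neighbour of the top gate, `k = t - 1`; no gate of
    -- that row acts in its column, so its label sets at times `k` and `t` coincide.
    by_cases hbx : b = x
    · subst hbx
      refine Or.inl ⟨by rw [inl_mem_env]; omega, hσx, ?_⟩
      rwa [← regDim_eq_of_step (s := k) (s' := t) (by omega)]
    · refine Or.inr ⟨by rw [inl_mem_env]; push_cast; omega, ?_⟩
      simp only [stepDim]
      refine regDim_eq_of_step ?_
      simp only [regTime]
      push_cast
      omega

theorem tr_evOp_right {t : ℕ} (hbi : C.IsBiunitary t) {c₀ : ℤ} {n : ℕ} {x y : ℤ}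
    (hc : c₀ % 2 = 0) (hxy : x < y) (hx : c₀ + (t : ℤ) ≤ x)
    (hy : y + (t : ℤ) ≤ c₀ + 2 * (n : ℤ)) {σ σ' : Cfg}
    (hσy : σ (Sum.inl y) = σ' (Sum.inl y)) (hσy' : σ (Sum.inl y) < C.regDim t y)
    (ψ φ : Cfg → ℂ) :
    tr (env c₀ (n + 1) x y) (C.winDim c₀ (n + 1) t)
        (fun τ τ' => C.evOp c₀ (n + 1) ψ t τ * star (C.evOp c₀ (n + 1) φ t τ')) σ σ' =
      tr (env c₀ (n + 1) x y) (C.winDim c₀ n t)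
        (fun τ τ' => C.evOp c₀ n ψ t τ * star (C.evOp c₀ n φ t τ')) σ σ' := by
  have ht : t ≤ n := by omega
  rw [evOp_succ_right ht, evOp_succ_right ht]
  have e1 : C.winDim c₀ (n + 1) t = C.stepDim c₀ (n + 1) c₀ n t t := by
    funext i
    rcases i with c | c
    · simp only [winDim, stepDim, regTime]; congr 1; push_cast; omega
    · simp only [winDim, stepDim, wireTime]; congr 1; push_cast; omega
  have e2 : C.winDim c₀ n t = C.stepDim c₀ (n + 1) c₀ n t 0 := by
    funext i
    rcases i with c | c
    · simp only [winDim, stepDim, regTime]; congr 1; push_cast; omega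
    · simp only [winDim, stepDim, wireTime]; congr 1; push_cast; omega
  rw [e1, e2]
  refine tr_diagOp hbi (δ := C.stepDim c₀ (n + 1) c₀ n t) ?_ ?_ ?_ ?_ ?_ ?_ _ _
  · intro k _; rw [Int.even_iff]; omega
  · intro k hk i hi
    simp only [gateSites, Finset.mem_insert, Finset.mem_singleton] at hi
    rcases hi with rfl | rfl | rfl
    · rw [inr_mem_env]; push_cast; omega
    · rw [inr_mem_env]; push_cast; omega
    · rw [inl_mem_env]; push_cast; omega
  · intro k hk
    simp only [stepDim, regTime, wireTime]
    refine ⟨?_, ?_, ?_⟩ <;> congr 1 <;> push_cast <;> omega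
  · intro k hk
    simp only [stepDim, regTime, wireTime]
    refine ⟨?_, ?_, ?_⟩ <;> congr 1 <;> push_cast <;> omega
  · intro k hk i hi hg
    simp only [gateSites, Finset.mem_insert, Finset.mem_singleton, not_or] at hg
    rcases i with c | c
    · simp only [Sum.inl.injEq, reduceCtorEq, not_false_eq_true, true_and] at hg
      rw [inl_mem_env] at hi
      push_cast at hi
      exact regDim_eq_of_step
        (regTime_step_right hc hk ht (by omega) (by omega) (by rintro rfl; exact hg rfl))
    · simp only [Sum.inr.injEq, reduceCtorEq, not_false_eq_true, and_true] at hg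
      rw [inr_mem_env] at hi
      push_cast at hi
      exact congrArg (C.wireDim · c) (wireTime_step_right hk ht (by omega) (by omega)
        (by rintro rfl; exact hg.1 rfl) (by rintro rfl; exact hg.2 (by ring)))
  · intro k hk b hb
    by_cases hby : b = y
    · subst hby
      refine Or.inl ⟨by rw [inl_mem_env]; omega, hσy, ?_⟩
      rwa [← regDim_eq_of_step (s := k) (s' := t) (by omega)]
    · refine Or.inr ⟨by rw [inl_mem_env]; push_cast; omega, ?_⟩
      simp only [stepDim]
      refine regDim_eq_of_step ?_
      simp only [regTime]
      push_cast
      omega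

end Circuit

end

/-! ### Matrix product states and the action of transfer matrices on the boundary density. -/

section

/-- `ψ` does not depend on the label of site `i`. -/
def Indep (i : Site) (ψ : Cfg → ℂ) : Prop := ∀ σ k, ψ (Function.update σ i k) = ψ σ

theorem setGate_update_of_notMem {c : ℤ} {i : Site} (hi : i ∉ gateSites c) (σ : Cfg) (k : ℕ)
    (x : ℕ × ℕ × ℕ) : setGate (Function.update σ i k) c x =
      Function.update (setGate σ c x) i k := by
  simp only [gateSites, Finset.mem_insert, Finset.mem_singleton, not_or] at hi
  simp only [setGate]
  rw [Function.update_comm hi.1, Function.update_comm hi.2.1, Function.update_comm hi.2.2]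

namespace Circuit

variable {C : Circuit}

theorem gateOp_indep {s : ℕ} {c : ℤ} {i : Site} (hi : i ∉ gateSites c)
    (hl : i ≠ Sum.inl (c - 1)) (hr : i ≠ Sum.inl (c + 1)) {ψ : Cfg → ℂ} (h : Indep i ψ) :
    Indep i (C.gateOp s c ψ) := by
  intro σ k
  have hi' := hi
  simp only [gateSites, Finset.mem_insert, Finset.mem_singleton, not_or] at hi'
  simp only [gateOp, setGate_update_of_notMem hi, h _ k, Function.update_of_ne hl.symm,
    Function.update_of_ne hr.symm, Function.update_of_ne (Ne.symm hi'.1),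
    Function.update_of_ne (Ne.symm hi'.2.1), Function.update_of_ne (Ne.symm hi'.2.2)]

theorem rowOp_indep {s : ℕ} {c : ℤ} {k : ℕ} {i : Site}
    (hi : ∀ j < k, i ∉ gateSites (c + 2 * (j : ℤ)) ∧ i ≠ Sum.inl (c + 2 * (j : ℤ) - 1) ∧
      i ≠ Sum.inl (c + 2 * (j : ℤ) + 1)) {ψ : Cfg → ℂ} (h : Indep i ψ) :
    Indep i (C.rowOp s c k ψ) := by
  induction k with
  | zero => exact h
  | succ k ih =>
    have := hi k (by omega)
    exact gateOp_indep this.1 this.2.1 this.2.2 (ih fun j hj => hi j (by omega))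

theorem evOp_indep {c₀ : ℤ} {n t : ℕ} {i : Site}
    (hi : ∀ c, c₀ + 2 ≤ c → c ≤ c₀ + 2 * (n : ℤ) - 2 → i ∉ gateSites c ∧ i ≠ Sum.inl (c - 1) ∧
      i ≠ Sum.inl (c + 1)) {ψ : Cfg → ℂ} (h : Indep i ψ) :
    Indep i (C.evOp c₀ n ψ t) := by
  induction t with
  | zero => exact h
  | succ s ih => exact rowOp_indep (fun j hj => hi _ (by omega) (by omega)) ih

theorem evOp_indep_of_outside {c₀ : ℤ} {n t : ℕ} {i : Site}
    (hi : Sum.elim (fun c => c < c₀ ∨ c₀ + 2 * (n : ℤ) < c)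
      (fun c => c < c₀ ∨ c₀ + 2 * (n : ℤ) ≤ c) i) {ψ : Cfg → ℂ} (h : Indep i ψ) :
    Indep i (C.evOp c₀ n ψ t) := by
  refine evOp_indep (fun c h1 h2 => ?_) h
  rcases i with b | b
  · simp only [Sum.elim_inl] at hi
    simp only [gateSites, Finset.mem_insert, Finset.mem_singleton, reduceCtorEq, false_or,
      Sum.inl.injEq, ne_eq]
    omega
  · simp only [Sum.elim_inr] at hi
    simp only [gateSites, Finset.mem_insert, Finset.mem_singleton, reduceCtorEq, or_false,
      Sum.inr.injEq, ne_eq, not_false_eq_true, and_true]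
    omega

end Circuit

/-- The amplitude of a vertex of the initial state at the labels given by `σ`. -/
def ampAt (N : ℤ → StateTensor) (j : ℤ) (σ : Cfg) (ξ η : ℕ) : ℂ :=
  (N j).amp (σ (Sum.inl (2 * j))) ξ (σ (Sum.inr (2 * j))) (σ (Sum.inl (2 * j + 1)))
    (σ (Sum.inr (2 * j + 1))) η (σ (Sum.inl (2 * j + 2)))

/-- The matrix product of `k` vertices starting from vertex `j`, as a function of labellings. -/
def chainAt (N : ℤ → StateTensor) (j : ℤ) (k : ℕ) (ξ η : ℕ) (σ : Cfg) : ℂ :=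
  chain N j (fun c => σ (Sum.inl c)) (fun c => σ (Sum.inr c)) k ξ η

theorem chainAt_zero (N : ℤ → StateTensor) (j : ℤ) (ξ η : ℕ) (σ : Cfg) :
    chainAt N j 0 ξ η σ = if ξ = η then 1 else 0 := rfl

theorem chainAt_succ (N : ℤ → StateTensor) (j : ℤ) (k : ℕ) (ξ η : ℕ) (σ : Cfg) :
    chainAt N j (k + 1) ξ η σ = ∑ ζ ∈ Finset.range (N (j + (k : ℤ))).leftAux,
      ampAt N (j + (k : ℤ)) σ ζ η * chainAt N j k ξ ζ σ := by
  rw [chainAt, chain]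
  exact Finset.sum_congr rfl fun _ _ => mul_comm _ _

/-- The empty product is a delta function on all natural numbers, hence an identity only for
auxiliary labels in range; this is why both bounds are needed. -/
theorem chainAt_succ_left (N : ℤ → StateTensor) (j : ℤ) (k : ℕ) {ξ η : ℕ}
    (hξ : ξ < (N j).leftAux) (hη : η < (N (j + 1 + (k : ℤ))).leftAux) (σ : Cfg) :
    chainAt N j (k + 1) ξ η σ = ∑ ζ ∈ Finset.range (N (j + 1)).leftAux,
      ampAt N j σ ξ ζ * chainAt N (j + 1) k ζ η σ := by
  induction k generalizing η with
  | zero =>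
    rw [Nat.cast_zero, add_zero] at hη
    simp [chainAt_succ, chainAt_zero, hξ, hη]
  | succ k ih =>
    rw [chainAt_succ]
    simp only [chainAt_succ N (j + 1) k, Finset.mul_sum]
    rw [Finset.sum_comm]
    have e : j + ((k + 1 : ℕ) : ℤ) = j + 1 + (k : ℤ) := by push_cast; ring
    rw [e]
    refine Finset.sum_congr rfl fun ζ hζ => ?_
    rw [ih (Finset.mem_range.1 hζ), Finset.mul_sum]
    exact Finset.sum_congr rfl fun _ _ => by ring

theorem chainAt_indep (N : ℤ → StateTensor) (j : ℤ) (k : ℕ) (ξ η : ℕ) {i : Site}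
    (hi : Sum.elim (fun c => c < 2 * j ∨ 2 * j + 2 * (k : ℤ) < c)
      (fun c => c < 2 * j ∨ 2 * j + 2 * (k : ℤ) ≤ c) i) : Indep i (chainAt N j k ξ η) := by
  induction k generalizing η with
  | zero => intro σ a; rfl
  | succ k ih =>
    intro σ a
    rw [chainAt_succ, chainAt_succ]
    refine Finset.sum_congr rfl fun ζ _ => ?_
    rw [ih ζ (by rcases i with c | c <;> simp only [Sum.elim_inl, Sum.elim_inr] at hi ⊢ <;> omega)]
    congr 1
    have hne : ∀ i', Sum.elim (fun c => 2 * j ≤ c ∧ c ≤ 2 * j + 2 * ((k + 1 : ℕ) : ℤ))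
        (fun c => 2 * j ≤ c ∧ c < 2 * j + 2 * ((k + 1 : ℕ) : ℤ)) i' → i' ≠ i := by
      rintro (c | c) hi' rfl <;> simp only [Sum.elim_inl, Sum.elim_inr] at hi hi' <;> omega
    simp only [ampAt]
    rw [Function.update_of_ne, Function.update_of_ne, Function.update_of_ne, Function.update_of_ne,
      Function.update_of_ne]
    all_goals
      apply hne
      simp only [Sum.elim_inl, Sum.elim_inr]
      omega

/-- Pairs of labels of the left auxiliary wire of vertex `j` and its conjugate. -/
def auxPairs (N : ℤ → StateTensor) (j : ℤ) : Finset (ℕ × ℕ) :=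
  Finset.range (N j).leftAux ×ˢ Finset.range (N j).leftAux

/-- Left labels of the transfer matrix of vertex `j`. -/
def cutLabels (N : ℤ → StateTensor) (j : ℤ) : Finset (ℕ × ℕ × ℕ) :=
  Finset.range (N j).leftReg ×ˢ auxPairs N j

/-- The partial trace over the complement of the subsystem bounded by the regions `x`, `y`, of the
window of the vertices `j, …, j + n - 1` evolved through `t` rows, as a linear function of the
boundary density `X`. -/
def Tform (C : Circuit) (N : ℤ → StateTensor) (t : ℕ) (x y : ℤ) (j : ℤ) (n : ℕ)
    (X : ℕ × ℕ × ℕ → ℕ × ℕ × ℕ → ℂ) (σ σ' : Cfg) : ℂ :=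
  tr (env (2 * j) n x y) (C.winDim (2 * j) n t) (fun τ τ' =>
    ∑ p ∈ auxPairs N j, ∑ q ∈ auxPairs N (j + n),
      X (τ (Sum.inl (2 * j)), p) (τ (Sum.inl (2 * j + 2 * n)), q) *
        (C.evOp (2 * j) n (chainAt N j n p.1 q.1) t τ *
          star (C.evOp (2 * j) n (chainAt N j n p.2 q.2) t τ'))) σ σ'

/-- Interchange of finite sums: tracing the outer labels of one vertex and its conjugate assembles a
transfer matrix acting on `X`, while `V`, `V'` stand for the rest of the state. The form is neutral
enough to serve both ends. -/
theorem transfer_shuffle {Q R M W W' : Finset ℕ} {P : Finset (ℕ × ℕ)}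
    (X : ℕ × ℕ × ℕ → ℂ) (a : ℕ → ℕ → ℕ → ℕ → ℕ → ℕ → ℂ) (V V' : ℕ → ℂ) :
    ∑ p ∈ P, ∑ l ∈ R, ∑ m ∈ M, ∑ w ∈ W, ∑ w' ∈ W', X (l, p) *
      ((∑ ζ ∈ Q, a l p.1 m w w' ζ * V ζ) * star (∑ ζ ∈ Q, a l p.2 m w w' ζ * V' ζ)) =
    ∑ q ∈ Q ×ˢ Q, (∑ y ∈ R ×ˢ P, X y * ∑ m ∈ M, ∑ w ∈ W, ∑ w' ∈ W',
      a y.1 y.2.1 m w w' q.1 * star (a y.1 y.2.2 m w w' q.2)) * (V q.1 * star (V' q.2)) := by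
  simp only [Finset.sum_mul (R ×ˢ P)]
  rw [Finset.sum_comm (s := Q ×ˢ Q), Finset.sum_product, Finset.sum_comm]
  refine Finset.sum_congr rfl fun l _ => Finset.sum_congr rfl fun p _ => ?_
  simp only [Finset.mul_sum (M), Finset.mul_sum W, Finset.mul_sum W', Finset.sum_mul M,
    Finset.sum_mul W, Finset.sum_mul W']
  rw [Finset.sum_comm (s := Q ×ˢ Q)]
  refine Finset.sum_congr rfl fun m _ => ?_
  rw [Finset.sum_comm (s := Q ×ˢ Q)]
  refine Finset.sum_congr rfl fun w _ => ?_
  rw [Finset.sum_comm (s := Q ×ˢ Q)]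
  refine Finset.sum_congr rfl fun w' _ => ?_
  rw [star_sum, Finset.sum_mul_sum, Finset.sum_product, Finset.mul_sum]
  refine Finset.sum_congr rfl fun q _ => ?_
  rw [Finset.mul_sum]
  refine Finset.sum_congr rfl fun q' _ => ?_
  rw [star_mul']
  ring

theorem tr_four {i₁ i₂ i₃ i₄ : Site} (h₁ : i₁ ∉ ({i₂, i₃, i₄} : Finset Site))
    (h₂ : i₂ ∉ ({i₃, i₄} : Finset Site)) (h₃ : i₃ ≠ i₄) (d : Site → ℕ) (F : Cfg → Cfg → ℂ)
    (σ σ' : Cfg) : tr {i₁, i₂, i₃, i₄} d F σ σ' =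
      ∑ a ∈ Finset.range (d i₁), ∑ b ∈ Finset.range (d i₂), ∑ c ∈ Finset.range (d i₃),
        ∑ e ∈ Finset.range (d i₄),
        F (Function.update (Function.update (Function.update (Function.update σ i₁ a) i₂ b) i₃ c)
            i₄ e)
          (Function.update (Function.update (Function.update (Function.update σ' i₁ a) i₂ b) i₃ c)
            i₄ e) := by
  have h4 : ∀ τ τ' : Cfg, tr {i₄} d F τ τ' = ∑ k ∈ Finset.range (d i₄),
      F (Function.update τ i₄ k) (Function.update τ' i₄ k) := by
    intro τ τ'
    rw [← insert_empty_eq, tr_insert (Finset.notMem_empty _)]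
    simp only [tr_empty]
  rw [tr_insert h₁]
  simp only [tr_insert h₂, tr_insert (Finset.notMem_singleton.2 h₃), h4]

theorem Indep.update_four {i₁ i₂ i₃ i₄ : Site} {ψ : Cfg → ℂ} (h₁ : Indep i₁ ψ) (h₂ : Indep i₂ ψ)
    (h₃ : Indep i₃ ψ) (h₄ : Indep i₄ ψ) (σ : Cfg) (a b c e : ℕ) :
    ψ (Function.update (Function.update (Function.update (Function.update σ i₁ a) i₂ b) i₃ c)
            i₄ e) = ψ σ := by
  rw [h₄, h₃, h₂, h₁]

theorem env_succ_left {c₀ : ℤ} {n : ℕ} {x y : ℤ} (hx : c₀ + 2 ≤ x) :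
    env c₀ (n + 1) x y = env (c₀ + 2) n x y ∪
      {Sum.inl c₀, Sum.inl (c₀ + 1), Sum.inr c₀, Sum.inr (c₀ + 1)} := by
  ext i
  rcases i with c | c
  · simp only [Finset.mem_union, inl_mem_env, Finset.mem_insert, Finset.mem_singleton,
      Sum.inl.injEq, reduceCtorEq, or_false]
    push_cast; omega
  · simp only [Finset.mem_union, inr_mem_env, Finset.mem_insert, Finset.mem_singleton,
      Sum.inr.injEq, reduceCtorEq, false_or]
    push_cast; omega

theorem disjoint_env_left {c₀ : ℤ} {n : ℕ} {x y : ℤ} :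
    Disjoint (env (c₀ + 2) n x y)
      {Sum.inl c₀, Sum.inl (c₀ + 1), Sum.inr c₀, Sum.inr (c₀ + 1)} := by
  rw [Finset.disjoint_right]
  intro i hi
  simp only [Finset.mem_insert, Finset.mem_singleton] at hi
  rcases hi with rfl | rfl | rfl | rfl <;> simp only [inl_mem_env, inr_mem_env] <;> omega

theorem env_succ_right {c₀ : ℤ} {n : ℕ} {x y : ℤ} (hy : y ≤ c₀ + 2 * (n : ℤ)) :
    env c₀ (n + 1) x y = env c₀ n x y ∪
      {Sum.inl (c₀ + 2 * (n : ℤ) + 2), Sum.inl (c₀ + 2 * (n : ℤ) + 1),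
        Sum.inr (c₀ + 2 * (n : ℤ)), Sum.inr (c₀ + 2 * (n : ℤ) + 1)} := by
  ext i
  rcases i with c | c
  · simp only [Finset.mem_union, inl_mem_env, Finset.mem_insert, Finset.mem_singleton,
      Sum.inl.injEq, reduceCtorEq, or_false]
    push_cast; omega
  · simp only [Finset.mem_union, inr_mem_env, Finset.mem_insert, Finset.mem_singleton,
      Sum.inr.injEq, reduceCtorEq, false_or]
    push_cast; omega

theorem disjoint_env_right {c₀ : ℤ} {n : ℕ} {x y : ℤ} :
    Disjoint (env c₀ n x y)
      {Sum.inl (c₀ + 2 * (n : ℤ) + 2), Sum.inl (c₀ + 2 * (n : ℤ) + 1),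
        Sum.inr (c₀ + 2 * (n : ℤ)), Sum.inr (c₀ + 2 * (n : ℤ) + 1)} := by
  rw [Finset.disjoint_right]
  intro i hi
  simp only [Finset.mem_insert, Finset.mem_singleton] at hi
  rcases hi with rfl | rfl | rfl | rfl <;> simp only [inl_mem_env, inr_mem_env] <;> omega

variable {C : Circuit} {N : ℤ → StateTensor}

theorem evOp_chainAt_left (t : ℕ) (j : ℤ) (n : ℕ) {ξ η : ℕ}
    (hξ : ξ < (N j).leftAux) (hη : η < (N (j + 1 + (n : ℤ))).leftAux) (σ : Cfg) :
    C.evOp (2 * j + 2) n (chainAt N j (n + 1) ξ η) t σ =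
      ∑ ζ ∈ Finset.range (N (j + 1)).leftAux,
        ampAt N j σ ξ ζ * C.evOp (2 * j + 2) n (chainAt N (j + 1) n ζ η) t σ := by
  have h : chainAt N j (n + 1) ξ η = fun σ => ∑ ζ ∈ Finset.range (N (j + 1)).leftAux,
      ampAt N j σ ξ ζ * chainAt N (j + 1) n ζ η σ :=
    funext fun σ => chainAt_succ_left N j n hξ hη σ
  rw [h, Circuit.evOp_sum]
  refine Finset.sum_congr rfl fun ζ _ => ?_
  rw [Circuit.evOp_mul]
  intro c h1 h2 σ x
  simp only [ampAt, setGate_inl, setGate_inr]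
  simp only [show 2 * j ≠ c by omega, show 2 * j + 1 ≠ c by omega, show 2 * j + 2 ≠ c by omega,
    show 2 * j ≠ c - 1 by omega, show 2 * j + 1 ≠ c - 1 by omega, if_false]

/-- Once the outer diagonal has cancelled, no gate acts on the end vertex. Its left and top regions
and both its wires are traced, and what remains of it is its transfer matrix applied to the boundary
density. -/
theorem Tform_left {t : ℕ} (ht : 0 < t) (hfit : FitsBelow N C) (hbi : C.IsBiunitary t) {x y : ℤ} {j : ℤ}
    {n : ℕ} (hxy : x < y) (hx : 2 * j + 2 + (t : ℤ) ≤ x) (hy : y + (t : ℤ) ≤ 2 * j + 2 * n + 2)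
    {σ σ' : Cfg} (hσx : σ (Sum.inl x) = σ' (Sum.inl x)) (hσx' : σ (Sum.inl x) < C.regDim t x)
    (X : ℕ × ℕ × ℕ → ℕ × ℕ × ℕ → ℂ) :
    Tform C N t x y j (n + 1) X σ σ' = Tform C N t x y (j + 1) n
      (fun z w => ∑ v ∈ cutLabels N j, X v w * (N j).transfer v z) σ σ' := by
  have ej : 2 * (j + 1) = 2 * j + 2 := by ring
  have ee : 2 * j + 2 * ((n + 1 : ℕ) : ℤ) = 2 * j + 2 + 2 * (n : ℤ) := by push_cast; ring
  have ea : j + ((n + 1 : ℕ) : ℤ) = j + 1 + (n : ℤ) := by push_cast; ring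
  unfold Tform
  rw [ej, ee, ea, tr_sum]
  simp only [tr_sum]
  have key : ∀ p ∈ auxPairs N j, ∀ q ∈ auxPairs N (j + 1 + n),
      tr (env (2 * j) (n + 1) x y) (C.winDim (2 * j) (n + 1) t) (fun τ τ' =>
        X (τ (Sum.inl (2 * j)), p) (τ (Sum.inl (2 * j + 2 + 2 * (n : ℤ))), q) *
        (C.evOp (2 * j) (n + 1) (chainAt N j (n + 1) p.1 q.1) t τ *
          star (C.evOp (2 * j) (n + 1) (chainAt N j (n + 1) p.2 q.2) t τ'))) σ σ' =
      tr (env (2 * j + 2) n x y) (C.winDim (2 * j + 2) n t) (fun τ τ' =>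
        ∑ l ∈ Finset.range (N j).leftReg, ∑ m ∈ Finset.range (N j).topReg,
        ∑ w ∈ Finset.range (N j).leftWire, ∑ w' ∈ Finset.range (N j).rightWire,
        X (l, p) (τ (Sum.inl (2 * j + 2 + 2 * (n : ℤ))), q) *
        ((∑ ζ ∈ Finset.range (N (j + 1)).leftAux,
            (N j).amp l p.1 w m w' ζ (τ (Sum.inl (2 * j + 2))) *
              C.evOp (2 * j + 2) n (chainAt N (j + 1) n ζ q.1) t τ) *
        star (∑ ζ ∈ Finset.range (N (j + 1)).leftAux,
            (N j).amp l p.2 w m w' ζ (τ (Sum.inl (2 * j + 2))) *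
              C.evOp (2 * j + 2) n (chainAt N (j + 1) n ζ q.2) t τ'))) σ σ' := by
    intro p hp q hq
    simp only [auxPairs, Finset.mem_product, Finset.mem_range] at hp hq
    -- No gate changes the two outermost regions, so the boundary density can be moved through the
    -- evolution.
    have hf : ∀ c, 2 * j + 2 ≤ c → c ≤ 2 * j + 2 * ((n + 1 : ℕ) : ℤ) - 2 → ∀ (τ : Cfg) z,
        X (setGate τ c z (Sum.inl (2 * j)), p)
          (setGate τ c z (Sum.inl (2 * j + 2 + 2 * (n : ℤ))), q) =
        X (τ (Sum.inl (2 * j)), p) (τ (Sum.inl (2 * j + 2 + 2 * (n : ℤ))), q) := by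
      intro c h1 h2 τ z
      push_cast at h2
      rw [setGate_inl, setGate_inl, if_neg (by omega), if_neg (by omega)]
    have hf' : ∀ c, 2 * j + 2 + 2 ≤ c → c ≤ 2 * j + 2 + 2 * (n : ℤ) - 2 → ∀ (τ : Cfg) z,
        X (setGate τ c z (Sum.inl (2 * j)), p)
          (setGate τ c z (Sum.inl (2 * j + 2 + 2 * (n : ℤ))), q) =
        X (τ (Sum.inl (2 * j)), p) (τ (Sum.inl (2 * j + 2 + 2 * (n : ℤ))), q) :=
      fun c h1 h2 => hf c (by omega) (by push_cast; omega)
    have h1 := Circuit.tr_evOp_left hbi (by omega : 2 * j % 2 = 0) hxy hx (by omega) hσx hσx'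
      (fun τ => X (τ (Sum.inl (2 * j)), p) (τ (Sum.inl (2 * j + 2 + 2 * (n : ℤ))), q) *
        chainAt N j (n + 1) p.1 q.1 τ) (chainAt N j (n + 1) p.2 q.2)
    rw [Circuit.evOp_mul hf, Circuit.evOp_mul hf'] at h1
    simp only [mul_assoc] at h1
    rw [h1, env_succ_left (by omega), tr_union disjoint_env_left]
    refine tr_congr fun τ τ' hτ _ => ?_
    -- Here `0 < t` matters: it puts the region between the dropped vertex and the rest strictly to
    -- the left of `x`, hence among the traced regions, so vertex and conjugate share its label.
    have hmid : τ' (Sum.inl (2 * j + 2)) = τ (Sum.inl (2 * j + 2)) :=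
      (hτ _ (by rw [inl_mem_env]; omega)).1.symm
    rw [tr_four (by simp) (by simp) (by simp)]
    have d1 : C.winDim (2 * j + 2) n t (Sum.inl (2 * j)) = (N j).leftReg := by
      rw [hfit.leftReg, Circuit.winDim, regTime_eq t (i := 0) (by omega) rfl]; simp
    have d2 : C.winDim (2 * j + 2) n t (Sum.inl (2 * j + 1)) = (N j).topReg := by
      rw [hfit.topReg, Circuit.winDim, regTime_eq t (i := 0) (by omega) rfl]; simp
    have d3 : C.winDim (2 * j + 2) n t (Sum.inr (2 * j)) = (N j).leftWire := by
      rw [hfit.leftWire, Circuit.winDim, wireTime_eq t (i := 0) (by omega) rfl]; simp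
    have d4 : C.winDim (2 * j + 2) n t (Sum.inr (2 * j + 1)) = (N j).rightWire := by
      rw [hfit.rightWire, Circuit.winDim, wireTime_eq t (i := 0) (by omega) rfl]; simp
    rw [d1, d2, d3, d4]
    refine Finset.sum_congr rfl fun l _ => Finset.sum_congr rfl fun m _ =>
      Finset.sum_congr rfl fun w _ => Finset.sum_congr rfl fun w' _ => ?_
    rw [evOp_chainAt_left t j n hp.1 hq.1, evOp_chainAt_left t j n hp.2 hq.2]
    have hout : ∀ i : Site, Sum.elim (fun c => c < 2 * j + 2 ∨ 2 * j + 2 + 2 * (n : ℤ) < c)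
        (fun c => c < 2 * j + 2 ∨ 2 * j + 2 + 2 * (n : ℤ) ≤ c) i → ∀ ζ η,
        Indep i (C.evOp (2 * j + 2) n (chainAt N (j + 1) n ζ η) t) := by
      intro i hi ζ η
      refine Circuit.evOp_indep_of_outside hi (chainAt_indep N (j + 1) n ζ η ?_)
      rw [ej]; exact hi
    have hV : ∀ (τ : Cfg) ζ η a b c e, C.evOp (2 * j + 2) n (chainAt N (j + 1) n ζ η) t
        (Function.update (Function.update (Function.update (Function.update τ
          (Sum.inl (2 * j)) a) (Sum.inl (2 * j + 1)) b) (Sum.inr (2 * j)) c)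
          (Sum.inr (2 * j + 1)) e) =
        C.evOp (2 * j + 2) n (chainAt N (j + 1) n ζ η) t τ := by
      intro τ ζ η a b c e
      refine Indep.update_four ?_ ?_ ?_ ?_ τ a b c e <;> apply hout <;>
        simp only [Sum.elim_inl, Sum.elim_inr] <;> omega
    simp only [hV]
    congr 1
    · have n1 : 2 * j + 2 + 2 * (n : ℤ) ≠ 2 * j := by omega
      have n2 : 2 * j + 2 + 2 * (n : ℤ) ≠ 2 * j + 1 := by omega
      have n3 : 2 * j ≠ 2 * j + 1 := by omega
      simp only [Function.update_apply, reduceCtorEq, Sum.inl.injEq, n1, n2, n3, if_false, if_true]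
    · simp only [ampAt]
      simp [hmid]
  rw [Finset.sum_congr rfl fun p hp => Finset.sum_congr rfl fun q hq => key p hp q hq]
  rw [Finset.sum_comm]
  simp only [← tr_sum]
  refine tr_congr fun τ τ' _ _ => ?_
  rw [Finset.sum_comm (s := auxPairs N (j + 1))]
  refine Finset.sum_congr rfl fun q _ => ?_
  exact transfer_shuffle (fun v => X v (τ (Sum.inl (2 * j + 2 + 2 * (n : ℤ))), q))
    (fun l ξ m w w' ζ => (N j).amp l ξ w m w' ζ (τ (Sum.inl (2 * j + 2)))) _ _

theorem evOp_chainAt_right (t : ℕ) (j : ℤ) (n : ℕ) (ξ η : ℕ) (σ : Cfg) :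
    C.evOp (2 * j) n (chainAt N j (n + 1) ξ η) t σ =
      ∑ ζ ∈ Finset.range (N (j + n)).leftAux,
        ampAt N (j + n) σ ζ η * C.evOp (2 * j) n (chainAt N j n ξ ζ) t σ := by
  have h : chainAt N j (n + 1) ξ η = fun σ => ∑ ζ ∈ Finset.range (N (j + n)).leftAux,
      ampAt N (j + n) σ ζ η * chainAt N j n ξ ζ σ :=
    funext fun σ => chainAt_succ N j n ξ η σ
  rw [h, Circuit.evOp_sum]
  refine Finset.sum_congr rfl fun ζ _ => ?_
  rw [Circuit.evOp_mul]
  intro c h1 h2 σ x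
  simp only [ampAt, setGate_inl, setGate_inr]
  simp only [show 2 * (j + n) ≠ c by omega, show 2 * (j + n) + 1 ≠ c by omega,
    show 2 * (j + n) + 2 ≠ c by omega, show 2 * (j + n) ≠ c - 1 by omega,
    show 2 * (j + n) + 1 ≠ c - 1 by omega, if_false]

theorem Tform_right {t : ℕ} (ht : 0 < t) (hfit : FitsBelow N C) (hbi : C.IsBiunitary t) {x y : ℤ}
    {j : ℤ} {n : ℕ} (hxy : x < y) (hx : 2 * j + (t : ℤ) ≤ x) (hy : y + (t : ℤ) ≤ 2 * j + 2 * n)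
    {σ σ' : Cfg} (hσy : σ (Sum.inl y) = σ' (Sum.inl y)) (hσy' : σ (Sum.inl y) < C.regDim t y)
    (X : ℕ × ℕ × ℕ → ℕ × ℕ × ℕ → ℂ) :
    Tform C N t x y j (n + 1) X σ σ' = Tform C N t x y j n
      (fun z w => ∑ v ∈ cutLabels N (j + n + 1), X z v * (N (j + n)).transfer w v) σ σ' := by
  have ee : 2 * j + 2 * ((n + 1 : ℕ) : ℤ) = 2 * j + 2 * (n : ℤ) + 2 := by push_cast; ring
  have ea : j + ((n + 1 : ℕ) : ℤ) = j + (n : ℤ) + 1 := by push_cast; ring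
  have em : 2 * (j + (n : ℤ)) = 2 * j + 2 * (n : ℤ) := by ring
  unfold Tform
  rw [ee, ea, tr_sum]
  simp only [tr_sum]
  have key : ∀ p ∈ auxPairs N j, ∀ q ∈ auxPairs N (j + n + 1),
      tr (env (2 * j) (n + 1) x y) (C.winDim (2 * j) (n + 1) t) (fun τ τ' =>
        X (τ (Sum.inl (2 * j)), p) (τ (Sum.inl (2 * j + 2 * (n : ℤ) + 2)), q) *
        (C.evOp (2 * j) (n + 1) (chainAt N j (n + 1) p.1 q.1) t τ *
          star (C.evOp (2 * j) (n + 1) (chainAt N j (n + 1) p.2 q.2) t τ'))) σ σ' =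
      tr (env (2 * j) n x y) (C.winDim (2 * j) n t) (fun τ τ' =>
        ∑ r ∈ Finset.range (N (j + n + 1)).leftReg, ∑ m ∈ Finset.range (N (j + n)).topReg,
        ∑ w ∈ Finset.range (N (j + n)).leftWire, ∑ w' ∈ Finset.range (N (j + n)).rightWire,
        X (τ (Sum.inl (2 * j)), p) (r, q) *
        ((∑ ζ ∈ Finset.range (N (j + n)).leftAux,
            (N (j + n)).amp (τ (Sum.inl (2 * j + 2 * n))) ζ w m w' q.1 r *
              C.evOp (2 * j) n (chainAt N j n p.1 ζ) t τ) *
        star (∑ ζ ∈ Finset.range (N (j + n)).leftAux,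
            (N (j + n)).amp (τ (Sum.inl (2 * j + 2 * n))) ζ w m w' q.2 r *
              C.evOp (2 * j) n (chainAt N j n p.2 ζ) t τ'))) σ σ' := by
    intro p hp q hq
    have hf : ∀ c, 2 * j + 2 ≤ c → c ≤ 2 * j + 2 * ((n + 1 : ℕ) : ℤ) - 2 → ∀ (τ : Cfg) z,
        X (setGate τ c z (Sum.inl (2 * j)), p)
          (setGate τ c z (Sum.inl (2 * j + 2 * (n : ℤ) + 2)), q) =
        X (τ (Sum.inl (2 * j)), p) (τ (Sum.inl (2 * j + 2 * (n : ℤ) + 2)), q) := by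
      intro c h1 h2 τ z
      push_cast at h2
      rw [setGate_inl, setGate_inl, if_neg (by omega), if_neg (by omega)]
    have hf' : ∀ c, 2 * j + 2 ≤ c → c ≤ 2 * j + 2 * (n : ℤ) - 2 → ∀ (τ : Cfg) z,
        X (setGate τ c z (Sum.inl (2 * j)), p)
          (setGate τ c z (Sum.inl (2 * j + 2 * (n : ℤ) + 2)), q) =
        X (τ (Sum.inl (2 * j)), p) (τ (Sum.inl (2 * j + 2 * (n : ℤ) + 2)), q) :=
      fun c h1 h2 => hf c (by omega) (by push_cast; omega)
    have h1 := Circuit.tr_evOp_right hbi (by omega : 2 * j % 2 = 0) hxy hx hy hσy hσy'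
      (fun τ => X (τ (Sum.inl (2 * j)), p) (τ (Sum.inl (2 * j + 2 * (n : ℤ) + 2)), q) *
        chainAt N j (n + 1) p.1 q.1 τ) (chainAt N j (n + 1) p.2 q.2)
    rw [Circuit.evOp_mul hf, Circuit.evOp_mul hf'] at h1
    simp only [mul_assoc] at h1
    rw [h1, env_succ_right (by omega), tr_union disjoint_env_right]
    refine tr_congr fun τ τ' hτ _ => ?_
    have hmid : τ' (Sum.inl (2 * j + 2 * (n : ℤ))) = τ (Sum.inl (2 * j + 2 * (n : ℤ))) :=
      (hτ _ (by rw [inl_mem_env]; omega)).1.symm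
    rw [tr_four (by simp) (by simp) (by simp)]
    have d1 : C.winDim (2 * j) n t (Sum.inl (2 * j + 2 * (n : ℤ) + 2)) =
        (N (j + n + 1)).leftReg := by
      rw [hfit.leftReg, Circuit.winDim, regTime_eq t rfl (j := 0) (by omega)]
      simp only [min_zero]; congr 1; ring
    have d2 : C.winDim (2 * j) n t (Sum.inl (2 * j + 2 * (n : ℤ) + 1)) = (N (j + n)).topReg := by
      rw [hfit.topReg, Circuit.winDim, regTime_eq t rfl (j := 0) (by omega)]
      simp only [min_zero]; congr 1; ring
    have d3 : C.winDim (2 * j) n t (Sum.inr (2 * j + 2 * (n : ℤ))) = (N (j + n)).leftWire := by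
      rw [hfit.leftWire, Circuit.winDim, wireTime_eq t rfl (j := 0) (by omega)]
      simp only [min_zero]; congr 1; ring
    have d4 : C.winDim (2 * j) n t (Sum.inr (2 * j + 2 * (n : ℤ) + 1)) =
        (N (j + n)).rightWire := by
      rw [hfit.rightWire, Circuit.winDim, wireTime_eq t rfl (j := 0) (by omega)]
      simp only [min_zero]; congr 1; ring
    rw [d1, d2, d3, d4]
    refine Finset.sum_congr rfl fun l _ => Finset.sum_congr rfl fun m _ =>
      Finset.sum_congr rfl fun w _ => Finset.sum_congr rfl fun w' _ => ?_
    rw [evOp_chainAt_right t j n, evOp_chainAt_right t j n]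
    have hout : ∀ i : Site, Sum.elim (fun c => c < 2 * j ∨ 2 * j + 2 * (n : ℤ) < c)
        (fun c => c < 2 * j ∨ 2 * j + 2 * (n : ℤ) ≤ c) i → ∀ ζ η,
        Indep i (C.evOp (2 * j) n (chainAt N j n ζ η) t) :=
      fun i hi ζ η => Circuit.evOp_indep_of_outside hi (chainAt_indep N j n ζ η hi)
    have hV : ∀ (τ : Cfg) ζ η a b c e, C.evOp (2 * j) n (chainAt N j n ζ η) t
        (Function.update (Function.update (Function.update (Function.update τ
          (Sum.inl (2 * j + 2 * (n : ℤ) + 2)) a) (Sum.inl (2 * j + 2 * (n : ℤ) + 1)) b)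
          (Sum.inr (2 * j + 2 * (n : ℤ))) c) (Sum.inr (2 * j + 2 * (n : ℤ) + 1)) e) =
        C.evOp (2 * j) n (chainAt N j n ζ η) t τ := by
      intro τ ζ η a b c e
      refine Indep.update_four ?_ ?_ ?_ ?_ τ a b c e <;> apply hout <;>
        simp only [Sum.elim_inl, Sum.elim_inr] <;> omega
    simp only [hV]
    congr 1
    · have n1 : 2 * j ≠ 2 * j + 2 * (n : ℤ) + 1 := by omega
      have n2 : 2 * j ≠ 2 * j + 2 * (n : ℤ) + 2 := by omega
      have n3 : 2 * j + 2 * (n : ℤ) + 2 ≠ 2 * j + 2 * (n : ℤ) + 1 := by omega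
      simp only [Function.update_apply, reduceCtorEq, Sum.inl.injEq, n1, n2, n3, if_false, if_true]
    · simp only [ampAt, em]
      simp [hmid]
  rw [Finset.sum_congr rfl fun p hp => Finset.sum_congr rfl fun q hq => key p hp q hq]
  simp only [← tr_sum]
  refine tr_congr fun τ τ' _ _ => ?_
  refine Finset.sum_congr rfl fun p _ => ?_
  exact transfer_shuffle (fun v => X (τ (Sum.inl (2 * j)), p) v)
    (fun r η m w w' ζ => (N (j + n)).amp (τ (Sum.inl (2 * j + 2 * n))) ζ w m w' η r) _ _

end

/-! ### Powers of a matrix with a nondegenerate leading eigenvalue. -/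

section

section Spectral

/-- By Gelfand's formula `‖a ^ n‖ ^ (1 / n)` tends to the spectral radius, which lies below some `r
< 1`; so eventually `‖a ^ n‖ ≤ r ^ n`. -/
theorem tendsto_pow_zero_of_spectrum {A : Type*} [NormedRing A] [NormedAlgebra ℂ A]
    [CompleteSpace A] [Nontrivial A] {a : A} (h : ∀ z ∈ spectrum ℂ a, ‖z‖ < 1) :
    Tendsto (fun n : ℕ => ‖a ^ n‖) atTop (𝓝 0) := by
  have h1 : spectralRadius ℂ a < ((1 : NNReal) : ENNReal) :=
    spectrum.spectralRadius_lt_of_forall_lt a fun z hz => by exact_mod_cast h z hz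
  obtain ⟨r, hr1, hr2⟩ := ENNReal.lt_iff_exists_nnreal_btwn.1 h1
  have hr : r < 1 := by exact_mod_cast hr2
  have h2 := (spectrum.pow_nnnorm_pow_one_div_tendsto_nhds_spectralRadius a).eventually_lt_const hr1
  refine squeeze_zero' (Eventually.of_forall fun n => norm_nonneg _) ?_
    (tendsto_pow_atTop_nhds_zero_of_lt_one r.coe_nonneg hr)
  filter_upwards [h2, eventually_ge_atTop 1] with n hn hn1
  have hn0 : (n : ℝ) ≠ 0 := by positivity
  have h3 := pow_le_pow_left' hn.le n
  rw [← ENNReal.rpow_natCast, ← ENNReal.rpow_mul, one_div_mul_cancel hn0, ENNReal.rpow_one] at h3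
  exact_mod_cast h3

attribute [local instance] Matrix.linftyOpNormedRing Matrix.linftyOpNormedAlgebra

variable {ι : Type*} [Fintype ι] [DecidableEq ι]

theorem matrix_tendsto_pow_zero [Nonempty ι] {A : Matrix ι ι ℂ} (h : ∀ z ∈ spectrum ℂ A, ‖z‖ < 1)
    (i j : ι) : Tendsto (fun n : ℕ => (A ^ n) i j) atTop (𝓝 0) := by
  have h1 := tendsto_pow_zero_of_spectrum h
  have h2 : Tendsto (fun n : ℕ => A ^ n) atTop (𝓝 0) := tendsto_zero_iff_norm_tendsto_zero.2 h1
  exact ((continuous_apply j).comp (continuous_apply i)).continuousAt.tendsto.comp h2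

theorem exists_eigenvector_of_isRoot {F : Matrix ι ι ℂ} {ν : ℂ} (h : F.charpoly.IsRoot ν) :
    ∃ v : ι → ℂ, v ≠ 0 ∧ F *ᵥ v = ν • v := by
  rw [← Matrix.charpoly_mulVecLin, ← Module.End.hasEigenvalue_iff_isRoot_charpoly] at h
  obtain ⟨v, hv⟩ := h.exists_hasEigenvector
  exact ⟨v, hv.2, by simpa using hv.apply_eq_smul⟩

theorem isRoot_of_eigenvector {F : Matrix ι ι ℂ} {ν : ℂ} {v : ι → ℂ} (hv : v ≠ 0)
    (h : F *ᵥ v = ν • v) : F.charpoly.IsRoot ν := by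
  rw [← Matrix.charpoly_mulVecLin, ← Module.End.hasEigenvalue_iff_isRoot_charpoly]
  exact Module.End.hasEigenvalue_of_hasEigenvector (x := v)
    ⟨Module.End.mem_eigenspace_iff.2 (by simpa using h), hv⟩

theorem pow_mulVec_eigenvector {F : Matrix ι ι ℂ} {ν : ℂ} {v : ι → ℂ}
    (h : F *ᵥ v = ν • v) (r : ℕ) : (F ^ r) *ᵥ v = ν ^ r • v := by
  induction r with
  | zero => simp
  | succ r ih => rw [pow_succ, ← Matrix.mulVec_mulVec, h, Matrix.mulVec_smul, ih, smul_smul,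
      pow_succ']

/-- The eigenvalues of a power-bounded matrix are bounded by the growth rate. -/
theorem norm_eigenvalue_le {F : Matrix ι ι ℂ} {lam : ℝ} (hlam : 0 < lam)
    (hb : ∀ r i j, ‖(F ^ r) i j‖ ≤ lam ^ r) {ν : ℂ} {v : ι → ℂ} (hv : v ≠ 0)
    (h : F *ᵥ v = ν • v) : ‖ν‖ ≤ lam := by
  by_contra hlt
  push Not at hlt
  obtain ⟨i, hi⟩ := Function.ne_iff.1 hv
  have hi' : 0 < ‖v i‖ := norm_pos_iff.2 hi
  have h1 : ∀ r : ℕ, (‖ν‖ / lam) ^ r ≤ (∑ j, ‖v j‖) / ‖v i‖ := by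
    intro r
    have h2 := congrFun (pow_mulVec_eigenvector h r) i
    have h3 : ‖ν‖ ^ r * ‖v i‖ ≤ lam ^ r * ∑ j, ‖v j‖ := by
      calc ‖ν‖ ^ r * ‖v i‖ = ‖(ν ^ r • v) i‖ := by simp
        _ = ‖∑ j, (F ^ r) i j * v j‖ := by rw [← h2]; rfl
        _ ≤ ∑ j, ‖(F ^ r) i j * v j‖ := norm_sum_le _ _
        _ ≤ ∑ j, lam ^ r * ‖v j‖ := Finset.sum_le_sum fun j _ => by
            rw [norm_mul]; exact mul_le_mul_of_nonneg_right (hb r i j) (norm_nonneg _)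
        _ = _ := by rw [Finset.mul_sum]
    rw [div_pow, div_le_div_iff₀ (by positivity) hi']
    linarith
  have h4 := tendsto_pow_atTop_atTop_of_one_lt ((one_lt_div hlam).2 hlt)
  obtain ⟨r, hr⟩ := (h4.eventually_gt_atTop ((∑ j, ‖v j‖) / ‖v i‖)).exists
  exact absurd (h1 r) (not_le.2 hr)

/-- Powers of a power-bounded matrix with nondegenerate leading eigenvalue and with left and right
eigenvector `u` converge to the projection onto `u`. -/
theorem tendsto_pow_of_nondegenerate {F : Matrix ι ι ℂ} {lam : ℝ} (hlam : 0 < lam) {u : ι → ℂ}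
    {d : ℝ} (hd : 0 < d) (hu : u ⬝ᵥ u = d) (hr : F *ᵥ u = (lam : ℂ) • u)
    (hl : u ᵥ* F = (lam : ℂ) • u) (hb : ∀ r i j, ‖(F ^ r) i j‖ ≤ lam ^ r)
    (hF : HasNondegenerateLeadingEigenvalue F) (i j : ι) :
    Tendsto (fun r : ℕ => (F ^ r) i j / (lam : ℂ) ^ r) atTop (𝓝 (u i * u j / d)) := by
  have : Nonempty ι := ⟨i⟩
  have hlc : (lam : ℂ) ≠ 0 := by exact_mod_cast hlam.ne'
  have hdc : (d : ℂ) ≠ 0 := by exact_mod_cast hd.ne'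
  have hu0 : u ≠ 0 := by rintro rfl; simp at hu; exact hdc hu.symm
  obtain ⟨μ, hμ0, hμ1, hμ2⟩ := hF
  have hroot := isRoot_of_eigenvector hu0 hr
  -- The vector `u` makes `lam` an eigenvalue, and the growth bound forbids eigenvalues of larger
  -- modulus; so the leading eigenvalue is `lam`.
  have hμ : μ = (lam : ℂ) := by
    by_contra hne
    have h1 := hμ2 lam hroot (Ne.symm hne)
    have hμroot : F.charpoly.IsRoot μ := by
      rw [← Polynomial.rootMultiplicity_pos (Matrix.charpoly_monic F).ne_zero]; omega
    obtain ⟨v, hv0, hv⟩ := exists_eigenvector_of_isRoot hμroot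
    have h2 := norm_eigenvalue_le hlam hb hv0 hv
    rw [Complex.norm_real, Real.norm_of_nonneg hlam.le] at h1
    linarith
  subst hμ
  set G : Matrix ι ι ℂ := (lam : ℂ)⁻¹ • F with hG
  set P : Matrix ι ι ℂ := (d : ℂ)⁻¹ • Matrix.vecMulVec u u with hP
  have hGu : G *ᵥ u = u := by rw [hG, Matrix.smul_mulVec, hr, smul_smul, inv_mul_cancel₀ hlc, one_smul]
  have huG : u ᵥ* G = u := by rw [hG, Matrix.vecMul_smul, hl, smul_smul, inv_mul_cancel₀ hlc, one_smul]
  have hGP : G * P = P := by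
    rw [hP, Matrix.mul_smul, Matrix.mul_vecMulVec, hGu]
  have hPG : P * G = P := by
    rw [hP, Matrix.smul_mul, Matrix.vecMulVec_mul, huG]
  have hPP : P * P = P := by
    rw [hP, Matrix.smul_mul, Matrix.mul_smul, Matrix.vecMulVec_mul_vecMulVec, hu, smul_smul,
      Matrix.vecMulVec_smul, smul_smul]
    congr 1
    field_simp
  -- `P` is the projection onto `u` with `G P = P G = P`, so all cross terms collapse and it remains
  -- to show `(G - P) ^ r → 0`.
  have hpow : ∀ r : ℕ, (G - P) ^ (r + 1) = G ^ (r + 1) - P := by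
    intro r
    induction r with
    | zero => simp
    | succ r ih =>
      rw [pow_succ, ih, sub_mul, mul_sub, mul_sub, hPG, hPP, ← pow_succ]
      have : G ^ (r + 1) * P = P := by
        clear ih
        induction r with
        | zero => simpa using hGP
        | succ r ih => rw [pow_succ, mul_assoc, hGP, ih]
      rw [this]; abel
  -- An eigenvector of `G - P` with nonzero eigenvalue `ν` is killed by `P`, hence orthogonal to `u`
  -- and an eigenvector of `F` for `lam * ν`.
  have hspec : ∀ ν ∈ spectrum ℂ (G - P), ‖ν‖ < 1 := by
    intro ν hν
    rw [Matrix.mem_spectrum_iff_isRoot_charpoly] at hν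
    obtain ⟨v, hv0, hv⟩ := exists_eigenvector_of_isRoot hν
    by_cases hν0 : ν = 0
    · simp [hν0]
    have hPv : P *ᵥ v = 0 := by
      have h1 : P *ᵥ ((G - P) *ᵥ v) = 0 := by
        rw [Matrix.mulVec_mulVec, mul_sub, hPG, hPP, sub_self, Matrix.zero_mulVec]
      rw [hv, Matrix.mulVec_smul] at h1
      exact (smul_eq_zero.1 h1).resolve_left hν0
    have huv : u ⬝ᵥ v = 0 := by
      have h1 : u ⬝ᵥ (P *ᵥ v) = u ⬝ᵥ v := by
        rw [hP, Matrix.smul_mulVec, Matrix.vecMulVec_mulVec, dotProduct_smul, dotProduct_smul, hu]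
        simp [hdc, mul_comm]
      rw [← h1, hPv, dotProduct_zero]
    have hFv : F *ᵥ v = ((lam : ℂ) * ν) • v := by
      rw [Matrix.sub_mulVec, hPv, sub_zero, hG, Matrix.smul_mulVec] at hv
      rw [mul_smul, ← hv, smul_smul, mul_inv_cancel₀ hlc, one_smul]
    -- For `ν = 1`, multiplicity one would make `u` and `v` proportional, contradicting `u ⬝ᵥ v = 0`
    -- and `u ⬝ᵥ u ≠ 0`.
    have hν1 : ν ≠ 1 := by
      rintro rfl
      rw [mul_one] at hFv
      have h1 := LinearMap.finrank_eigenspace_le F.mulVecLin (lam : ℂ)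
      rw [Matrix.charpoly_mulVecLin, hμ1] at h1
      have hmem : ∀ w : ι → ℂ, F *ᵥ w = (lam : ℂ) • w →
          w ∈ Module.End.eigenspace F.mulVecLin (lam : ℂ) := fun w hw =>
        Module.End.mem_eigenspace_iff.2 (by simpa using hw)
      obtain ⟨w, hw⟩ := finrank_le_one_iff.1 h1
      obtain ⟨a, ha⟩ := hw ⟨u, hmem u hr⟩
      obtain ⟨b, hb'⟩ := hw ⟨v, hmem v hFv⟩
      have ha' : a • (w : ι → ℂ) = u := congrArg Subtype.val ha
      have hb'' : b • (w : ι → ℂ) = v := congrArg Subtype.val hb'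
      have h2 : b • u = a • v := by rw [← ha', ← hb'', smul_smul, smul_smul, mul_comm]
      have h3 := congrArg (fun z => u ⬝ᵥ z) h2
      simp only [dotProduct_smul, hu, huv, smul_eq_mul, mul_zero, mul_eq_zero, hdc, or_false] at h3
      exact hv0 (by rw [← hb'', h3, zero_smul])
    have h2 := hμ2 _ (isRoot_of_eigenvector hv0 hFv) (by
      intro h; exact hν1 (mul_left_cancel₀ hlc (by rw [h, mul_one])))
    rw [norm_mul] at h2
    have hl' : 0 < ‖(lam : ℂ)‖ := norm_pos_iff.2 hlc
    exact lt_of_mul_lt_mul_left (by rwa [mul_one]) hl'.le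
  have hlim := matrix_tendsto_pow_zero hspec i j
  have hlim2 : Tendsto (fun r : ℕ => ((G - P) ^ r) i j + P i j) atTop (𝓝 (0 + P i j)) :=
    hlim.add_const _
  have hPij : P i j = u i * u j / d := by
    rw [hP, Matrix.smul_apply, Matrix.vecMulVec_apply, smul_eq_mul]; field_simp
  rw [zero_add, hPij] at hlim2
  refine hlim2.congr' ?_
  filter_upwards [eventually_ge_atTop 1] with r hr1
  obtain ⟨k, rfl⟩ : ∃ k, r = k + 1 := ⟨r - 1, by omega⟩
  rw [hpow, Matrix.sub_apply, ← hPij, sub_add_cancel, hG, smul_pow, Matrix.smul_apply,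
    smul_eq_mul, inv_pow]
  field_simp

end Spectral

end

/-! ### Complete positivity and entrywise bounds. -/

/-- Kernels between doubled cuts; a cut label is (region, auxiliary wire, conjugate wire). -/
abbrev Kernel : Type := ℕ × ℕ × ℕ → ℕ × ℕ × ℕ → ℂ

/-- A kernel which is a sum of amplitudes times their conjugates. -/
def IsCP (K : Kernel) : Prop :=
  ∃ (I : Type) (s : Finset I) (φ : I → ℕ → ℕ → ℕ → ℕ → ℂ), ∀ l ξ ξ' r η η',
    K (l, ξ, ξ') (r, η, η') = ∑ i ∈ s, φ i l ξ r η * star (φ i l ξ' r η')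

/-- The label of an auxiliary wire and of its conjugate agree. -/
def diag (y : ℕ × ℕ × ℕ) : ℂ := if y.2.1 = y.2.2 then 1 else 0

theorem IsCP.swap {K : Kernel} (h : IsCP K) : IsCP fun y x => K x y := by
  obtain ⟨I, s, φ, h⟩ := h
  exact ⟨I, s, fun i l ξ r η => φ i r η l ξ, fun l ξ ξ' r η η' => h r η η' l ξ ξ'⟩

/-- Products of amplitudes are again amplitudes: the intermediate auxiliary wire is contracted
inside them, whereas the intermediate region, shared with the conjugate, becomes a further summation
index. -/
theorem IsCP.comp {K K' : Kernel} (h : IsCP K) (h' : IsCP K') (R A : Finset ℕ) :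
    IsCP fun y x => ∑ z ∈ R ×ˢ A ×ˢ A, K y z * K' z x := by
  obtain ⟨I, s, φ, h⟩ := h
  obtain ⟨I', s', φ', h'⟩ := h'
  refine ⟨ℕ × I × I', R ×ˢ s ×ˢ s', fun i l ξ r η =>
    ∑ ζ ∈ A, φ i.2.1 l ξ i.1 ζ * φ' i.2.2 i.1 ζ r η, fun l ξ ξ' r η η' => ?_⟩
  simp only [Finset.sum_product, h, h']
  refine Finset.sum_congr rfl fun c _ => ?_
  simp only [star_sum, Finset.sum_mul_sum]
  rw [Finset.sum_congr rfl fun _ _ => Finset.sum_comm, Finset.sum_comm]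
  refine Finset.sum_congr rfl fun i _ => ?_
  rw [Finset.sum_congr rfl fun _ _ => Finset.sum_comm, Finset.sum_comm]
  refine Finset.sum_congr rfl fun i' _ => Finset.sum_congr rfl fun ζ _ =>
    Finset.sum_congr rfl fun ζ' _ => ?_
  rw [star_mul']
  ring

/-- `D` is the sum of squared amplitudes, and `2 |a b| ≤ |a|² + |b|²` controls the other entries.
Estimates thereby reduce to the entries seen by `diag`. -/
theorem IsCP.bound {K : Kernel} (h : IsCP K) :
    ∃ D : ℕ → ℕ → ℕ → ℕ → ℝ, (∀ l ξ r η, 0 ≤ D l ξ r η) ∧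
      (∀ l ξ r η, K (l, ξ, ξ) (r, η, η) = D l ξ r η) ∧
      ∀ l ξ ξ' r η η', ‖K (l, ξ, ξ') (r, η, η')‖ ≤ (D l ξ r η + D l ξ' r η') / 2 := by
  obtain ⟨I, s, φ, h⟩ := h
  refine ⟨fun l ξ r η => ∑ i ∈ s, ‖φ i l ξ r η‖ ^ 2, fun l ξ r η => by positivity, ?_, ?_⟩
  · intro l ξ r η
    rw [h, Complex.ofReal_sum]
    refine Finset.sum_congr rfl fun i _ => ?_
    rw [Complex.star_def, Complex.mul_conj']
    push_cast; rfl
  · intro l ξ ξ' r η η'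
    rw [h, ← Finset.sum_add_distrib, Finset.sum_div]
    refine (norm_sum_le _ _).trans (Finset.sum_le_sum fun i _ => ?_)
    rw [norm_mul, norm_star]
    nlinarith [sq_nonneg (‖φ i l ξ r η‖ - ‖φ i l ξ' r η'‖)]

theorem sum_diag_mul (R A : Finset ℕ) (f : ℕ × ℕ × ℕ → ℂ) :
    ∑ y ∈ R ×ˢ A ×ˢ A, diag y * f y = ∑ l ∈ R, ∑ ξ ∈ A, f (l, ξ, ξ) := by
  simp only [Finset.sum_product, diag, ite_mul, one_mul, zero_mul]
  refine Finset.sum_congr rfl fun l _ => Finset.sum_congr rfl fun ξ hξ => ?_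
  rw [Finset.sum_ite_eq, if_pos hξ]

/-- For fixed right labels the entries with coinciding auxiliary labels are nonnegative and sum to
`lam`, so each is at most `lam`; `IsCP.bound` extends this to all entries. Applied to products of
transfer matrices it gives exactly the growth bound that the spectral argument needs. -/
theorem IsCP.norm_le_of_diag {K : Kernel} (h : IsCP K) {R A R' A' : Finset ℕ} {lam : ℝ}
    (hK : ∀ x ∈ R' ×ˢ A' ×ˢ A', ∑ y ∈ R ×ˢ A ×ˢ A, diag y * K y x = lam * diag x)
    {y x : ℕ × ℕ × ℕ} (hy : y ∈ R ×ˢ A ×ˢ A) (hx : x ∈ R' ×ˢ A' ×ˢ A') : ‖K y x‖ ≤ lam := by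
  obtain ⟨D, hD0, hD, hb⟩ := h.bound
  obtain ⟨l, ξ, ξ'⟩ := y
  obtain ⟨r, η, η'⟩ := x
  simp only [Finset.mem_product] at hy hx
  have key : ∀ ξ ∈ A, ∀ η ∈ A', D l ξ r η ≤ lam := by
    intro ξ hξ η hη
    have h1 := hK (r, η, η) (by simp [hx.1, hη])
    rw [sum_diag_mul] at h1
    simp only [hD, diag, if_true, mul_one] at h1
    have h2 : ∑ l ∈ R, ∑ ξ ∈ A, D l ξ r η = lam := by exact_mod_cast h1
    rw [← h2]
    calc D l ξ r η ≤ ∑ ξ ∈ A, D l ξ r η :=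
          Finset.single_le_sum (f := fun ξ => D l ξ r η) (fun _ _ => hD0 _ _ _ _) hξ
      _ ≤ _ := Finset.single_le_sum (f := fun l => ∑ ξ ∈ A, D l ξ r η)
          (fun _ _ => Finset.sum_nonneg fun _ _ => hD0 _ _ _ _) hy.1
  have h1 := key ξ hy.2.1 η hx.2.1
  have h2 := key ξ' hy.2.2 η' hx.2.2
  have h3 := hb l ξ ξ' r η η'
  linarith

/-- The entries of a completely positive kernel are bounded by its trace. -/
theorem IsCP.norm_le_trace {K : Kernel} (h : IsCP K) {R A R' A' : Finset ℕ} {T : ℝ}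
    (hT : ∑ y ∈ R ×ˢ A ×ˢ A, ∑ x ∈ R' ×ˢ A' ×ˢ A', diag y * diag x * K y x = T)
    {y x : ℕ × ℕ × ℕ} (hy : y ∈ R ×ˢ A ×ˢ A) (hx : x ∈ R' ×ˢ A' ×ˢ A') : ‖K y x‖ ≤ T := by
  obtain ⟨D, hD0, hD, hb⟩ := h.bound
  obtain ⟨l, ξ, ξ'⟩ := y
  obtain ⟨r, η, η'⟩ := x
  simp only [Finset.mem_product] at hy hx
  have hT' : ∑ l ∈ R, ∑ ξ ∈ A, ∑ r ∈ R', ∑ η ∈ A', D l ξ r η = T := by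
    simp only [mul_assoc, ← Finset.mul_sum, sum_diag_mul, hD] at hT
    exact_mod_cast hT
  have key : ∀ ξ ∈ A, ∀ η ∈ A', D l ξ r η ≤ T := by
    intro ξ hξ η hη
    rw [← hT']
    calc D l ξ r η ≤ ∑ η ∈ A', D l ξ r η :=
          Finset.single_le_sum (f := fun η => D l ξ r η) (fun _ _ => hD0 _ _ _ _) hη
      _ ≤ ∑ r ∈ R', ∑ η ∈ A', D l ξ r η := Finset.single_le_sum
          (f := fun r => ∑ η ∈ A', D l ξ r η)
          (fun _ _ => Finset.sum_nonneg fun _ _ => hD0 _ _ _ _) hx.1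
      _ ≤ ∑ ξ ∈ A, ∑ r ∈ R', ∑ η ∈ A', D l ξ r η := Finset.single_le_sum
          (f := fun ξ => ∑ r ∈ R', ∑ η ∈ A', D l ξ r η)
          (fun _ _ => Finset.sum_nonneg fun _ _ => Finset.sum_nonneg fun _ _ => hD0 _ _ _ _) hξ
      _ ≤ _ := Finset.single_le_sum (f := fun l => ∑ ξ ∈ A, ∑ r ∈ R', ∑ η ∈ A', D l ξ r η)
          (fun _ _ => Finset.sum_nonneg fun _ _ => Finset.sum_nonneg fun _ _ =>
            Finset.sum_nonneg fun _ _ => hD0 _ _ _ _) hy.1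
  have h1 := key ξ hy.2.1 η hx.2.1
  have h2 := key ξ' hy.2.2 η' hx.2.2
  have h3 := hb l ξ ξ' r η η'
  linarith

theorem isCP_transfer (T : StateTensor) : IsCP T.transfer := by
  refine ⟨ℕ × ℕ × ℕ, Finset.range T.topReg ×ˢ Finset.range T.leftWire ×ˢ
    Finset.range T.rightWire, fun i l ξ r η => T.amp l ξ i.2.1 i.1 i.2.2 η r, ?_⟩
  intro l ξ ξ' r η η'
  simp only [StateTensor.transfer, Finset.sum_product]

theorem isCP_cellTransfer (T : ℕ → StateTensor) (k : ℕ) : IsCP (StateTensor.cellTransfer T k) := by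
  induction k with
  | zero =>
    refine ⟨Unit, Finset.univ, fun _ l ξ r η => if l = r ∧ ξ = η then 1 else 0, ?_⟩
    intro l ξ ξ' r η η'
    simp only [StateTensor.cellTransfer, Prod.mk.injEq, Finset.univ_unique, Finset.sum_singleton]
    by_cases h1 : l = r <;> by_cases h2 : ξ = η <;> by_cases h3 : ξ' = η' <;> simp [h1, h2, h3]
  | succ k ih => exact ih.comp (isCP_transfer (T k)) _ _

theorem cellTransfer_congr {T T' : ℕ → StateTensor} {k : ℕ} (h : ∀ i < k, T i = T' i) :
    StateTensor.cellTransfer T k = StateTensor.cellTransfer T' k := by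
  induction k with
  | zero => rfl
  | succ k ih =>
    funext y x
    simp only [StateTensor.cellTransfer, ih fun i hi => h i (by omega), h k (by omega)]

/-! ### Products of transfer matrices and their rank one limit. -/

/-- Product of the transfer matrices of the vertices `j, …, j + k - 1`. -/
def path (N : ℤ → StateTensor) (j : ℤ) (k : ℕ) : Kernel :=
  StateTensor.cellTransfer (fun i => N (j + i)) k

theorem path_succ (N : ℤ → StateTensor) (j : ℤ) (k : ℕ) (y x : ℕ × ℕ × ℕ) :
    path N j (k + 1) y x = ∑ z ∈ cutLabels N (j + k), path N j k y z * (N (j + k)).transfer z x :=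
  rfl

theorem path_add {N : ℤ → StateTensor} {j : ℤ} (k l : ℕ) {y x : ℕ × ℕ × ℕ}
    (hx : x ∈ cutLabels N (j + k + l)) :
    path N j (k + l) y x = ∑ z ∈ cutLabels N (j + k), path N j k y z * path N (j + k) l z x := by
  induction l generalizing x with
  | zero =>
    rw [Nat.cast_zero, add_zero] at hx
    simp [path, StateTensor.cellTransfer, hx]
  | succ l ih =>
    rw [← add_assoc, path_succ]
    simp only [path_succ N (j + k) l, Finset.mul_sum]
    rw [Finset.sum_comm]
    have e : j + ((k + l : ℕ) : ℤ) = j + k + l := by push_cast; ring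
    rw [e]
    refine Finset.sum_congr rfl fun z hz => ?_
    rw [ih hz, Finset.sum_mul]
    exact Finset.sum_congr rfl fun _ _ => by ring

theorem path_succ_left {N : ℤ → StateTensor} {j : ℤ} (k : ℕ) {y x : ℕ × ℕ × ℕ}
    (hy : y ∈ cutLabels N j) (hx : x ∈ cutLabels N (j + 1 + k)) :
    path N j (k + 1) y x = ∑ z ∈ cutLabels N (j + 1), (N j).transfer y z * path N (j + 1) k z x := by
  rw [add_comm k 1, path_add 1 k (by simpa using hx)]
  have h1 : ∀ z, path N j 1 y z = (N j).transfer y z := by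
    intro z
    rw [path_succ]
    simp [path, StateTensor.cellTransfer, hy]
  simp only [h1, Nat.cast_one]

section

variable {C : Circuit} {N : ℤ → StateTensor}

theorem FitsBelow.cutLabels_succ (hfit : FitsBelow N C) (j : ℤ) :
    cutLabels N (j + 1) = Finset.range (N j).rightReg ×ˢ Finset.range (N j).rightAux ×ˢ
      Finset.range (N j).rightAux := by
  rw [cutLabels, auxPairs, hfit.aux, hfit.rightReg, hfit.leftReg]
  congr 3
  ring

/-- With the right auxiliary wires joined, the sum over the right labels is the entry of `M Mᴴ = κ
1` between `(l, ξ, p)` and `(l, ξ', p)`. Region and wire are common to vertex and conjugate, so only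
the delta in `ξ`, `ξ'` remains; the sums over top region and left wire count labels. -/
theorem transfer_diag_right (hfit : FitsBelow N C) {j : ℤ} (hu : (N j).IsHorizontallyUnitary) :
    ∃ lam : ℝ, 0 < lam ∧ ∀ y ∈ cutLabels N j,
      ∑ x ∈ cutLabels N (j + 1), diag x * (N j).transfer y x = lam * diag y := by
  obtain ⟨κ, hκ, hh⟩ := hu
  have h1 : 0 < (N j).topReg := by rw [hfit.topReg]; exact C.regDim_pos _ _
  have h2 : 0 < (N j).leftWire := by rw [hfit.leftWire]; exact C.wireDim_pos _ _
  refine ⟨(N j).topReg * (N j).leftWire * κ, by positivity, ?_⟩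
  rintro ⟨l, ξ, ξ'⟩ hy
  simp only [cutLabels, auxPairs, Finset.mem_product, Finset.mem_range] at hy
  rw [hfit.cutLabels_succ, sum_diag_mul]
  simp only [StateTensor.transfer]
  have key : ∀ m ∈ Finset.range (N j).topReg, ∀ p ∈ Finset.range (N j).leftWire,
      ∑ x ∈ Finset.range (N j).rightReg ×ˢ Finset.range (N j).rightAux ×ˢ
        Finset.range (N j).rightWire,
        (N j).amp l ξ p m x.2.2 x.2.1 x.1 * star ((N j).amp l ξ' p m x.2.2 x.2.1 x.1) =
      κ * diag (l, ξ, ξ') := by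
    intro m hm p hp
    have := Circuit.matrix_coisometry (M := (N j).horiz m)
      (g := fun y x => (N j).amp y.1 y.2.1 y.2.2 m x.2.2 x.2.1 x.1) (fun _ _ => rfl)
      (hh m (Finset.mem_range.1 hm)).1 (y := (l, ξ, p)) (y' := (l, ξ', p))
      (by simpa [hy] using hp) (by simpa [hy] using hp)
    rw [this]
    simp [diag]
  simp only [Finset.sum_product] at key
  rw [Finset.sum_congr rfl fun _ _ => Finset.sum_comm, Finset.sum_comm]
  rw [Finset.sum_congr rfl fun m hm => by
    rw [Finset.sum_congr rfl fun _ _ => Finset.sum_comm, Finset.sum_comm,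
      Finset.sum_congr rfl fun p hp => key m hm p hp]]
  simp only [Finset.sum_const, Finset.card_range, nsmul_eq_mul]
  push_cast
  ring

theorem transfer_diag_left (hfit : FitsBelow N C) {j : ℤ} (hu : (N j).IsHorizontallyUnitary) :
    ∃ lam : ℝ, 0 < lam ∧ ∀ x ∈ cutLabels N (j + 1),
      ∑ y ∈ cutLabels N j, diag y * (N j).transfer y x = lam * diag x := by
  obtain ⟨κ, hκ, hh⟩ := hu
  have h1 : 0 < (N j).topReg := by rw [hfit.topReg]; exact C.regDim_pos _ _
  have h2 : 0 < (N j).rightWire := by rw [hfit.rightWire]; exact C.wireDim_pos _ _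
  refine ⟨(N j).topReg * (N j).rightWire * κ, by positivity, ?_⟩
  rintro ⟨r, η, η'⟩ hx
  rw [hfit.cutLabels_succ] at hx
  simp only [Finset.mem_product, Finset.mem_range] at hx
  rw [cutLabels, auxPairs, sum_diag_mul]
  simp only [StateTensor.transfer]
  have key : ∀ m ∈ Finset.range (N j).topReg, ∀ q ∈ Finset.range (N j).rightWire,
      ∑ y ∈ Finset.range (N j).leftReg ×ˢ Finset.range (N j).leftAux ×ˢ
        Finset.range (N j).leftWire,
        (N j).amp y.1 y.2.1 y.2.2 m q η r * star ((N j).amp y.1 y.2.1 y.2.2 m q η' r) =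
      κ * diag (r, η, η') := by
    intro m hm q hq
    have := Circuit.matrix_isometry (M := (N j).horiz m)
      (g := fun y x => (N j).amp y.1 y.2.1 y.2.2 m x.2.2 x.2.1 x.1) (fun _ _ => rfl)
      (hh m (Finset.mem_range.1 hm)).2 (x := (r, η, q)) (x' := (r, η', q))
      (by simpa [hx] using hq) (by simpa [hx] using hq)
    rw [this]
    simp [diag]
  simp only [Finset.sum_product] at key
  rw [Finset.sum_congr rfl fun _ _ => Finset.sum_comm, Finset.sum_comm]
  rw [Finset.sum_congr rfl fun m hm => by
    rw [Finset.sum_congr rfl fun _ _ => Finset.sum_congr rfl fun _ _ => Finset.sum_comm,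
      Finset.sum_congr rfl fun _ _ => Finset.sum_comm, Finset.sum_comm,
      Finset.sum_congr rfl fun q hq => key m hm q hq]]
  simp only [Finset.sum_const, Finset.card_range, nsmul_eq_mul]
  push_cast
  ring

theorem path_diag_right (hfit : FitsBelow N C) (hu : ∀ j, (N j).IsHorizontallyUnitary)
    (j : ℤ) (k : ℕ) : ∃ lam : ℝ, 0 < lam ∧ ∀ y ∈ cutLabels N j,
      ∑ x ∈ cutLabels N (j + k), diag x * path N j k y x = lam * diag y := by
  induction k with
  | zero =>
    refine ⟨1, one_pos, fun y hy => ?_⟩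
    simp [path, StateTensor.cellTransfer, hy]
  | succ k ih =>
    obtain ⟨lam, h0, h⟩ := ih
    obtain ⟨lam', h0', h'⟩ := transfer_diag_right hfit (hu (j + k))
    refine ⟨lam * lam', by positivity, fun y hy => ?_⟩
    have e : j + ((k + 1 : ℕ) : ℤ) = j + k + 1 := by push_cast; ring
    rw [e]
    simp only [path_succ, Finset.mul_sum]
    rw [Finset.sum_comm]
    have : ∀ z ∈ cutLabels N (j + k), ∑ x ∈ cutLabels N (j + k + 1),
        diag x * (path N j k y z * (N (j + k)).transfer z x) =
        lam' * (diag z * path N j k y z) := by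
      intro z hz
      rw [← mul_assoc, ← h' z hz, Finset.sum_mul]
      exact Finset.sum_congr rfl fun _ _ => by ring
    rw [Finset.sum_congr rfl this, ← Finset.mul_sum, h y hy]
    push_cast; ring

theorem path_diag_left (hfit : FitsBelow N C) (hu : ∀ j, (N j).IsHorizontallyUnitary)
    (j : ℤ) (k : ℕ) : ∃ lam : ℝ, 0 < lam ∧ ∀ x ∈ cutLabels N (j + k),
      ∑ y ∈ cutLabels N j, diag y * path N j k y x = lam * diag x := by
  induction k with
  | zero =>
    refine ⟨1, one_pos, fun x hx => ?_⟩
    rw [Nat.cast_zero, add_zero] at hx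
    simp [path, StateTensor.cellTransfer, hx]
  | succ k ih =>
    obtain ⟨lam, h0, h⟩ := ih
    obtain ⟨lam', h0', h'⟩ := transfer_diag_left hfit (hu (j + k))
    refine ⟨lam * lam', by positivity, fun x hx => ?_⟩
    have e : j + ((k + 1 : ℕ) : ℤ) = j + k + 1 := by push_cast; ring
    rw [e] at hx
    simp only [path_succ, Finset.mul_sum]
    rw [Finset.sum_comm]
    have : ∀ z ∈ cutLabels N (j + k), ∑ y ∈ cutLabels N j,
        diag y * (path N j k y z * (N (j + k)).transfer z x) =
        lam * (diag z * (N (j + k)).transfer z x) := by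
      intro z hz
      rw [← mul_assoc, ← h z hz, Finset.sum_mul]
      exact Finset.sum_congr rfl fun _ _ => by ring
    rw [Finset.sum_congr rfl this, ← Finset.mul_sum, h' x hx]
    push_cast; ring

section Cell

variable {p : ℕ} {T : ℕ → StateTensor}

/-- Left labels of the transfer matrix of a cell. -/
def cellLabels (T : ℕ → StateTensor) : Finset (ℕ × ℕ × ℕ) :=
  Finset.range (T 0).leftReg ×ˢ Finset.range (T 0).leftAux ×ˢ Finset.range (T 0).leftAux

/-- One copy of the cell beyond the `r` in use guarantees that also the cut after the last used copy
has the label set of the cell. -/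
theorem cutLabels_of_cell {K : ℤ} {r : ℕ} (hp : 0 < p)
    (hK : ∀ i < (r + 1) * p, N (K + (i : ℤ)) = T (i % p)) {s : ℕ} (hs : s ≤ r) :
    cutLabels N (K + ((s * p : ℕ) : ℤ)) = cellLabels T := by
  have := hK (s * p) (by nlinarith)
  rw [Nat.mul_mod_left] at this
  rw [cutLabels, auxPairs, this, cellLabels]

theorem path_eq_cellMatrix_pow {K : ℤ} {r : ℕ} (hp : 0 < p)
    (hK : ∀ i < (r + 1) * p, N (K + (i : ℤ)) = T (i % p)) {s : ℕ} (hs : s ≤ r)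
    (y x : Fin (T 0).leftReg × Fin (T 0).leftAux × Fin (T 0).leftAux) :
    path N K (s * p) (y.1, y.2.1, y.2.2) (x.1, x.2.1, x.2.2) =
      (StateTensor.cellMatrix T p ^ s) y x := by
  induction s generalizing x with
  | zero =>
    simp only [zero_mul, path, StateTensor.cellTransfer, pow_zero, Matrix.one_apply, Prod.ext_iff,
      Fin.ext_iff]
  | succ s ih =>
    have hx : ((x.1 : ℕ), (x.2.1 : ℕ), (x.2.2 : ℕ)) ∈
        cutLabels N (K + ((s * p : ℕ) : ℤ) + (p : ℤ)) := by
      have e : K + ((s * p : ℕ) : ℤ) + (p : ℤ) = K + (((s + 1) * p : ℕ) : ℤ) := by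
        push_cast; ring
      rw [e, cutLabels_of_cell hp hK hs]
      simp [cellLabels]
    rw [add_mul, one_mul, path_add (s * p) p hx, cutLabels_of_cell hp hK (by omega), cellLabels,
      ← sum_fin_triple, pow_succ, Matrix.mul_apply]
    refine Finset.sum_congr rfl fun z _ => ?_
    rw [ih (by omega)]
    congr 1
    rw [path, cellTransfer_congr (T' := T)]
    · rfl
    · intro i hi
      have := hK (s * p + i) (by nlinarith)
      rw [Nat.mul_add_mod', Nat.mod_eq_of_lt hi] at this
      rw [← this]; congr 1; push_cast; ring

/-- On the cell, `diag` is a left and right eigenvector, and `d` is its squared length. Complete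
positivity supplies the bound on powers required by `tendsto_pow_of_nondegenerate`. The number `r`
of copies depends on `ε` but not on the place `K` where they occur. -/
theorem cell_converges (hfit : FitsBelow N C) (hu : ∀ j, (N j).IsHorizontallyUnitary) (hp : 0 < p)
    (hnd : HasNondegenerateLeadingEigenvalue (StateTensor.cellMatrix T p))
    (hocc : ∀ R : ℕ, ∃ K : ℤ, ∀ i < R * p, N (K + (i : ℤ)) = T (i % p)) :
    ∃ lam d : ℝ, 0 < lam ∧ 0 < d ∧ ∀ ε > 0, ∃ r : ℕ, ∀ K : ℤ,
      (∀ i < (r + 1) * p, N (K + (i : ℤ)) = T (i % p)) →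
      ∀ y ∈ cellLabels T, ∀ x ∈ cellLabels T,
        ‖path N K (r * p) y x - lam ^ r / d * (diag y * diag x)‖ ≤ ε * lam ^ r := by
  set F := StateTensor.cellMatrix T p with hF
  let u : Fin (T 0).leftReg × Fin (T 0).leftAux × Fin (T 0).leftAux → ℂ :=
    fun i => diag (i.1, i.2.1, i.2.2)
  have hmem : ∀ i : Fin (T 0).leftReg × Fin (T 0).leftAux × Fin (T 0).leftAux,
      ((i.1 : ℕ), (i.2.1 : ℕ), (i.2.2 : ℕ)) ∈ cellLabels T := fun i => by simp [cellLabels]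
  have hfin : ∀ y ∈ cellLabels T, ∃ i : Fin (T 0).leftReg × Fin (T 0).leftAux × Fin (T 0).leftAux,
      y = ((i.1 : ℕ), (i.2.1 : ℕ), (i.2.2 : ℕ)) := by
    rintro ⟨a, b, c⟩ hy
    simp only [cellLabels, Finset.mem_product, Finset.mem_range] at hy
    exact ⟨(⟨a, hy.1⟩, ⟨b, hy.2.1⟩, ⟨c, hy.2.2⟩), rfl⟩
  obtain ⟨K, hK⟩ := hocc 2
  have hcK : cutLabels N K = cellLabels T := by
    simpa using cutLabels_of_cell (r := 1) (s := 0) hp hK (by omega)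
  have hcKp : cutLabels N (K + p) = cellLabels T := by
    simpa using cutLabels_of_cell (r := 1) (s := 1) hp hK le_rfl
  have hpathF : ∀ y x : Fin (T 0).leftReg × Fin (T 0).leftAux × Fin (T 0).leftAux,
      path N K p (y.1, y.2.1, y.2.2) (x.1, x.2.1, x.2.2) = F y x := by
    intro y x
    simpa using path_eq_cellMatrix_pow (r := 1) (s := 1) hp hK le_rfl y x
  set d : ℝ := (T 0).leftReg * (T 0).leftAux with hd
  have hreg : 0 < (T 0).leftReg := by
    have := hK 0 (by omega)
    rw [Nat.zero_mod] at this
    rw [← this, hfit.leftReg]; exact C.regDim_pos _ _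
  have haux : 0 < (T 0).leftAux := by
    have := hK 0 (by omega)
    rw [Nat.zero_mod] at this
    rw [← this]; exact hfit.aux_pos _
  have hd0 : 0 < d := by positivity
  have hdc : (d : ℂ) ≠ 0 := by exact_mod_cast hd0.ne'
  have huu : u ⬝ᵥ u = d := by
    rw [dotProduct, sum_fin_triple _ _ _ (fun y => diag y * diag y), sum_diag_mul]
    simp [diag, hd]
  obtain ⟨lam, hlam, hr⟩ := path_diag_right hfit hu K p
  obtain ⟨lam', hlam', hl⟩ := path_diag_left hfit hu K p
  have hr' : F *ᵥ u = (lam : ℂ) • u := by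
    funext i
    rw [hcK, hcKp] at hr
    have := hr _ (hmem i)
    rw [cellLabels, ← sum_fin_triple] at this
    simp only [hpathF] at this
    rw [Pi.smul_apply, smul_eq_mul, ← this]
    exact Finset.sum_congr rfl fun _ _ => mul_comm _ _
  have hl' : u ᵥ* F = (lam' : ℂ) • u := by
    funext i
    rw [hcK, hcKp] at hl
    have := hl _ (hmem i)
    rw [cellLabels, ← sum_fin_triple] at this
    simp only [hpathF] at this
    rw [Pi.smul_apply, smul_eq_mul, ← this]
    rfl
  -- Left and right eigenvalues agree: evaluate `u ⬝ᵥ F u` in both ways.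
  have hll : lam' = lam := by
    have h1 : u ⬝ᵥ (F *ᵥ u) = (u ᵥ* F) ⬝ᵥ u := Matrix.dotProduct_mulVec _ _ _
    rw [hr', hl', dotProduct_smul, smul_dotProduct, huu, smul_eq_mul, smul_eq_mul] at h1
    exact_mod_cast (mul_right_cancel₀ hdc h1).symm
  subst hll
  have hb : ∀ r i j, ‖(F ^ r) i j‖ ≤ lam' ^ r := by
    intro r i j
    -- The power is realized as the transfer product along an actual run in the row, which is
    -- completely positive.
    obtain ⟨K', hK'⟩ := hocc (r + 1)
    rw [← path_eq_cellMatrix_pow (s := r) hp hK' le_rfl]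
    refine (isCP_cellTransfer _ _).norm_le_of_diag (lam := lam' ^ r) ?_ (hmem i) (hmem j)
    intro x hx
    obtain ⟨j, rfl⟩ := hfin x hx
    rw [← sum_fin_triple]
    have h1 : ∀ s : ℕ, u ᵥ* (F ^ s) = ((lam' : ℂ) ^ s) • u := by
      intro s
      induction s with
      | zero => simp
      | succ s ih => rw [pow_succ, ← Matrix.vecMul_vecMul, ih, Matrix.smul_vecMul, hl', smul_smul,
          pow_succ]
    have h2 := congrFun (h1 r) j
    rw [Pi.smul_apply, smul_eq_mul] at h2
    push_cast
    rw [← h2]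
    refine Finset.sum_congr rfl fun i _ => ?_
    congr 1
    exact path_eq_cellMatrix_pow (s := r) hp hK' le_rfl _ _
  refine ⟨lam', d, hlam, hd0, fun ε hε => ?_⟩
  have hlim := fun i j => tendsto_pow_of_nondegenerate hlam hd0 huu hr' hl' hb hnd i j
  have hev : ∀ᶠ r : ℕ in atTop, ∀ i j,
      dist ((F ^ r) i j / (lam' : ℂ) ^ r) (u i * u j / d) < ε :=
    eventually_all.2 fun i => eventually_all.2 fun j => (Metric.tendsto_nhds.1 (hlim i j)) ε hε
  obtain ⟨r, hr0⟩ := hev.exists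
  refine ⟨r, fun K hK y hy x hx => ?_⟩
  obtain ⟨i, rfl⟩ := hfin y hy
  obtain ⟨j, rfl⟩ := hfin x hx
  have h1 := (hr0 i j).le
  rw [path_eq_cellMatrix_pow hp hK le_rfl]
  have hlc : (lam' : ℂ) ^ r ≠ 0 := by exact_mod_cast (pow_pos hlam r).ne'
  have h2 : (F ^ r) i j - (lam' : ℂ) ^ r / d * (u i * u j) =
      ((F ^ r) i j / (lam' : ℂ) ^ r - u i * u j / d) * (lam' : ℂ) ^ r := by
    field_simp
  change ‖(F ^ r) i j - (lam' : ℂ) ^ r / d * (u i * u j)‖ ≤ _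
  rw [h2, norm_mul, norm_pow, Complex.norm_real, Real.norm_of_nonneg hlam.le]
  rw [dist_eq_norm] at h1
  exact mul_le_mul_of_nonneg_right h1 (pow_nonneg hlam.le r)

end Cell

end

section

variable {C : Circuit} {N : ℤ → StateTensor}

theorem norm_diag_le (y : ℕ × ℕ × ℕ) : ‖diag y‖ ≤ 1 := by
  unfold diag; split_ifs <;> simp

/-- Between the run of cells and the cut `j₀` lies an arbitrary stretch. It maps `diag` to `lI •
diag` and its entries are at most `lI`, so the rank one form survives and the relative error grows
at most by the number of labels of the cell cut. The constants `d`, `D` do not depend on `ε`, which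
`joint_limit` relies on. -/
theorem left_limit (hfit : FitsBelow N C) (hsolv : IsSolvable N) (j₀ : ℤ) :
    ∃ d D : ℝ, 0 < d ∧ 0 ≤ D ∧ ∀ ε > 0, ∃ (k : ℕ) (lam : ℝ), 0 < lam ∧
      ((cutLabels N (j₀ - k)).card : ℝ) ≤ D ∧ ∀ y ∈ cutLabels N (j₀ - k), ∀ x ∈ cutLabels N j₀,
        ‖path N (j₀ - k) k y x - lam / d * (diag y * diag x)‖ ≤ ε * lam := by
  obtain ⟨p, T, hp, hnd, hocc⟩ := hsolv.left
  obtain ⟨lam, d, hlam, hd, hconv⟩ := cell_converges hfit hsolv.unitary hp hnd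
    fun R => (hocc R).imp fun K h => h.2
  refine ⟨d, (cellLabels T).card, hd, by positivity, fun ε hε => ?_⟩
  -- The divisor absorbs the sum over intermediate labels; the added `1` keeps it nonzero.
  obtain ⟨r, hr⟩ := hconv (ε / ((cellLabels T).card + 1)) (by positivity)
  -- Enough copies for `r`, and far enough out for the whole run to lie to the left of `j₀`.
  obtain ⟨K, hK1, hK2⟩ := hocc (max (r + 1) j₀.natAbs)
  have hle : (r + 1) * p ≤ max (r + 1) j₀.natAbs * p := Nat.mul_le_mul_right p (le_max_left _ _)
  have hK3 : ∀ i < (r + 1) * p, N (K + (i : ℤ)) = T (i % p) := fun i hi => hK2 i (by omega)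
  have hrp : r * p ≤ (r + 1) * p := Nat.mul_le_mul_right p (by omega)
  obtain ⟨l, hl⟩ : ∃ l : ℕ, K + ((r * p : ℕ) : ℤ) + l = j₀ :=
    ⟨(j₀ - K - ((r * p : ℕ) : ℤ)).toNat, by omega⟩
  have hKk : j₀ - ((r * p + l : ℕ) : ℤ) = K := by push_cast at hl ⊢; omega
  obtain ⟨lI, hlI, hI⟩ := path_diag_left hfit hsolv.unitary (K + ((r * p : ℕ) : ℤ)) l
  have hc0 : cutLabels N K = cellLabels T := by
    simpa using cutLabels_of_cell (s := 0) hp hK3 (by omega)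
  have hc1 := cutLabels_of_cell hp hK3 le_rfl
  rw [hc1, hl] at hI
  refine ⟨r * p + l, lam ^ r * lI, by positivity, by rw [hKk, hc0], ?_⟩
  rw [hKk, hc0]
  intro y hy x hx
  have h1 := path_add (N := N) (j := K) (r * p) l (y := y) (x := x) (by rw [hl]; exact hx)
  rw [h1, hc1]
  have h2 : ∑ z ∈ cellLabels T, path N K (r * p) y z * path N (K + ((r * p : ℕ) : ℤ)) l z x -
      ((lam ^ r * lI : ℝ) : ℂ) / d * (diag y * diag x) =
      ∑ z ∈ cellLabels T, (path N K (r * p) y z - (lam : ℂ) ^ r / d * (diag y * diag z)) *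
        path N (K + ((r * p : ℕ) : ℤ)) l z x := by
    simp only [sub_mul, Finset.sum_sub_distrib]
    congr 1
    have h3 := hI x hx
    rw [Complex.ofReal_mul, Complex.ofReal_pow]
    rw [show (lam : ℂ) ^ r * lI / d * (diag y * diag x) =
      (lam : ℂ) ^ r / d * diag y * (lI * diag x) by ring, ← h3, Finset.mul_sum]
    exact Finset.sum_congr rfl fun _ _ => by ring
  rw [h2]
  calc _ ≤ ∑ z ∈ cellLabels T, (ε / ((cellLabels T).card + 1) * lam ^ r) * lI := by
        refine (norm_sum_le _ _).trans (Finset.sum_le_sum fun z hz => ?_)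
        rw [norm_mul]
        refine mul_le_mul (hr K hK3 y hy z hz) ?_ (norm_nonneg _) (by positivity)
        refine (isCP_cellTransfer _ _).norm_le_of_diag (R := Finset.range (T 0).leftReg)
          (A := Finset.range (T 0).leftAux) (R' := Finset.range (N j₀).leftReg)
          (A' := Finset.range (N j₀).leftAux) hI hz hx
    _ = ((cellLabels T).card / ((cellLabels T).card + 1)) * (ε * (lam ^ r * lI)) := by
        rw [Finset.sum_const, nsmul_eq_mul]; ring
    _ ≤ 1 * (ε * (lam ^ r * lI)) := by
        refine mul_le_mul_of_nonneg_right ?_ (by positivity)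
        rw [div_le_one (by positivity)]; linarith
    _ = _ := one_mul _

theorem right_limit (hfit : FitsBelow N C) (hsolv : IsSolvable N) (j₁ : ℤ) :
    ∃ d D : ℝ, 0 < d ∧ 0 ≤ D ∧ ∀ ε > 0, ∃ (k : ℕ) (lam : ℝ), 0 < lam ∧
      ((cutLabels N (j₁ + k)).card : ℝ) ≤ D ∧ ∀ y ∈ cutLabels N j₁, ∀ x ∈ cutLabels N (j₁ + k),
        ‖path N j₁ k y x - lam / d * (diag y * diag x)‖ ≤ ε * lam := by
  obtain ⟨p, T, hp, hnd, hocc⟩ := hsolv.right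
  obtain ⟨lam, d, hlam, hd, hconv⟩ := cell_converges hfit hsolv.unitary hp hnd
    fun R => (hocc R).imp fun K h => h.2
  refine ⟨d, (cellLabels T).card, hd, by positivity, fun ε hε => ?_⟩
  obtain ⟨r, hr⟩ := hconv (ε / ((cellLabels T).card + 1)) (by positivity)
  obtain ⟨K, hK1, hK2⟩ := hocc (max (r + 1) j₁.natAbs)
  have hle : (r + 1) * p ≤ max (r + 1) j₁.natAbs * p := Nat.mul_le_mul_right p (le_max_left _ _)
  have hK3 : ∀ i < (r + 1) * p, N (K + (i : ℤ)) = T (i % p) := fun i hi => hK2 i (by omega)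
  obtain ⟨l, hl⟩ : ∃ l : ℕ, j₁ + l = K := ⟨(K - j₁).toNat, by omega⟩
  have hKk : j₁ + ((l + r * p : ℕ) : ℤ) = K + ((r * p : ℕ) : ℤ) := by push_cast; omega
  obtain ⟨lI, hlI, hI⟩ := path_diag_right hfit hsolv.unitary j₁ l
  have hc0 : cutLabels N K = cellLabels T := by
    simpa using cutLabels_of_cell (s := 0) hp hK3 (by omega)
  have hc1 := cutLabels_of_cell hp hK3 le_rfl
  rw [hl, hc0] at hI
  refine ⟨l + r * p, lam ^ r * lI, by positivity, by rw [hKk, hc1], ?_⟩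
  rw [hKk, hc1]
  intro y hy x hx
  have h1 := path_add (N := N) (j := j₁) l (r * p) (y := y) (x := x)
    (by rw [hl, hc1]; exact hx)
  rw [h1, hl, hc0]
  have h2 : ∑ z ∈ cellLabels T, path N j₁ l y z * path N K (r * p) z x -
      ((lam ^ r * lI : ℝ) : ℂ) / d * (diag y * diag x) =
      ∑ z ∈ cellLabels T, (path N K (r * p) z x - (lam : ℂ) ^ r / d * (diag z * diag x)) *
        path N j₁ l y z := by
    simp only [sub_mul, Finset.sum_sub_distrib]
    congr 1
    · exact Finset.sum_congr rfl fun _ _ => mul_comm _ _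
    have h3 := hI y hy
    rw [Complex.ofReal_mul, Complex.ofReal_pow]
    rw [show (lam : ℂ) ^ r * lI / d * (diag y * diag x) =
      (lam : ℂ) ^ r / d * diag x * (lI * diag y) by ring, ← h3, Finset.mul_sum]
    exact Finset.sum_congr rfl fun _ _ => by ring
  rw [h2]
  calc _ ≤ ∑ z ∈ cellLabels T, (ε / ((cellLabels T).card + 1) * lam ^ r) * lI := by
        refine (norm_sum_le _ _).trans (Finset.sum_le_sum fun z hz => ?_)
        rw [norm_mul]
        refine mul_le_mul (hr K hK3 z hz x hx) ?_ (norm_nonneg _) (by positivity)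
        exact (isCP_cellTransfer (fun i => N (j₁ + i)) l).swap.norm_le_of_diag
          (R := Finset.range (T 0).leftReg)
          (A := Finset.range (T 0).leftAux) (R' := Finset.range (N j₁).leftReg)
          (A' := Finset.range (N j₁).leftAux) hI hz hy
    _ = ((cellLabels T).card / ((cellLabels T).card + 1)) * (ε * (lam ^ r * lI)) := by
        rw [Finset.sum_const, nsmul_eq_mul]; ring
    _ ≤ 1 * (ε * (lam ^ r * lI)) := by
        refine mul_le_mul_of_nonneg_right ?_ (by positivity)
        rw [div_le_one (by positivity)]; linarith
    _ = _ := one_mul _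

/-- The boundary density of a boundary tensor. -/
def bdKernel (B : ℕ → ℕ → ℕ → ℕ → ℂ) : Kernel := fun y x =>
  B y.1 y.2.1 x.2.1 x.1 * star (B y.1 y.2.2 x.2.2 x.1)

/-- The boundary density at the cuts `j₀`, `j₁` which results from the boundary kernel `X` at the
cuts `j₀ - k`, `j₁ + k'`. -/
def pushKernel (N : ℤ → StateTensor) (j₀ j₁ : ℤ) (k k' : ℕ) (X : Kernel) : Kernel := fun x z =>
  ∑ y ∈ cutLabels N (j₀ - k), ∑ y' ∈ cutLabels N (j₁ + k'),
    X y y' * path N (j₀ - k) k y x * path N j₁ k' z y'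

theorem isCP_bdKernel (B : ℕ → ℕ → ℕ → ℕ → ℂ) : IsCP (bdKernel B) :=
  ⟨Unit, Finset.univ, fun _ l ξ r η => B l ξ η r, fun l ξ ξ' r η η' => by simp [bdKernel]⟩

theorem IsCP.pushKernel {X : Kernel} (h : IsCP X) (j₀ j₁ : ℤ) (k k' : ℕ) :
    IsCP (pushKernel N j₀ j₁ k k' X) := by
  have h1 := ((isCP_cellTransfer (fun i => N (j₀ - k + i)) k).swap.comp h
    (Finset.range (N (j₀ - k)).leftReg) (Finset.range (N (j₀ - k)).leftAux)).comp
    (isCP_cellTransfer (fun i => N (j₁ + i)) k').swap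
    (Finset.range (N (j₁ + k')).leftReg) (Finset.range (N (j₁ + k')).leftAux)
  refine (congrArg IsCP ?_).mp h1
  funext x z
  simp only [Biunitary.pushKernel, Finset.sum_mul]
  rw [Finset.sum_comm]
  refine Finset.sum_congr rfl fun y _ => Finset.sum_congr rfl fun y' _ => ?_
  simp only [path]
  ring

theorem pushKernel_add {X : Kernel} (j₀ j₁ : ℤ) (k k' m m' : ℕ) {x z : ℕ × ℕ × ℕ}
    (hx : x ∈ cutLabels N j₀) :
    pushKernel N j₀ j₁ (m + k) (k' + m') X x z =
      pushKernel N j₀ j₁ k k' (pushKernel N (j₀ - k) (j₁ + k') m m' X) x z := by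
  have e1 : j₀ - ((m + k : ℕ) : ℤ) = j₀ - k - m := by push_cast; ring
  have e2 : j₁ + ((k' + m' : ℕ) : ℤ) = j₁ + k' + m' := by push_cast; ring
  simp only [pushKernel, e1, e2]
  have h1 : ∀ y, path N (j₀ - k - m) (m + k) y x = ∑ y₁ ∈ cutLabels N (j₀ - k),
      path N (j₀ - k - m) m y y₁ * path N (j₀ - k) k y₁ x := by
    intro y
    have := path_add (N := N) (j := j₀ - k - m) m k (y := y) (x := x) (by simpa using hx)
    simpa using this
  have h2 : ∀ y' ∈ cutLabels N (j₁ + k' + m'), path N j₁ (k' + m') z y' =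
      ∑ z₁ ∈ cutLabels N (j₁ + k'), path N j₁ k' z z₁ * path N (j₁ + k') m' z₁ y' :=
    fun y' hy' => path_add k' m' hy'
  rw [Finset.sum_congr rfl fun y _ => Finset.sum_congr rfl fun y' hy' => by rw [h1 y, h2 y' hy']]
  simp only [Finset.sum_mul, Finset.mul_sum]
  rw [Finset.sum_congr rfl fun _ _ => Finset.sum_congr rfl fun _ _ => Finset.sum_comm]
  rw [Finset.sum_congr rfl fun _ _ => Finset.sum_comm, Finset.sum_comm]
  refine (Finset.sum_congr rfl fun y₁ _ => ?_)
  rw [Finset.sum_congr rfl fun _ _ => Finset.sum_comm, Finset.sum_comm]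
  refine Finset.sum_congr rfl fun z₁ _ => Finset.sum_congr rfl fun y _ =>
    Finset.sum_congr rfl fun y' _ => ?_
  ring

/-- Pairing with `diag` passes through both stretches at the cost of their eigenvalues `a`, `b`;
what remains is `a b ∑ ‖B‖²`, positive because `B` has a nonzero entry. -/
theorem pushKernel_bdKernel_trace (hfit : FitsBelow N C) (hu : ∀ j, (N j).IsHorizontallyUnitary)
    (j₀ j₁ : ℤ) (k k' : ℕ) {B : ℕ → ℕ → ℕ → ℕ → ℂ}
    (hB : ∃ l < (N (j₀ - k)).leftReg, ∃ ξ < (N (j₀ - k)).leftAux, ∃ η < (N (j₁ + k')).leftAux,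
      ∃ r < (N (j₁ + k')).leftReg, B l ξ η r ≠ 0) :
    ∃ T : ℝ, 0 < T ∧ ∑ y ∈ cutLabels N j₀, ∑ y' ∈ cutLabels N j₁,
      diag y * diag y' * pushKernel N j₀ j₁ k k' (bdKernel B) y y' = T := by
  obtain ⟨a, ha, h1⟩ := path_diag_right hfit hu (j₀ - k) k
  obtain ⟨b, hb, h2⟩ := path_diag_left hfit hu j₁ k'
  rw [sub_add_cancel] at h1
  refine ⟨a * b * ∑ l ∈ Finset.range (N (j₀ - k)).leftReg, ∑ ξ ∈ Finset.range (N (j₀ - k)).leftAux,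
    ∑ r ∈ Finset.range (N (j₁ + k')).leftReg, ∑ η ∈ Finset.range (N (j₁ + k')).leftAux,
      ‖B l ξ η r‖ ^ 2, ?_, ?_⟩
  · obtain ⟨l, hl, ξ, hξ, η, hη, r, hr, h⟩ := hB
    refine mul_pos (mul_pos ha hb) ?_
    refine Finset.sum_pos' (fun _ _ => by positivity) ⟨l, Finset.mem_range.2 hl, ?_⟩
    refine Finset.sum_pos' (fun _ _ => by positivity) ⟨ξ, Finset.mem_range.2 hξ, ?_⟩
    refine Finset.sum_pos' (fun _ _ => by positivity) ⟨r, Finset.mem_range.2 hr, ?_⟩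
    refine Finset.sum_pos' (fun _ _ => by positivity) ⟨η, Finset.mem_range.2 hη, ?_⟩
    positivity
  · have h3 : ∑ y ∈ cutLabels N j₀, ∑ y' ∈ cutLabels N j₁,
        diag y * diag y' * pushKernel N j₀ j₁ k k' (bdKernel B) y y' =
        ∑ w ∈ cutLabels N (j₀ - k), ∑ w' ∈ cutLabels N (j₁ + k'), bdKernel B w w' *
          (∑ y ∈ cutLabels N j₀, diag y * path N (j₀ - k) k w y) *
          (∑ y' ∈ cutLabels N j₁, diag y' * path N j₁ k' y' w') := by
      simp only [pushKernel, Finset.mul_sum, Finset.sum_mul]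
      rw [Finset.sum_congr rfl fun _ _ => Finset.sum_comm, Finset.sum_comm]
      refine Finset.sum_congr rfl fun w _ => ?_
      rw [Finset.sum_congr rfl fun _ _ => Finset.sum_comm, Finset.sum_comm]
      refine Finset.sum_congr rfl fun w' _ => ?_
      rw [Finset.sum_comm]
      exact Finset.sum_congr rfl fun _ _ => Finset.sum_congr rfl fun _ _ => by ring
    rw [h3, Finset.sum_congr rfl fun w hw => Finset.sum_congr rfl fun w' hw' => by
      rw [h1 w hw, h2 w' hw']]
    rw [Finset.sum_congr rfl fun w _ => show _ = diag w * (a * b *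
      ∑ w' ∈ cutLabels N (j₁ + k'), diag w' * bdKernel B w w') by
        rw [Finset.mul_sum, Finset.mul_sum]
        exact Finset.sum_congr rfl fun _ _ => by ring]
    simp only [cutLabels, auxPairs, sum_diag_mul, ← Finset.mul_sum]
    push_cast
    congr 1
    refine Finset.sum_congr rfl fun l _ => Finset.sum_congr rfl fun ξ _ =>
      Finset.sum_congr rfl fun r _ => Finset.sum_congr rfl fun η _ => ?_
    rw [bdKernel, Complex.star_def, Complex.mul_conj']

/-- The windows need not end at a cell boundary. The fixed inner stretches `k₀`, `k₀'` contain the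
contracting runs; everything further out turns `B` into a completely positive density `Y` whose
entries are bounded by its positive trace `T`. The inner stretches then project `Y` onto `diag ⊗
diag` with weight proportional to `T`, and the error is relative to `T` too, hence uniform in `B`
and in the window. -/
theorem joint_limit (hfit : FitsBelow N C) (hsolv : IsSolvable N) (j₀ j₁ : ℤ) {ε : ℝ}
    (hε : 0 < ε) : ∃ k₀ k₀' : ℕ, ∀ k ≥ k₀, ∀ k' ≥ k₀', ∀ B : ℕ → ℕ → ℕ → ℕ → ℂ,
      (∃ l < (N (j₀ - k)).leftReg, ∃ ξ < (N (j₀ - k)).leftAux, ∃ η < (N (j₁ + k')).leftAux,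
        ∃ r < (N (j₁ + k')).leftReg, B l ξ η r ≠ 0) →
      ∃ Λ : ℝ, 0 < Λ ∧ ∀ x ∈ cutLabels N j₀, ∀ z ∈ cutLabels N j₁,
        ‖pushKernel N j₀ j₁ k k' (bdKernel B) x z - Λ * (diag x * diag z)‖ ≤ ε * Λ := by
  obtain ⟨dL, DL, hdL, hDL, hL⟩ := left_limit hfit hsolv j₀
  obtain ⟨dR, DR, hdR, hDR, hR⟩ := right_limit hfit hsolv j₁
  -- After the factor `lL * lR * T / (dL * dR)`, that is `Λ`, is taken out, the three error terms of
  -- the product add up to `c * δ`.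
  set c : ℝ := DL * DR * (dL + dR + dL * dR) with hc
  have hc0 : 0 ≤ c := by positivity
  -- The cap at `1` lets the term quadratic in the errors be estimated linearly.
  set δ : ℝ := min 1 (ε / (c + 1)) with hδ
  have hδ0 : 0 < δ := lt_min one_pos (by positivity)
  have hδ1 : δ ≤ 1 := min_le_left _ _
  have hδc : c * δ ≤ ε := by
    calc c * δ ≤ (c + 1) * (ε / (c + 1)) :=
          mul_le_mul (by linarith) (min_le_right _ _) hδ0.le (by linarith)
      _ = ε := by field_simp
  obtain ⟨k₀, lL, hlL, hcL, hPL⟩ := hL δ hδ0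
  obtain ⟨k₀', lR, hlR, hcR, hPR⟩ := hR δ hδ0
  refine ⟨k₀, k₀', fun k hk k' hk' B hB => ?_⟩
  obtain ⟨m, rfl⟩ : ∃ m, k = m + k₀ := ⟨k - k₀, by omega⟩
  obtain ⟨m', rfl⟩ : ∃ m', k' = k₀' + m' := ⟨k' - k₀', by omega⟩
  have e1 : j₀ - ((m + k₀ : ℕ) : ℤ) = j₀ - k₀ - m := by push_cast; ring
  have e2 : j₁ + ((k₀' + m' : ℕ) : ℤ) = j₁ + k₀' + m' := by push_cast; ring
  rw [e1, e2] at hB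
  obtain ⟨T, hT0, hT⟩ := pushKernel_bdKernel_trace hfit hsolv.unitary (j₀ - k₀) (j₁ + k₀') m m' hB
  set Y := pushKernel N (j₀ - k₀) (j₁ + k₀') m m' (bdKernel B) with hY
  have hYb : ∀ y ∈ cutLabels N (j₀ - k₀), ∀ y' ∈ cutLabels N (j₁ + k₀'), ‖Y y y'‖ ≤ T :=
    fun y hy y' hy' => ((isCP_bdKernel B).pushKernel _ _ _ _).norm_le_trace hT hy hy'
  refine ⟨lL * lR * T / (dL * dR), by positivity, fun x hx z hz => ?_⟩
  rw [pushKernel_add _ _ _ _ _ _ hx, ← hY, pushKernel]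
  have h1 : ((lL * lR * T / (dL * dR) : ℝ) : ℂ) * (diag x * diag z) =
      ∑ y ∈ cutLabels N (j₀ - k₀), ∑ y' ∈ cutLabels N (j₁ + k₀'), Y y y' *
        ((lL : ℂ) / dL * (diag y * diag x)) * ((lR : ℂ) / dR * (diag z * diag y')) := by
    push_cast
    rw [← hT, show ∀ S : ℂ, (lL : ℂ) * lR * S / (dL * dR) * (diag x * diag z) =
      ((lL : ℂ) / dL * diag x) * ((lR : ℂ) / dR * diag z) * S from fun S => by ring]
    simp only [Finset.mul_sum]
    exact Finset.sum_congr rfl fun _ _ => Finset.sum_congr rfl fun _ _ => by ring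
  rw [h1, ← Finset.sum_sub_distrib]
  simp only [← Finset.sum_sub_distrib]
  have hbound : ∀ y ∈ cutLabels N (j₀ - k₀), ∀ y' ∈ cutLabels N (j₁ + k₀'),
      ‖Y y y' * path N (j₀ - k₀) k₀ y x * path N j₁ k₀' z y' -
        Y y y' * ((lL : ℂ) / dL * (diag y * diag x)) * ((lR : ℂ) / dR * (diag z * diag y'))‖ ≤
      T * (lL * lR * (1 / dR + 1 / dL + 1) * δ) := by
    intro y hy y' hy'
    have hp := hPL y hy x hx
    have hq := hPR z hz y' hy'
    set P := path N (j₀ - k₀) k₀ y x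
    set Q := path N j₁ k₀' z y'
    set P0 := (lL : ℂ) / dL * (diag y * diag x)
    set Q0 := (lR : ℂ) / dR * (diag z * diag y')
    have hP0 : ‖P0‖ ≤ lL / dL := by
      simp only [P0, norm_mul, norm_div, Complex.norm_real, Real.norm_of_nonneg hlL.le,
        Real.norm_of_nonneg hdL.le]
      refine mul_le_of_le_one_right (by positivity) ?_
      exact mul_le_one₀ (norm_diag_le _) (norm_nonneg _) (norm_diag_le _)
    have hQ0 : ‖Q0‖ ≤ lR / dR := by
      simp only [Q0, norm_mul, norm_div, Complex.norm_real, Real.norm_of_nonneg hlR.le,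
        Real.norm_of_nonneg hdR.le]
      refine mul_le_of_le_one_right (by positivity) ?_
      exact mul_le_one₀ (norm_diag_le _) (norm_nonneg _) (norm_diag_le _)
    rw [show Y y y' * P * Q - Y y y' * P0 * Q0 =
      Y y y' * ((P - P0) * Q0 + P0 * (Q - Q0) + (P - P0) * (Q - Q0)) by ring, norm_mul]
    refine mul_le_mul (hYb y hy y' hy') ?_ (norm_nonneg _) hT0.le
    calc _ ≤ ‖P - P0‖ * ‖Q0‖ + ‖P0‖ * ‖Q - Q0‖ + ‖P - P0‖ * ‖Q - Q0‖ := by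
          refine (norm_add_le _ _).trans (add_le_add ((norm_add_le _ _).trans ?_) ?_) <;>
            simp only [norm_mul, le_refl]
      _ ≤ δ * lL * (lR / dR) + lL / dL * (δ * lR) + δ * lL * (1 * lR) := by
          have hq1 : ‖Q - Q0‖ ≤ 1 * lR := hq.trans (by gcongr)
          gcongr
      _ = _ := by ring
  calc _ ≤ ∑ y ∈ cutLabels N (j₀ - k₀), ∑ y' ∈ cutLabels N (j₁ + k₀'),
        T * (lL * lR * (1 / dR + 1 / dL + 1) * δ) :=
        (norm_sum_le _ _).trans (Finset.sum_le_sum fun y hy =>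
          (norm_sum_le _ _).trans (Finset.sum_le_sum fun y' hy' => hbound y hy y' hy'))
    _ = (cutLabels N (j₀ - k₀)).card * (cutLabels N (j₁ + k₀')).card *
        (T * (lL * lR * (1 / dR + 1 / dL + 1) * δ)) := by
        simp only [Finset.sum_const, nsmul_eq_mul]; ring
    _ ≤ DL * DR * (T * (lL * lR * (1 / dR + 1 / dL + 1) * δ)) := by gcongr
    _ = c * δ * (lL * lR * T / (dL * dR)) := by rw [hc]; field_simp
    _ ≤ _ := mul_le_mul_of_nonneg_right hδc (by positivity)

end

/-! ### Removing a gate by horizontal unitarity. -/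

section

/-- `W` does not depend on the labels of site `i` in its two arguments. -/
def Indep₂ (i : Site) (W : Cfg → Cfg → ℂ) : Prop :=
  ∀ σ σ' k k', W (Function.update σ i k) (Function.update σ' i k') = W σ σ'

theorem assign_update_of_mem {S : Finset Site} {i : Site} (hi : i ∈ S) (d : Site → ℕ)
    (e : (i : {i // i ∈ S}) → Fin (d i)) (σ : Cfg) (k : ℕ) :
    assign S d e (Function.update σ i k) = assign S d e σ := by
  funext j
  by_cases h : j ∈ S
  · simp [assign, h]
  · have : j ≠ i := fun h' => h (h' ▸ hi)
    simp [assign, h, this]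

theorem assign_update_of_notMem {S : Finset Site} {i : Site} (hi : i ∉ S) (d : Site → ℕ)
    (e : (i : {i // i ∈ S}) → Fin (d i)) (σ : Cfg) (k : ℕ) :
    assign S d e (Function.update σ i k) = Function.update (assign S d e σ) i k := by
  funext j
  by_cases h : j = i
  · subst h; simp [assign, hi]
  · simp [assign, Function.update_of_ne h]

theorem tr_indep_of_mem {S : Finset Site} {i : Site} (hi : i ∈ S) (d : Site → ℕ)
    (F : Cfg → Cfg → ℂ) : Indep₂ i (tr S d F) := by
  intro σ σ' k k'
  simp only [tr, assign_update_of_mem hi]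

theorem Indep₂.tr {i : Site} {F : Cfg → Cfg → ℂ} (h : Indep₂ i F) (S : Finset Site)
    (d : Site → ℕ) : Indep₂ i (tr S d F) := by
  by_cases hi : i ∈ S
  · exact tr_indep_of_mem hi d F
  · intro σ σ' k k'
    simp only [Biunitary.tr, assign_update_of_notMem hi, h _ _]

theorem assign_setGate {S : Finset Site} {c : ℤ} (hS : Disjoint (gateSites c) S) (d : Site → ℕ)
    (e : (i : {i // i ∈ S}) → Fin (d i)) (σ : Cfg) (x : ℕ × ℕ × ℕ) :
    assign S d e (setGate σ c x) = setGate (assign S d e σ) c x := by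
  have h : ∀ i ∈ gateSites c, i ∉ S := fun i hi => Finset.disjoint_left.1 hS hi
  rw [setGate, assign_update_of_notMem (h _ (by simp [gateSites])),
    assign_update_of_notMem (h _ (by simp [gateSites])),
    assign_update_of_notMem (h _ (by simp [gateSites])), setGate]

theorem tr_pair {i i' : Site} (h : i ≠ i') (d : Site → ℕ) (F : Cfg → Cfg → ℂ) (σ σ' : Cfg) :
    tr {i, i'} d F σ σ' = ∑ k ∈ Finset.range (d i), ∑ k' ∈ Finset.range (d i'),
      F (Function.update (Function.update σ i k) i' k')
        (Function.update (Function.update σ' i k) i' k') := by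
  rw [tr_insert (by simpa using h)]
  simp only [← insert_empty_eq i', tr_insert (Finset.notMem_empty _), tr_empty]

/-- The delta in `m`, `v` makes gate and conjugate share their lower region and near lower wire. The
remaining sum over the near side is an inner product of two columns of the sideways matrix: it
forces the far labels to agree, `P` for the fixed ones and `u = u'` for the far lower wire, and
leaves a trace of `K`. -/
theorem sum_of_side_isometry {R V V' M U : Finset ℕ} {g g' : ℕ → ℕ → ℕ → ℕ → ℕ → ℂ}
    {K : ℕ → ℕ → ℕ → ℂ} {κ : ℂ} {P : Prop} [Decidable P]
    (h : ∀ m ∈ M, ∀ u ∈ U, ∀ u' ∈ U, ∑ y ∈ R ×ˢ V ×ˢ V', g y.1 y.2.2 y.2.1 m u *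
      star (g' y.1 y.2.2 y.2.1 m u') = if P ∧ u = u' then κ else 0) :
    ∑ l ∈ R, ∑ v' ∈ V', ∑ v ∈ V, ∑ m ∈ M, ∑ u ∈ U, ∑ w ∈ V, ∑ m' ∈ M, ∑ u' ∈ U,
      g l v' v m u * star (g' l v' w m' u') * (if m = m' ∧ v = w then K m u u' else 0) =
    if P then κ * ∑ m ∈ M, ∑ u ∈ U, K m u u else 0 := by
  have h1 : ∀ l ∈ R, ∀ v' ∈ V', ∀ v ∈ V, ∀ m ∈ M, ∀ u ∈ U,
      (∑ w ∈ V, ∑ m' ∈ M, ∑ u' ∈ U,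
        g l v' v m u * star (g' l v' w m' u') * (if m = m' ∧ v = w then K m u u' else 0)) =
      ∑ u' ∈ U, g l v' v m u * star (g' l v' v m u') * K m u u' := by
    intro l _ v' _ v hv m hm u _
    rw [Finset.sum_eq_single_of_mem v hv, Finset.sum_eq_single_of_mem m hm]
    · simp
    · intro m' _ hm'
      simp [hm'.symm]
    · intro w _ hw
      simp [hw.symm]
  rw [Finset.sum_congr rfl fun l hl => Finset.sum_congr rfl fun v' hv' =>
    Finset.sum_congr rfl fun v hv => Finset.sum_congr rfl fun m hm =>
    Finset.sum_congr rfl fun u hu => h1 l hl v' hv' v hv m hm u hu]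
  have h2 : ∑ l ∈ R, ∑ v' ∈ V', ∑ v ∈ V, ∑ m ∈ M, ∑ u ∈ U, ∑ u' ∈ U,
      g l v' v m u * star (g' l v' v m u') * K m u u' =
      ∑ y ∈ R ×ˢ V ×ˢ V', ∑ m ∈ M, ∑ u ∈ U, ∑ u' ∈ U,
        g y.1 y.2.2 y.2.1 m u * star (g' y.1 y.2.2 y.2.1 m u') * K m u u' := by
    simp only [Finset.sum_product]
    exact Finset.sum_congr rfl fun _ _ => Finset.sum_comm
  rw [h2, Finset.sum_comm]
  have h3 : ∀ m ∈ M, ∑ y ∈ R ×ˢ V ×ˢ V', ∑ u ∈ U, ∑ u' ∈ U,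
        g y.1 y.2.2 y.2.1 m u * star (g' y.1 y.2.2 y.2.1 m u') * K m u u' =
      if P then κ * ∑ u ∈ U, K m u u else 0 := by
    intro m hm
    rw [Finset.sum_comm]
    rw [Finset.sum_congr rfl fun _ _ => Finset.sum_comm]
    simp only [← Finset.sum_mul]
    rw [Finset.sum_congr rfl fun u hu => Finset.sum_congr rfl fun u' hu' => by
      rw [h m hm u hu u' hu']]
    by_cases hP : P
    · simp only [hP, true_and, if_true, ite_mul, zero_mul, Finset.mul_sum]
      exact Finset.sum_congr rfl fun u hu => by rw [Finset.sum_ite_eq, if_pos hu]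
    · simp [hP]
  rw [Finset.sum_congr rfl h3]
  by_cases hP : P <;> simp [hP, Finset.mul_sum]

namespace Circuit

variable {C : Circuit}

variable (C) in
/-- A gate acting on the first, and its conjugate on the second argument. -/
def gatePair (s : ℕ) (c : ℤ) (G : Cfg → Cfg → ℂ) (σ σ' : Cfg) : ℂ :=
  ∑ x ∈ C.labels s c, ∑ x' ∈ C.labels s c,
    C.gate s c (σ (Sum.inl (c - 1))) (σ (Sum.inl (c + 1)))
      (σ (Sum.inr (c - 1)), σ (Sum.inl c), σ (Sum.inr c)) x *
    star (C.gate s c (σ' (Sum.inl (c - 1))) (σ' (Sum.inl (c + 1)))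
      (σ' (Sum.inr (c - 1)), σ' (Sum.inl c), σ' (Sum.inr c)) x') *
    G (setGate σ c x) (setGate σ' c x')

theorem gatePair_sum_mul_star {α : Type*} (I : Finset α) (ψ φ : α → Cfg → ℂ) (s : ℕ) (c : ℤ) :
    C.gatePair s c (fun τ τ' => ∑ a ∈ I, ψ a τ * star (φ a τ')) =
      fun τ τ' => ∑ a ∈ I, C.gateOp s c (ψ a) τ * star (C.gateOp s c (φ a) τ') := by
  funext τ τ'
  simp only [gatePair, gateOp, star_sum, Finset.sum_mul_sum]
  simp only [Finset.mul_sum]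
  rw [Finset.sum_congr rfl fun _ _ => Finset.sum_comm, Finset.sum_comm]
  refine Finset.sum_congr rfl fun a _ => Finset.sum_congr rfl fun x _ =>
    Finset.sum_congr rfl fun x' _ => ?_
  rw [star_mul']
  ring

theorem tr_gatePair {s : ℕ} {c : ℤ} {S : Finset Site} (hS : Disjoint (gateSites c) S)
    (hl : Sum.inl (c - 1) ∉ S) (hr : Sum.inl (c + 1) ∉ S) (d : Site → ℕ) (G : Cfg → Cfg → ℂ) :
    tr S d (C.gatePair s c G) = C.gatePair s c (tr S d G) := by
  funext σ σ'
  have h : ∀ i ∉ S, ∀ (e : (i : {i // i ∈ S}) → Fin (d i)) (σ : Cfg), assign S d e σ i = σ i :=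
    fun i hi e σ => by simp [assign, hi]
  have hg : ∀ i ∈ gateSites c, i ∉ S := fun i hi => Finset.disjoint_left.1 hS hi
  have h1 := hg (Sum.inr c) (by simp [gateSites])
  have h2 := hg (Sum.inr (c - 1)) (by simp [gateSites])
  have h3 := hg (Sum.inl c) (by simp [gateSites])
  simp only [tr, gatePair, h _ hl, h _ hr, h _ h1, h _ h2, h _ h3, ← assign_setGate hS,
    Finset.mul_sum]
  rw [Finset.sum_comm]
  exact Finset.sum_congr rfl fun x _ => Finset.sum_comm

variable (C) in
/-- The partial trace `G` over everything on the left of wire `e` is `κ W` times the condition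
that the labels of wire `e` and region `e + 1` agree, provided that those of region `e` do. -/
def PeeledLeft (s : ℕ) (e : ℤ) (G W : Cfg → Cfg → ℂ) (κ : ℂ) : Prop :=
  ∀ σ σ' : Cfg, σ (Sum.inl e) = σ' (Sum.inl e) → σ (Sum.inl e) < C.regDim s e →
    σ (Sum.inl (e + 1)) < C.regDim s (e + 1) → σ' (Sum.inl (e + 1)) < C.regDim s (e + 1) →
    σ (Sum.inr e) < C.wireDim s e → σ' (Sum.inr e) < C.wireDim s e →
    G σ σ' = if σ (Sum.inl (e + 1)) = σ' (Sum.inl (e + 1)) ∧ σ (Sum.inr e) = σ' (Sum.inr e)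
      then κ * W σ σ' else 0

variable (C) in
/-- The mirror image of `PeeledLeft`, for everything on the right of wire `e - 1`. -/
def PeeledRight (s : ℕ) (e : ℤ) (G W : Cfg → Cfg → ℂ) (κ : ℂ) : Prop :=
  ∀ σ σ' : Cfg, σ (Sum.inl e) = σ' (Sum.inl e) → σ (Sum.inl e) < C.regDim s e →
    σ (Sum.inl (e - 1)) < C.regDim s (e - 1) → σ' (Sum.inl (e - 1)) < C.regDim s (e - 1) →
    σ (Sum.inr (e - 1)) < C.wireDim s (e - 1) → σ' (Sum.inr (e - 1)) < C.wireDim s (e - 1) →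
    G σ σ' = if σ (Sum.inl (e - 1)) = σ' (Sum.inl (e - 1)) ∧
        σ (Sum.inr (e - 1)) = σ' (Sum.inr (e - 1)) then κ * W σ σ' else 0

/-- What `G` has already peeled forces agreement of the gate's lower left wire and lower region. The
left region and the upper left wire are now traced and the upper region is common, so sideways
isometry passes the agreement on to the right: to the upper right wire and the right region, while
the lower region and lower right wire become traced in `W`. -/
theorem PeeledLeft.gatePair {s : ℕ} {c : ℤ} (hb : C.IsBiunitaryAt s c) (hc : Even (c + (s : ℤ))) :
    ∃ κ' : ℂ, κ' ≠ 0 ∧ ∀ {G W : Cfg → Cfg → ℂ} {κ : ℂ} {d d' : Site → ℕ},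
      C.PeeledLeft s (c - 1) G W κ → Indep₂ (Sum.inl (c - 1)) W → Indep₂ (Sum.inr (c - 1)) W →
      d (Sum.inl (c - 1)) = C.regDim s (c - 1) → d (Sum.inr (c - 1)) = C.wireDim (s + 1) (c - 1) →
      d' (Sum.inl c) = C.regDim s c → d' (Sum.inr c) = C.wireDim s c →
      C.PeeledLeft (s + 1) c (tr {Sum.inl (c - 1), Sum.inr (c - 1)} d (C.gatePair s c G))
        (tr {Sum.inl c, Sum.inr c} d' W) (κ * κ') := by
  obtain ⟨κ', hκ', hh⟩ := hb.horiz_isometry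
  refine ⟨κ', hκ', ?_⟩
  intro G W κ d d' hG hi1 hi2 d1 d2 d3 d4 σ σ' hm hm1 hr hr' hw hw'
  have hreg : C.regDim (s + 1) (c + 1) = C.regDim s (c + 1) :=
    C.regDim_succ s (c + 1) (by
      rw [Int.not_even_iff_odd, show c + 1 + (s : ℤ) = c + s + 1 by ring]; exact hc.add_one)
  rw [hreg] at hr hr'
  rw [tr_pair (by simp), tr_pair (by simp), d1, d2, d3, d4]
  have e1 : c - 1 ≠ c := by omega
  have e2 : c + 1 ≠ c - 1 := by omega
  have e3 : c + 1 ≠ c := by omega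
  -- The incoming label of wire `c - 1` overwrites the traced outgoing label `v`. The left sites are
  -- written last because `W` does not depend on them.
  have hset : ∀ (τ : Cfg) l v x, setGate (Function.update (Function.update τ (Sum.inl (c - 1)) l)
      (Sum.inr (c - 1)) v) c x = Function.update (Function.update (Function.update
        (Function.update τ (Sum.inl c) x.2.1) (Sum.inr c) x.2.2) (Sum.inl (c - 1)) l)
        (Sum.inr (c - 1)) x.1 := by
    intro τ l v x
    funext i
    rcases i with b | b
    · simp only [setGate_inl, Function.update_apply, Sum.inl.injEq, reduceCtorEq, if_false]
      split_ifs <;> first | rfl | omega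
    · simp only [setGate_inr, Function.update_apply, Sum.inr.injEq, reduceCtorEq, if_false]
      split_ifs <;> first | rfl | omega
  have key : ∀ l ∈ Finset.range (C.regDim s (c - 1)),
      ∀ v ∈ Finset.range (C.wireDim (s + 1) (c - 1)), C.gatePair s c G
        (Function.update (Function.update σ (Sum.inl (c - 1)) l) (Sum.inr (c - 1)) v)
        (Function.update (Function.update σ' (Sum.inl (c - 1)) l) (Sum.inr (c - 1)) v) =
      ∑ x ∈ C.labels s c, ∑ x' ∈ C.labels s c,
        C.gate s c l (σ (Sum.inl (c + 1))) (v, σ (Sum.inl c), σ (Sum.inr c)) x *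
        star (C.gate s c l (σ' (Sum.inl (c + 1))) (v, σ (Sum.inl c), σ' (Sum.inr c)) x') *
        (if x.2.1 = x'.2.1 ∧ x.1 = x'.1 then κ * W
          (Function.update (Function.update σ (Sum.inl c) x.2.1) (Sum.inr c) x.2.2)
          (Function.update (Function.update σ' (Sum.inl c) x.2.1) (Sum.inr c) x'.2.2) else 0) := by
    intro l hl v hv
    refine Finset.sum_congr rfl fun x hx => Finset.sum_congr rfl fun x' hx' => ?_
    simp only [labels, Finset.mem_product, Finset.mem_range] at hx hx' hl
    have h := hG (setGate (Function.update (Function.update σ (Sum.inl (c - 1)) l)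
        (Sum.inr (c - 1)) v) c x)
      (setGate (Function.update (Function.update σ' (Sum.inl (c - 1)) l)
        (Sum.inr (c - 1)) v) c x')
      (by simp [setGate_inl]) (by simpa [setGate_inl] using hl)
      (by simpa [setGate_inl] using hx.2.1) (by simpa [setGate_inl] using hx'.2.1)
      (by simpa [setGate_inr] using hx.1) (by simpa [setGate_inr] using hx'.1)
    rw [h]
    simp only [setGate_inl, setGate_inr, sub_add_cancel, if_true, e1, if_false]
    simp only [hset, hi2 _ _, hi1 _ _]
    congr 1
    · congr 1
      · simp [e1.symm, e2]
      · simp [e1.symm, e2, hm]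
    · split_ifs with h
      · rw [h.1]
      · rfl
  rw [Finset.sum_congr rfl fun l hl => Finset.sum_congr rfl fun v hv => key l hl v hv]
  simp only [labels, Finset.sum_product]
  rw [sum_of_side_isometry (P := σ (Sum.inl (c + 1)) = σ' (Sum.inl (c + 1)) ∧
    σ (Sum.inr c) = σ' (Sum.inr c)) (κ := κ')
    (g := fun l v' v m u => C.gate s c l (σ (Sum.inl (c + 1)))
      (v', σ (Sum.inl c), σ (Sum.inr c)) (v, m, u))
    (g' := fun l v' v m u => C.gate s c l (σ' (Sum.inl (c + 1)))
      (v', σ (Sum.inl c), σ' (Sum.inr c)) (v, m, u))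
    (K := fun m u u' => κ * W
          (Function.update (Function.update σ (Sum.inl c) m) (Sum.inr c) u)
          (Function.update (Function.update σ' (Sum.inl c) m) (Sum.inr c) u'))]
  · congr 1
    simp only [← Finset.mul_sum]
    ring
  · intro m hm' u hu u' hu'
    have := (hh (σ (Sum.inl c)) hm1 m (Finset.mem_range.1 hm')).1
      (σ (Sum.inl (c + 1)), u, σ (Sum.inr c))
      (by simpa [rightLabels, hr, hw] using hu)
      (σ' (Sum.inl (c + 1)), u', σ' (Sum.inr c))
      (by simpa [rightLabels, hr', hw'] using hu')
    rw [leftLabels] at this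
    refine Eq.trans this ?_
    congr 1
    simp only [Prod.mk.injEq, eq_iff_iff]
    tauto

/-- Mirror image of `PeeledLeft.gatePair`, using the other sideways relation, in which the right
labels are summed and the left ones forced to agree. -/
theorem PeeledRight.gatePair {s : ℕ} {c : ℤ} (hb : C.IsBiunitaryAt s c)
    (hc : Even (c + (s : ℤ))) :
    ∃ κ' : ℂ, κ' ≠ 0 ∧ ∀ {G W : Cfg → Cfg → ℂ} {κ : ℂ} {d d' : Site → ℕ},
      C.PeeledRight s (c + 1) G W κ → Indep₂ (Sum.inl (c + 1)) W → Indep₂ (Sum.inr c) W →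
      d (Sum.inl (c + 1)) = C.regDim s (c + 1) → d (Sum.inr c) = C.wireDim (s + 1) c →
      d' (Sum.inl c) = C.regDim s c → d' (Sum.inr (c - 1)) = C.wireDim s (c - 1) →
      C.PeeledRight (s + 1) c (tr {Sum.inl (c + 1), Sum.inr c} d (C.gatePair s c G))
        (tr {Sum.inl c, Sum.inr (c - 1)} d' W) (κ * κ') := by
  obtain ⟨κ', hκ', hh⟩ := hb.horiz_isometry
  refine ⟨κ', hκ', ?_⟩
  intro G W κ d d' hG hi1 hi2 d1 d2 d3 d4 σ σ' hm hm1 hr hr' hw hw'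
  have hreg : C.regDim (s + 1) (c - 1) = C.regDim s (c - 1) :=
    C.regDim_succ s (c - 1) (by
      rw [Int.not_even_iff_odd, show c - 1 + (s : ℤ) = c + s - 1 by ring]; exact hc.sub_odd odd_one)
  rw [hreg] at hr hr'
  rw [tr_pair (by simp), tr_pair (by simp), d1, d2, d3, d4]
  have e1 : c - 1 ≠ c := by omega
  have e2 : c - 1 ≠ c + 1 := by omega
  have e3 : c + 1 ≠ c := by omega
  have hset : ∀ (τ : Cfg) l v x, setGate (Function.update (Function.update τ (Sum.inl (c + 1)) l)
      (Sum.inr c) v) c x = Function.update (Function.update (Function.update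
        (Function.update τ (Sum.inl c) x.2.1) (Sum.inr (c - 1)) x.1) (Sum.inl (c + 1)) l)
        (Sum.inr c) x.2.2 := by
    intro τ l v x
    funext i
    rcases i with b | b
    · simp only [setGate_inl, Function.update_apply, Sum.inl.injEq, reduceCtorEq, if_false]
      split_ifs <;> first | rfl | omega
    · simp only [setGate_inr, Function.update_apply, Sum.inr.injEq, reduceCtorEq, if_false]
      split_ifs <;> rfl
  have key : ∀ l ∈ Finset.range (C.regDim s (c + 1)),
      ∀ v ∈ Finset.range (C.wireDim (s + 1) c), C.gatePair s c G
        (Function.update (Function.update σ (Sum.inl (c + 1)) l) (Sum.inr c) v)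
        (Function.update (Function.update σ' (Sum.inl (c + 1)) l) (Sum.inr c) v) =
      ∑ x ∈ C.labels s c, ∑ x' ∈ C.labels s c,
        C.gate s c (σ (Sum.inl (c - 1))) l (σ (Sum.inr (c - 1)), σ (Sum.inl c), v) x *
        star (C.gate s c (σ' (Sum.inl (c - 1))) l (σ' (Sum.inr (c - 1)), σ (Sum.inl c), v) x') *
        (if x.2.1 = x'.2.1 ∧ x.2.2 = x'.2.2 then κ * W
          (Function.update (Function.update σ (Sum.inl c) x.2.1) (Sum.inr (c - 1)) x.1)
          (Function.update (Function.update σ' (Sum.inl c) x.2.1) (Sum.inr (c - 1)) x'.1)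
          else 0) := by
    intro l hl v hv
    refine Finset.sum_congr rfl fun x hx => Finset.sum_congr rfl fun x' hx' => ?_
    simp only [labels, Finset.mem_product, Finset.mem_range] at hx hx' hl
    have h := hG (setGate (Function.update (Function.update σ (Sum.inl (c + 1)) l)
        (Sum.inr c) v) c x)
      (setGate (Function.update (Function.update σ' (Sum.inl (c + 1)) l)
        (Sum.inr c) v) c x')
      (by simp [setGate_inl]) (by simpa [setGate_inl] using hl)
      (by simpa [setGate_inl] using hx.2.1) (by simpa [setGate_inl] using hx'.2.1)
      (by simpa [setGate_inr] using hx.2.2) (by simpa [setGate_inr] using hx'.2.2)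
    rw [h]
    simp only [setGate_inl, setGate_inr, add_sub_cancel_right, if_true]
    simp only [hset, hi2 _ _, hi1 _ _]
    congr 1
    · congr 1
      · simp [e1, e3.symm, e2]
      · simp [e1, e3.symm, e2, hm]
    · split_ifs with h
      · rw [h.1]
      · rfl
  rw [Finset.sum_congr rfl fun l hl => Finset.sum_congr rfl fun v hv => key l hl v hv]
  -- Puts the right lower wire first, so that it takes the role of the traced near side.
  have hreorder : ∀ f : ℕ × ℕ × ℕ → ℂ, ∑ x ∈ C.labels s c, f x =
      ∑ u ∈ Finset.range (C.wireDim s c), ∑ m ∈ Finset.range (C.regDim s c),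
        ∑ v ∈ Finset.range (C.wireDim s (c - 1)), f (v, m, u) := by
    intro f
    simp only [labels, Finset.sum_product]
    rw [Finset.sum_congr rfl fun _ _ => Finset.sum_comm, Finset.sum_comm]
    exact Finset.sum_congr rfl fun _ _ => Finset.sum_comm
  simp only [hreorder]
  rw [sum_of_side_isometry (P := σ (Sum.inl (c - 1)) = σ' (Sum.inl (c - 1)) ∧
    σ (Sum.inr (c - 1)) = σ' (Sum.inr (c - 1))) (κ := κ')
    (g := fun l v' v m u => C.gate s c (σ (Sum.inl (c - 1))) l
      (σ (Sum.inr (c - 1)), σ (Sum.inl c), v') (u, m, v))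
    (g' := fun l v' v m u => C.gate s c (σ' (Sum.inl (c - 1))) l
      (σ' (Sum.inr (c - 1)), σ (Sum.inl c), v') (u, m, v))
    (K := fun m u u' => κ * W
          (Function.update (Function.update σ (Sum.inl c) m) (Sum.inr (c - 1)) u)
          (Function.update (Function.update σ' (Sum.inl c) m) (Sum.inr (c - 1)) u'))]
  · congr 1
    simp only [← Finset.mul_sum]
    ring
  · intro m hm' u hu u' hu'
    have := (hh (σ (Sum.inl c)) hm1 m (Finset.mem_range.1 hm')).2
      (σ (Sum.inl (c - 1)), u, σ (Sum.inr (c - 1)))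
      (by simpa [leftLabels, hr, hw] using hu)
      (σ' (Sum.inl (c - 1)), u', σ' (Sum.inr (c - 1)))
      (by simpa [leftLabels, hr', hw'] using hu')
    rw [rightLabels] at this
    refine Eq.trans this ?_
    congr 1
    simp only [Prod.mk.injEq, eq_iff_iff]
    tauto

end Circuit

end

/-! ### Removing a whole diagonal of gates. -/

section

variable {C : Circuit} {N : ℤ → StateTensor}

/-- The regions and wires `a, …, b - 1`. -/
def leftSites (a b : ℤ) : Finset Site := (Finset.Ico a b).disjSum (Finset.Ico a b)

/-- The regions `a + 1, …, b` and the wires `a, …, b - 1`. -/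
def rightSites (a b : ℤ) : Finset Site := (Finset.Ioc a b).disjSum (Finset.Ico a b)

theorem inl_mem_leftSites {a b c : ℤ} : (Sum.inl c : Site) ∈ leftSites a b ↔ a ≤ c ∧ c < b := by
  simp only [leftSites, Finset.inl_mem_disjSum, Finset.mem_Ico]

theorem inr_mem_leftSites {a b c : ℤ} : (Sum.inr c : Site) ∈ leftSites a b ↔ a ≤ c ∧ c < b := by
  simp only [leftSites, Finset.inr_mem_disjSum, Finset.mem_Ico]

theorem inl_mem_rightSites {a b c : ℤ} : (Sum.inl c : Site) ∈ rightSites a b ↔ a < c ∧ c ≤ b := by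
  simp only [rightSites, Finset.inl_mem_disjSum, Finset.mem_Ioc]

theorem inr_mem_rightSites {a b c : ℤ} : (Sum.inr c : Site) ∈ rightSites a b ↔ a ≤ c ∧ c < b := by
  simp only [rightSites, Finset.inr_mem_disjSum, Finset.mem_Ico]

theorem leftSites_succ {a b : ℤ} (h : a ≤ b) :
    leftSites a (b + 1) = {Sum.inl b, Sum.inr b} ∪ leftSites a b := by
  ext i
  rcases i with c | c
  · simp only [inl_mem_leftSites, Finset.mem_union, Finset.mem_insert, Finset.mem_singleton,
      Sum.inl.injEq, reduceCtorEq, or_false]; omega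
  · simp only [inr_mem_leftSites, Finset.mem_union, Finset.mem_insert, Finset.mem_singleton,
      Sum.inr.injEq, reduceCtorEq, false_or]; omega

theorem disjoint_leftSites (a b : ℤ) :
    Disjoint ({Sum.inl b, Sum.inr b} : Finset Site) (leftSites a b) := by
  rw [Finset.disjoint_left]
  intro i hi
  simp only [Finset.mem_insert, Finset.mem_singleton] at hi
  rcases hi with rfl | rfl
  · rw [inl_mem_leftSites]; omega
  · rw [inr_mem_leftSites]; omega

theorem rightSites_pred {a b : ℤ} (h : a ≤ b) :
    rightSites (a - 1) b = {Sum.inl a, Sum.inr (a - 1)} ∪ rightSites a b := by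
  ext i
  rcases i with c | c
  · simp only [inl_mem_rightSites, Finset.mem_union, Finset.mem_insert, Finset.mem_singleton,
      Sum.inl.injEq, reduceCtorEq, or_false]; omega
  · simp only [inr_mem_rightSites, Finset.mem_union, Finset.mem_insert, Finset.mem_singleton,
      Sum.inr.injEq, reduceCtorEq, false_or]; omega

theorem disjoint_rightSites (a b : ℤ) :
    Disjoint ({Sum.inl a, Sum.inr (a - 1)} : Finset Site) (rightSites a b) := by
  rw [Finset.disjoint_left]
  intro i hi
  simp only [Finset.mem_insert, Finset.mem_singleton] at hi
  rcases hi with rfl | rfl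
  · rw [inl_mem_rightSites]; omega
  · rw [inr_mem_rightSites]; omega

namespace Circuit

/-- After `k` gates the agreement sits on wire `c₀ + 1 + k` and region `c₀ + 2 + k`, which are the
lower left wire and lower region of the next gate; thus the peeling climbs the diagonal. The sites
to its left were traced at its upper end, those to its right become traced at its lower end. The
constant does not depend on the states or on `W`. -/
theorem peel_diag_left {t : ℕ} (hbi : C.IsBiunitary t) {c₀ : ℤ} (hc : c₀ % 2 = 0)
    {d d' : Site → ℕ}
    (hd : ∀ k < t, d (Sum.inl (c₀ + 1 + k)) = C.regDim k (c₀ + 1 + k) ∧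
      d (Sum.inr (c₀ + 1 + k)) = C.wireDim (k + 1) (c₀ + 1 + k))
    (hd' : ∀ k < t, d' (Sum.inl (c₀ + 2 + k)) = C.regDim k (c₀ + 2 + k) ∧
      d' (Sum.inr (c₀ + 2 + k)) = C.wireDim k (c₀ + 2 + k)) :
    ∃ κ : ℂ, κ ≠ 0 ∧ ∀ {α : Type} (I : Finset α) (ψ φ : α → Cfg → ℂ) (W : Cfg → Cfg → ℂ),
      (∀ κ₀, C.PeeledLeft 0 (c₀ + 1) (tr (leftSites c₀ (c₀ + 1)) d
        fun τ τ' => ∑ a ∈ I, ψ a τ * star (φ a τ')) W κ₀ →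
      Indep₂ (Sum.inl (c₀ + 1)) W → Indep₂ (Sum.inr (c₀ + 1)) W →
      C.PeeledLeft t (c₀ + 1 + t) (tr (leftSites c₀ (c₀ + 1 + t)) d fun τ τ' =>
        ∑ a ∈ I, C.diagOp (fun s => c₀ + 2 + (s : ℤ)) t (ψ a) τ *
          star (C.diagOp (fun s => c₀ + 2 + (s : ℤ)) t (φ a) τ'))
        (tr (leftSites (c₀ + 2) (c₀ + 2 + t)) d' W) (κ₀ * κ)) := by
  induction t with
  | zero =>
    refine ⟨1, one_ne_zero, fun I ψ φ W κ₀ h _ _ => ?_⟩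
    have : tr (leftSites (c₀ + 2) (c₀ + 2)) d' W = W := by
      funext σ σ'; rw [leftSites, Finset.Ico_self]; exact tr_empty _ _ _ _
    simpa [diagOp, this] using h
  | succ k ih =>
    obtain ⟨κ, hκ, ih⟩ := ih (fun s hs => hbi s (by omega)) (fun s hs => hd s (by omega))
      fun s hs => hd' s (by omega)
    have hev : Even (c₀ + 2 + (k : ℤ) + (k : ℤ)) := by rw [Int.even_iff]; omega
    obtain ⟨κ', hκ', hstep⟩ := PeeledLeft.gatePair (hbi k (by omega) (c₀ + 2 + k) hev) hev
    refine ⟨κ * κ', mul_ne_zero hκ hκ', fun I ψ φ W κ₀ h hi1 hi2 => ?_⟩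
    have hprev := ih I ψ φ W κ₀ h hi1 hi2
    have e1 : c₀ + 2 + (k : ℤ) - 1 = c₀ + 1 + k := by ring
    have e2 : c₀ + 1 + ((k + 1 : ℕ) : ℤ) = c₀ + 2 + k := by push_cast; ring
    have e3 : c₀ + 2 + ((k + 1 : ℕ) : ℤ) = c₀ + 2 + k + 1 := by push_cast; ring
    -- For `k = 0` nothing has been traced from `W` yet and independence is an assumption; for later
    -- gates the site has already been summed over.
    have hind : ∀ i : Site, i = Sum.inl (c₀ + 1 + (k : ℤ)) ∨ i = Sum.inr (c₀ + 1 + (k : ℤ)) →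
        Indep₂ i (tr (leftSites (c₀ + 2) (c₀ + 2 + k)) d' W) := by
      rintro i hi
      by_cases hk : k = 0
      · subst hk
        rw [Nat.cast_zero, add_zero] at hi
        rcases hi with rfl | rfl
        · exact hi1.tr _ _
        · exact hi2.tr _ _
      · refine tr_indep_of_mem ?_ _ _
        rcases hi with rfl | rfl
        · rw [inl_mem_leftSites]; omega
        · rw [inr_mem_leftSites]; omega
    have h1 := hstep (d := d) (d' := d') (by rw [e1]; exact hprev) (by rw [e1]; exact hind _ (Or.inl rfl))
      (by rw [e1]; exact hind _ (Or.inr rfl)) (by rw [e1]; exact (hd k (by omega)).1)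
      (by rw [e1]; exact (hd k (by omega)).2) (hd' k (by omega)).1 (hd' k (by omega)).2
    rw [e2, e3, show c₀ + 2 + (k : ℤ) = c₀ + 1 + k + 1 by ring, leftSites_succ (by omega),
      show c₀ + 1 + (k : ℤ) + 1 + 1 = c₀ + 2 + k + 1 by ring, leftSites_succ (by omega),
      ← mul_assoc]
    have h2 : tr ({Sum.inl (c₀ + 2 + (k : ℤ)), Sum.inr (c₀ + 2 + (k : ℤ))} ∪
        leftSites (c₀ + 2) (c₀ + 2 + k)) d' W =
        tr {Sum.inl (c₀ + 2 + (k : ℤ)), Sum.inr (c₀ + 2 + (k : ℤ))} d'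
          (tr (leftSites (c₀ + 2) (c₀ + 2 + k)) d' W) := by
      funext σ σ'; exact tr_union (disjoint_leftSites _ _) _ _ _ _
    have h3 : ∀ F, tr ({Sum.inl (c₀ + 1 + (k : ℤ)), Sum.inr (c₀ + 1 + (k : ℤ))} ∪
        leftSites c₀ (c₀ + 1 + k)) d F =
        tr {Sum.inl (c₀ + 1 + (k : ℤ)), Sum.inr (c₀ + 1 + (k : ℤ))} d
          (tr (leftSites c₀ (c₀ + 1 + k)) d F) := by
      intro F; funext σ σ'; exact tr_union (disjoint_leftSites _ _) _ _ _ _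
    rw [h2, h3, show c₀ + 1 + (k : ℤ) + 1 = c₀ + 2 + k by ring]
    rw [e1, ← tr_gatePair, gatePair_sum_mul_star] at h1
    · exact h1
    · rw [Finset.disjoint_left]
      intro i hi
      simp only [gateSites, Finset.mem_insert, Finset.mem_singleton] at hi
      rcases hi with rfl | rfl | rfl
      · rw [inr_mem_leftSites]; omega
      · rw [inr_mem_leftSites]; omega
      · rw [inl_mem_leftSites]; omega
    · rw [inl_mem_leftSites]; omega
    · rw [inl_mem_leftSites]; omega

theorem peel_diag_right {t : ℕ} (hbi : C.IsBiunitary t) {e : ℤ} (he : e % 2 = 0)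
    {d d' : Site → ℕ}
    (hd : ∀ k < t, d (Sum.inl (e - 1 - k)) = C.regDim k (e - 1 - k) ∧
      d (Sum.inr (e - 1 - k - 1)) = C.wireDim (k + 1) (e - 1 - k - 1))
    (hd' : ∀ k < t, d' (Sum.inl (e - 2 - k)) = C.regDim k (e - 2 - k) ∧
      d' (Sum.inr (e - 2 - k - 1)) = C.wireDim k (e - 2 - k - 1)) :
    ∃ κ : ℂ, κ ≠ 0 ∧ ∀ {α : Type} (I : Finset α) (ψ φ : α → Cfg → ℂ) (W : Cfg → Cfg → ℂ),
      (∀ κ₀, C.PeeledRight 0 (e - 1) (tr (rightSites (e - 1) e) d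
        fun τ τ' => ∑ a ∈ I, ψ a τ * star (φ a τ')) W κ₀ →
      Indep₂ (Sum.inl (e - 1)) W → Indep₂ (Sum.inr (e - 2)) W →
      C.PeeledRight t (e - 1 - t) (tr (rightSites (e - 1 - t) e) d fun τ τ' =>
        ∑ a ∈ I, C.diagOp (fun s => e - 2 - (s : ℤ)) t (ψ a) τ *
          star (C.diagOp (fun s => e - 2 - (s : ℤ)) t (φ a) τ'))
        (tr (rightSites (e - 2 - t) (e - 2)) d' W) (κ₀ * κ)) := by
  induction t with
  | zero =>
    refine ⟨1, one_ne_zero, fun I ψ φ W κ₀ h _ _ => ?_⟩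
    have : tr (rightSites (e - 2) (e - 2)) d' W = W := by
      funext σ σ'; rw [rightSites, Finset.Ico_self, Finset.Ioc_self]; exact tr_empty _ _ _ _
    simpa [diagOp, this] using h
  | succ k ih =>
    obtain ⟨κ, hκ, ih⟩ := ih (fun s hs => hbi s (by omega)) (fun s hs => hd s (by omega))
      fun s hs => hd' s (by omega)
    have hev : Even (e - 2 - (k : ℤ) + (k : ℤ)) := by rw [Int.even_iff]; omega
    obtain ⟨κ', hκ', hstep⟩ := PeeledRight.gatePair (hbi k (by omega) (e - 2 - k) hev) hev
    refine ⟨κ * κ', mul_ne_zero hκ hκ', fun I ψ φ W κ₀ h hi1 hi2 => ?_⟩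
    have hprev := ih I ψ φ W κ₀ h hi1 hi2
    have e1 : e - 2 - (k : ℤ) + 1 = e - 1 - k := by ring
    have e1' : e - 1 - (k : ℤ) - 1 = e - 2 - k := by ring
    have e2 : e - 1 - ((k + 1 : ℕ) : ℤ) = e - 2 - k := by push_cast; ring
    have e3 : e - 2 - ((k + 1 : ℕ) : ℤ) = e - 2 - k - 1 := by push_cast; ring
    have hind : ∀ i : Site, i = Sum.inl (e - 1 - (k : ℤ)) ∨ i = Sum.inr (e - 2 - (k : ℤ)) →
        Indep₂ i (tr (rightSites (e - 2 - k) (e - 2)) d' W) := by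
      rintro i hi
      by_cases hk : k = 0
      · subst hk
        rw [Nat.cast_zero, sub_zero, sub_zero] at hi
        rcases hi with rfl | rfl
        · exact hi1.tr _ _
        · exact hi2.tr _ _
      · refine tr_indep_of_mem ?_ _ _
        rcases hi with rfl | rfl
        · rw [inl_mem_rightSites]; omega
        · rw [inr_mem_rightSites]; omega
    have h1 := hstep (d := d) (d' := d') (by rw [e1]; exact hprev)
      (by rw [e1]; exact hind _ (Or.inl rfl)) (hind _ (Or.inr rfl))
      (by rw [e1]; exact (hd k (by omega)).1)
      (by rw [← e1']; exact (hd k (by omega)).2) (hd' k (by omega)).1 (hd' k (by omega)).2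
    rw [e2, e3, ← e1', rightSites_pred (by omega), e1', rightSites_pred (by omega),
      ← mul_assoc]
    have h2 : tr ({Sum.inl (e - 2 - (k : ℤ)), Sum.inr (e - 2 - (k : ℤ) - 1)} ∪
        rightSites (e - 2 - k) (e - 2)) d' W =
        tr {Sum.inl (e - 2 - (k : ℤ)), Sum.inr (e - 2 - (k : ℤ) - 1)} d'
          (tr (rightSites (e - 2 - k) (e - 2)) d' W) := by
      funext σ σ'; exact tr_union (disjoint_rightSites _ _) _ _ _ _
    have h3 : ∀ F, tr ({Sum.inl (e - 1 - (k : ℤ)), Sum.inr (e - 2 - (k : ℤ))} ∪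
        rightSites (e - 1 - k) e) d F =
        tr {Sum.inl (e - 1 - (k : ℤ)), Sum.inr (e - 2 - (k : ℤ))} d
          (tr (rightSites (e - 1 - k) e) d F) := by
      intro F; funext σ σ'
      exact tr_union (by rw [← e1']; exact disjoint_rightSites _ _) _ _ _ _
    rw [h2, h3]
    rw [e1, ← tr_gatePair, gatePair_sum_mul_star] at h1
    · exact h1
    · rw [Finset.disjoint_left]
      intro i hi
      simp only [gateSites, Finset.mem_insert, Finset.mem_singleton] at hi
      rcases hi with rfl | rfl | rfl
      · rw [inr_mem_rightSites]; omega
      · rw [inr_mem_rightSites]; omega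
      · rw [inl_mem_rightSites]; omega
    · rw [inl_mem_rightSites]; omega
    · rw [inl_mem_rightSites]; omega

end Circuit

end

/-! ### Exact reduction of a window with traced ends. -/

section

variable {C : Circuit} {N : ℤ → StateTensor}

theorem sum_mul_star_of_orthogonal {α β : Type*} [DecidableEq β] {Y : Finset α} {X : Finset β}
    {g g' : α → β → ℂ} {κ : ℂ} {P : Prop} [Decidable P]
    (h : ∀ x ∈ X, ∀ x' ∈ X, ∑ y ∈ Y, g y x * star (g' y x') = if P ∧ x = x' then κ else 0)
    (a b : β → ℂ) :
    ∑ y ∈ Y, (∑ x ∈ X, g y x * a x) * star (∑ x ∈ X, g' y x * b x) =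
      if P then κ * ∑ x ∈ X, a x * star (b x) else 0 := by
  have h1 : ∀ y ∈ Y, (∑ x ∈ X, g y x * a x) * star (∑ x ∈ X, g' y x * b x) =
      ∑ x ∈ X, ∑ x' ∈ X, (g y x * star (g' y x')) * (a x * star (b x')) := by
    intro y _
    rw [star_sum, Finset.sum_mul_sum]
    refine Finset.sum_congr rfl fun x _ => Finset.sum_congr rfl fun x' _ => ?_
    rw [star_mul']; ring
  rw [Finset.sum_congr rfl h1, Finset.sum_comm]
  rw [Finset.sum_congr rfl fun _ _ => Finset.sum_comm]
  simp only [← Finset.sum_mul]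
  rw [Finset.sum_congr rfl fun x hx => Finset.sum_congr rfl fun x' hx' => by rw [h x hx x' hx']]
  by_cases hP : P
  · simp only [hP, true_and, if_true, ite_mul, zero_mul, Finset.mul_sum]
    exact Finset.sum_congr rfl fun u hu => by rw [Finset.sum_ite_eq, if_pos hu]
  · simp [hP]

/-- Labels of the pair of outer auxiliary wires of a window. -/
def outerAux (N : ℤ → StateTensor) (j : ℤ) (n : ℕ) : Finset (ℕ × ℕ) :=
  Finset.range (N j).leftAux ×ˢ Finset.range (N (j + n)).leftAux

variable (C N) in
/-- The reduced density matrix of the evolved window whose outer regions and auxiliary wires are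
traced out. -/
def Dform (t : ℕ) (x y : ℤ) (j : ℤ) (n : ℕ) : Cfg → Cfg → ℂ :=
  tr (env (2 * j) n x y) (C.winDim (2 * j) n t) fun τ τ' => ∑ a ∈ outerAux N j n,
    C.evOp (2 * j) n (chainAt N j n a.1 a.2) t τ *
      star (C.evOp (2 * j) n (chainAt N j n a.1 a.2) t τ')

/-- `diag ⊗ diag` is the boundary density that survives the limit; its deltas join the outer
auxiliary wires to their conjugates, which turns `Tform` into an honest partial trace. -/
theorem Tform_diag (t : ℕ) (x y : ℤ) (j : ℤ) (n : ℕ) (σ σ' : Cfg) :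
    Tform C N t x y j n (fun v w => diag v * diag w) σ σ' = Dform C N t x y j n σ σ' := by
  unfold Tform Dform
  congr 1
  funext τ τ'
  simp only [diag, auxPairs, outerAux, Finset.sum_product, ite_mul, mul_ite, one_mul, mul_one,
    zero_mul, mul_zero]
  refine Finset.sum_congr rfl fun ξ hξ => ?_
  rw [Finset.sum_comm]
  refine Finset.sum_congr rfl fun η hη => ?_
  rw [Finset.sum_comm, Finset.sum_eq_single_of_mem η hη]
  · rw [Finset.sum_eq_single_of_mem ξ hξ]
    · simp
    · intro ξ' _ h; simp [h.symm]
  · intro η' _ h; simp [h.symm]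

/-- The vertex starts the peeling. Its top region is common, and tracing its left region, auxiliary
wire and physical wire produces `Mᴴ M = κ 1`: the right physical wire and right region must agree,
and the right auxiliary wire gets joined to its conjugate, becoming the traced end of the smaller
window. -/
theorem peel_vertex_left (hfit : FitsBelow N C) {j : ℤ} (hu : (N j).IsHorizontallyUnitary) :
    ∃ κ : ℂ, κ ≠ 0 ∧ ∀ (A : Finset ℕ) (d : Site → ℕ) (V : ℕ → ℕ → Cfg → ℂ),
      (∀ ζ η, Indep (Sum.inl (2 * j)) (V ζ η)) → (∀ ζ η, Indep (Sum.inr (2 * j)) (V ζ η)) →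
      d (Sum.inl (2 * j)) = (N j).leftReg → d (Sum.inr (2 * j)) = (N j).leftWire →
      C.PeeledLeft 0 (2 * j + 1) (tr (leftSites (2 * j) (2 * j + 1)) d fun τ τ' =>
          ∑ a ∈ Finset.range (N j).leftAux ×ˢ A,
            (∑ ζ ∈ Finset.range (N (j + 1)).leftAux, ampAt N j τ a.1 ζ * V ζ a.2 τ) *
            star (∑ ζ ∈ Finset.range (N (j + 1)).leftAux, ampAt N j τ' a.1 ζ * V ζ a.2 τ'))
        (fun τ τ' => ∑ a ∈ Finset.range (N (j + 1)).leftAux ×ˢ A,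
          V a.1 a.2 τ * star (V a.1 a.2 τ')) κ := by
  obtain ⟨κ, hκ, hh⟩ := hu
  refine ⟨κ, by exact_mod_cast hκ.ne', ?_⟩
  intro A d V hV1 hV2 d1 d2 σ σ' hm hm1 hr hr' hq hq'
  have hS : leftSites (2 * j) (2 * j + 1) = {Sum.inl (2 * j), Sum.inr (2 * j)} := by
    rw [leftSites_succ le_rfl]; simp [leftSites]
  rw [hS, tr_pair (by simp), d1, d2]
  have e1 : 2 * j + 1 ≠ 2 * j := by omega
  have e2 : 2 * j + 2 ≠ 2 * j := by omega
  simp only [ampAt, Function.update_apply, Sum.inl.injEq, Sum.inr.injEq, reduceCtorEq, if_false,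
    if_true, e1, e2, hV1 _ _ _ _, hV2 _ _ _ _, ← hm, Finset.sum_product]
  rw [show 2 * j + 1 + 1 = 2 * j + 2 by ring] at hr hr' ⊢
  rw [← hfit.topReg] at hm1
  rw [← hfit.rightReg] at hr hr'
  rw [← hfit.rightWire] at hq hq'
  have hre : ∀ f : ℕ → ℕ → ℕ → ℕ → ℂ, ∑ l ∈ Finset.range (N j).leftReg,
      ∑ p ∈ Finset.range (N j).leftWire, ∑ ξ ∈ Finset.range (N j).leftAux, ∑ η ∈ A, f l p ξ η =
      ∑ η ∈ A, ∑ y ∈ Finset.range (N j).leftReg ×ˢ Finset.range (N j).leftAux ×ˢ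
        Finset.range (N j).leftWire, f y.1 y.2.2 y.2.1 η := by
    intro f
    simp only [Finset.sum_product]
    rw [Finset.sum_comm (s := A)]
    refine Finset.sum_congr rfl fun l _ => Finset.sum_comm.trans ?_
    rw [Finset.sum_comm (s := A)]
    exact Finset.sum_congr rfl fun _ _ => Finset.sum_comm
  rw [hre]
  have key : ∀ η ∈ A, ∑ y ∈ Finset.range (N j).leftReg ×ˢ Finset.range (N j).leftAux ×ˢ
        Finset.range (N j).leftWire,
      (∑ ζ ∈ Finset.range (N (j + 1)).leftAux, (N j).amp y.1 y.2.1 y.2.2 (σ (Sum.inl (2 * j + 1)))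
        (σ (Sum.inr (2 * j + 1))) ζ (σ (Sum.inl (2 * j + 2))) * V ζ η σ) *
      star (∑ ζ ∈ Finset.range (N (j + 1)).leftAux, (N j).amp y.1 y.2.1 y.2.2
        (σ (Sum.inl (2 * j + 1))) (σ' (Sum.inr (2 * j + 1))) ζ (σ' (Sum.inl (2 * j + 2))) *
          V ζ η σ') =
      if σ (Sum.inl (2 * j + 2)) = σ' (Sum.inl (2 * j + 2)) ∧
        σ (Sum.inr (2 * j + 1)) = σ' (Sum.inr (2 * j + 1)) then
        (κ : ℂ) * ∑ ζ ∈ Finset.range (N (j + 1)).leftAux, V ζ η σ * star (V ζ η σ') else 0 := by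
    intro η _
    refine sum_mul_star_of_orthogonal (fun ζ hζ ζ' hζ' => ?_) (V · η σ) (V · η σ')
    rw [← hfit.aux] at hζ hζ'
    have := Circuit.matrix_isometry (M := (N j).horiz (σ (Sum.inl (2 * j + 1))))
      (g := fun y x => (N j).amp y.1 y.2.1 y.2.2 (σ (Sum.inl (2 * j + 1))) x.2.2 x.2.1 x.1)
      (fun _ _ => rfl) (hh _ hm1).2
      (x := (σ (Sum.inl (2 * j + 2)), ζ, σ (Sum.inr (2 * j + 1))))
      (x' := (σ' (Sum.inl (2 * j + 2)), ζ', σ' (Sum.inr (2 * j + 1))))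
      (by simpa [hr, hq] using hζ) (by simpa [hr', hq'] using hζ')
    refine this.trans ?_
    congr 1
    simp only [Prod.mk.injEq, eq_iff_iff]
    tauto
  rw [Finset.sum_congr rfl key, Finset.sum_comm (t := A)]
  split_ifs <;> simp [Finset.mul_sum]

theorem peel_vertex_right (hfit : FitsBelow N C) {j : ℤ} (hu : (N j).IsHorizontallyUnitary) :
    ∃ κ : ℂ, κ ≠ 0 ∧ ∀ (A : Finset ℕ) (d : Site → ℕ) (V : ℕ → ℕ → Cfg → ℂ),
      (∀ ξ ζ, Indep (Sum.inl (2 * j + 2)) (V ξ ζ)) →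
      (∀ ξ ζ, Indep (Sum.inr (2 * j + 1)) (V ξ ζ)) →
      d (Sum.inl (2 * j + 2)) = (N j).rightReg → d (Sum.inr (2 * j + 1)) = (N j).rightWire →
      C.PeeledRight 0 (2 * j + 1) (tr (rightSites (2 * j + 1) (2 * j + 2)) d fun τ τ' =>
          ∑ a ∈ A ×ˢ Finset.range (N (j + 1)).leftAux,
            (∑ ζ ∈ Finset.range (N j).leftAux, ampAt N j τ ζ a.2 * V a.1 ζ τ) *
            star (∑ ζ ∈ Finset.range (N j).leftAux, ampAt N j τ' ζ a.2 * V a.1 ζ τ'))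
        (fun τ τ' => ∑ a ∈ A ×ˢ Finset.range (N j).leftAux,
          V a.1 a.2 τ * star (V a.1 a.2 τ')) κ := by
  obtain ⟨κ, hκ, hh⟩ := hu
  refine ⟨κ, by exact_mod_cast hκ.ne', ?_⟩
  intro A d V hV1 hV2 d1 d2 σ σ' hm hm1 hr hr' hq hq'
  have hS : rightSites (2 * j + 1) (2 * j + 2) =
      {Sum.inl (2 * j + 2), Sum.inr (2 * j + 1)} := by
    rw [show 2 * j + 1 = 2 * j + 2 - 1 by ring, rightSites_pred le_rfl]; simp [rightSites]
  rw [hS, tr_pair (by simp), d1, d2]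
  have e1 : 2 * j ≠ 2 * j + 1 := by omega
  have e2 : 2 * j ≠ 2 * j + 2 := by omega
  have e3 : 2 * j + 1 ≠ 2 * j + 2 := by omega
  simp only [ampAt, Function.update_apply, Sum.inl.injEq, Sum.inr.injEq, reduceCtorEq, if_false,
    if_true, e1, e2, e3, hV1 _ _ _ _, hV2 _ _ _ _, ← hm, Finset.sum_product]
  rw [show 2 * j + 1 - 1 = 2 * j by ring] at hr hr' hq hq' ⊢
  rw [← hfit.topReg] at hm1
  rw [← hfit.leftReg] at hr hr'
  rw [← hfit.leftWire] at hq hq'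
  have hre : ∀ f : ℕ → ℕ → ℕ → ℕ → ℂ, ∑ l ∈ Finset.range (N j).rightReg,
      ∑ p ∈ Finset.range (N j).rightWire, ∑ ξ ∈ A, ∑ η ∈ Finset.range (N (j + 1)).leftAux,
        f l p ξ η = ∑ ξ ∈ A, ∑ y ∈ Finset.range (N j).rightReg ×ˢ
        Finset.range (N (j + 1)).leftAux ×ˢ Finset.range (N j).rightWire,
          f y.1 y.2.2 ξ y.2.1 := by
    intro f
    simp only [Finset.sum_product]
    rw [Finset.sum_comm (s := A)]
    refine Finset.sum_congr rfl fun l _ => Finset.sum_comm.trans ?_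
    exact Finset.sum_congr rfl fun _ _ => Finset.sum_comm
  rw [hre]
  have key : ∀ ξ ∈ A, ∑ y ∈ Finset.range (N j).rightReg ×ˢ
        Finset.range (N (j + 1)).leftAux ×ˢ Finset.range (N j).rightWire,
      (∑ ζ ∈ Finset.range (N j).leftAux, (N j).amp (σ (Sum.inl (2 * j))) ζ (σ (Sum.inr (2 * j)))
        (σ (Sum.inl (2 * j + 1))) y.2.2 y.2.1 y.1 * V ξ ζ σ) *
      star (∑ ζ ∈ Finset.range (N j).leftAux, (N j).amp (σ' (Sum.inl (2 * j))) ζ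
        (σ' (Sum.inr (2 * j))) (σ (Sum.inl (2 * j + 1))) y.2.2 y.2.1 y.1 * V ξ ζ σ') =
      if σ (Sum.inl (2 * j)) = σ' (Sum.inl (2 * j)) ∧
        σ (Sum.inr (2 * j)) = σ' (Sum.inr (2 * j)) then
        (κ : ℂ) * ∑ ζ ∈ Finset.range (N j).leftAux, V ξ ζ σ * star (V ξ ζ σ') else 0 := by
    intro ξ _
    refine sum_mul_star_of_orthogonal (fun ζ hζ ζ' hζ' => ?_) (V ξ · σ) (V ξ · σ')
    rw [← hfit.aux]
    have := Circuit.matrix_coisometry (M := (N j).horiz (σ (Sum.inl (2 * j + 1))))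
      (g := fun y x => (N j).amp y.1 y.2.1 y.2.2 (σ (Sum.inl (2 * j + 1))) x.2.2 x.2.1 x.1)
      (fun _ _ => rfl) (hh _ hm1).1
      (y := (σ (Sum.inl (2 * j)), ζ, σ (Sum.inr (2 * j))))
      (y' := (σ' (Sum.inl (2 * j)), ζ', σ' (Sum.inr (2 * j))))
      (by simpa [hr, hq] using hζ) (by simpa [hr', hq'] using hζ')
    refine this.trans ?_
    congr 1
    simp only [Prod.mk.injEq, eq_iff_iff]
    tauto
  rw [Finset.sum_congr rfl key]
  split_ifs <;> simp [Finset.mul_sum]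

theorem env_eq_union {c₀ : ℤ} {n : ℕ} {x y : ℤ} (hx : c₀ ≤ x) (hxy : x ≤ y)
    (hy : y ≤ c₀ + 2 * (n : ℤ)) :
    env c₀ n x y = rightSites y (c₀ + 2 * (n : ℤ)) ∪ leftSites c₀ x := by
  ext i
  rcases i with c | c
  · rw [inl_mem_env, Finset.mem_union, inl_mem_leftSites, inl_mem_rightSites]; omega
  · rw [inr_mem_env, Finset.mem_union, inr_mem_leftSites, inr_mem_rightSites]; omega

theorem disjoint_right_left {a x y b : ℤ} (hxy : x ≤ y) :
    Disjoint (rightSites y b) (leftSites a x) := by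
  rw [Finset.disjoint_left]
  rintro (c | c)
  · rw [inl_mem_leftSites, inl_mem_rightSites]; omega
  · rw [inr_mem_leftSites, inr_mem_rightSites]; omega

theorem evOp_chainAt_indep (t : ℕ) (j : ℤ) (n : ℕ) (ξ η : ℕ) {i : Site}
    (hi : Sum.elim (fun c => c < 2 * j ∨ 2 * j + 2 * (n : ℤ) < c)
      (fun c => c < 2 * j ∨ 2 * j + 2 * (n : ℤ) ≤ c) i) :
    Indep i (C.evOp (2 * j) n (chainAt N j n ξ η) t) :=
  Circuit.evOp_indep_of_outside hi (chainAt_indep N j n ξ η hi)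

theorem indep₂_sum {α : Type*} {I : Finset α} {ψ : α → Cfg → ℂ} {i : Site}
    (h : ∀ a, Indep i (ψ a)) : Indep₂ i fun τ τ' => ∑ a ∈ I, ψ a τ * star (ψ a τ') := by
  intro σ σ' k k'
  simp only [h _ _ _]

/-- With `x = 2j + 1 + t` the outer diagonal just reaches the subsystem: for `t > 0` its top gate
sits in column `x` and cannot cancel vertically. Instead the end vertex and then the diagonal are
peeled sideways, leaving an identity on the first wire of the subsystem. Sites to the right of `y`
are not involved and are traced at the end. -/
theorem Dform_left (hfit : FitsBelow N C) {t : ℕ} (hbi : C.IsBiunitary t) {j : ℤ}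
    (hu : (N j).IsHorizontallyUnitary) {n : ℕ} (ht : t ≤ n) {x y : ℤ} (hx : x = 2 * j + 1 + t)
    (hxy : x < y) (hy : y ≤ 2 * j + 2 * n + 2) :
    ∃ κ : ℂ, κ ≠ 0 ∧ C.PeeledLeft t x (Dform C N t x y j (n + 1))
      (Dform C N t (x + 1) y (j + 1) n) κ := by
  obtain ⟨κ₀, hκ₀, hbase⟩ := peel_vertex_left hfit hu
  obtain ⟨κ, hκ, hdiag⟩ := Circuit.peel_diag_left hbi (c₀ := 2 * j) (by omega)
    (d := C.winDim (2 * j) (n + 1) t) (d' := C.winDim (2 * j + 2) n t)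
    (by
      intro k hk
      simp only [Circuit.winDim]
      rw [regTime_eq t (i := k + 1) (j := 2 * n + 1 - k) (by omega) (by push_cast; omega),
        wireTime_eq t (i := k + 1) (j := 2 * n - k) (by omega) (by push_cast; omega),
        show min t (min (k + 1) (2 * n + 1 - k)) = k + 1 by omega,
        show min t (min (k + 1) (2 * n - k)) = k + 1 by omega]
      exact ⟨Circuit.regDim_eq_of_step (by omega), rfl⟩)
    (by
      intro k hk
      simp only [Circuit.winDim]
      rw [regTime_eq t (i := k) (j := 2 * n - k) (by omega) (by omega),
        wireTime_eq t (i := k) (j := 2 * n - 1 - k) (by omega) (by omega),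
        show min t (min k (2 * n - k)) = k by omega,
        show min t (min k (2 * n - 1 - k)) = k by omega]
      exact ⟨rfl, rfl⟩)
  refine ⟨κ₀ * κ, mul_ne_zero hκ₀ hκ, ?_⟩
  have ej : 2 * (j + 1) = 2 * j + 2 := by ring
  have ee : 2 * j + 2 * ((n + 1 : ℕ) : ℤ) = 2 * j + 2 + 2 * (n : ℤ) := by push_cast; ring
  have ea : j + ((n + 1 : ℕ) : ℤ) = j + 1 + (n : ℤ) := by push_cast; ring
  set V : ℕ → ℕ → Cfg → ℂ := fun ζ η => C.evOp (2 * j + 2) n (chainAt N (j + 1) n ζ η) t with hV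
  have hVi : ∀ i : Site, Sum.elim (fun c => c < 2 * j + 2) (fun c => c < 2 * j + 2) i →
      ∀ ζ η, Indep i (V ζ η) := by
    intro i hi ζ η
    have := evOp_chainAt_indep (C := C) (N := N) t (j + 1) n ζ η (i := i)
      (by rcases i with c | c <;> simp only [Sum.elim_inl, Sum.elim_inr] at hi ⊢ <;> omega)
    rwa [ej] at this
  have h1 := hdiag (outerAux N j (n + 1))
    (fun a τ => ∑ ζ ∈ Finset.range (N (j + 1)).leftAux, ampAt N j τ a.1 ζ * V ζ a.2 τ)
    (fun a τ => ∑ ζ ∈ Finset.range (N (j + 1)).leftAux, ampAt N j τ a.1 ζ * V ζ a.2 τ)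
    (fun τ τ' => ∑ a ∈ outerAux N (j + 1) n, V a.1 a.2 τ * star (V a.1 a.2 τ')) κ₀
    (by
      have := hbase (Finset.range (N (j + 1 + n)).leftAux) (C.winDim (2 * j) (n + 1) t) V
        (hVi _ (by simp)) (hVi _ (by simp))
        (by rw [hfit.leftReg, Circuit.winDim, regTime_eq t (i := 0) (by omega) rfl]; simp)
        (by rw [hfit.leftWire, Circuit.winDim, wireTime_eq t (i := 0) (by omega) rfl]; simp)
      rw [outerAux, ea]
      exact this)
    (indep₂_sum fun a => hVi _ (by simp) _ _) (indep₂_sum fun a => hVi _ (by simp) _ _)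
  rw [← hx, show 2 * j + 2 + (t : ℤ) = x + 1 by omega] at h1
  intro σ σ' hm hm1 hr hr' hw hw'
  have hF : (fun τ τ' : Cfg => ∑ a ∈ outerAux N j (n + 1),
      C.evOp (2 * j) (n + 1) (chainAt N j (n + 1) a.1 a.2) t τ *
        star (C.evOp (2 * j) (n + 1) (chainAt N j (n + 1) a.1 a.2) t τ')) =
      fun τ τ' => ∑ a ∈ outerAux N j (n + 1),
        C.diagOp (fun s => 2 * j + 2 + (s : ℤ)) t (fun τ =>
          ∑ ζ ∈ Finset.range (N (j + 1)).leftAux, ampAt N j τ a.1 ζ * V ζ a.2 τ) τ *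
        star (C.diagOp (fun s => 2 * j + 2 + (s : ℤ)) t (fun τ =>
          ∑ ζ ∈ Finset.range (N (j + 1)).leftAux, ampAt N j τ a.1 ζ * V ζ a.2 τ) τ') := by
    funext τ τ'
    refine Finset.sum_congr rfl fun a ha => ?_
    rw [outerAux, Finset.mem_product, Finset.mem_range, Finset.mem_range, ea] at ha
    rw [Circuit.evOp_succ_left ht]
    have : C.evOp (2 * j + 2) n (chainAt N j (n + 1) a.1 a.2) t = fun τ =>
        ∑ ζ ∈ Finset.range (N (j + 1)).leftAux, ampAt N j τ a.1 ζ * V ζ a.2 τ :=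
      funext fun τ => evOp_chainAt_left t j n ha.1 ha.2 τ
    rw [this]
  unfold Dform
  rw [env_eq_union (by omega) hxy.le (by rw [ee]; omega),
    env_eq_union (by omega) (by omega) (by rw [ej]; omega), tr_union (disjoint_right_left hxy.le),
    tr_union (disjoint_right_left (by omega)), ee, ej]
  rw [hF]
  rw [tr_congr_dim (d := C.winDim (2 * j) (n + 1) t) (d' := C.winDim (2 * j + 2) n t)
    (S := rightSites y (2 * j + 2 + 2 * (n : ℤ)))]
  · rw [tr_congr (F' := fun τ τ' => (if σ (Sum.inl (x + 1)) = σ' (Sum.inl (x + 1)) ∧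
        σ (Sum.inr x) = σ' (Sum.inr x) then κ₀ * κ else 0) *
        tr (leftSites (2 * j + 2) (x + 1)) (C.winDim (2 * j + 2) n t) (fun τ τ' =>
          ∑ a ∈ outerAux N (j + 1) n, V a.1 a.2 τ * star (V a.1 a.2 τ')) τ τ'), tr_mul_left]
    · split_ifs
      · rfl
      · rw [zero_mul]
    · intro τ τ' _ h2
      have hx0 := h2 (Sum.inl x) (by rw [inl_mem_rightSites]; omega)
      have hx1 := h2 (Sum.inl (x + 1)) (by rw [inl_mem_rightSites]; omega)
      have hx2 := h2 (Sum.inr x) (by rw [inr_mem_rightSites]; omega)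
      rw [h1 τ τ' (by rw [hx0.1, hx0.2, hm]) (by rwa [hx0.1]) (by rwa [hx1.1]) (by rwa [hx1.2])
        (by rwa [hx2.1]) (by rwa [hx2.2]), hx1.1, hx1.2, hx2.1, hx2.2]
      split_ifs <;> simp only [zero_mul]
  · rintro (c | c) hc
    · rw [inl_mem_rightSites] at hc
      simp only [Circuit.winDim, regTime]; congr 1; push_cast; omega
    · rw [inr_mem_rightSites] at hc
      simp only [Circuit.winDim, wireTime]; congr 1; push_cast; omega

theorem Dform_right (hfit : FitsBelow N C) {t : ℕ} (hbi : C.IsBiunitary t) {j : ℤ} {n : ℕ}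
    (hu : (N (j + n)).IsHorizontallyUnitary) (ht : t ≤ n) {x y : ℤ}
    (hy : y = 2 * j + 2 * n + 1 - t) (hxy : x < y) (hx : 2 * j ≤ x) :
    ∃ κ : ℂ, κ ≠ 0 ∧ C.PeeledRight t y (Dform C N t x y j (n + 1))
      (Dform C N t x (y - 1) j n) κ := by
  obtain ⟨κ₀, hκ₀, hbase⟩ := peel_vertex_right hfit hu
  have ej : 2 * (j + (n : ℤ)) = 2 * j + 2 * n := by ring
  have ee : 2 * j + 2 * ((n + 1 : ℕ) : ℤ) = 2 * j + 2 * (n : ℤ) + 2 := by push_cast; ring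
  have ea : j + ((n + 1 : ℕ) : ℤ) = j + (n : ℤ) + 1 := by push_cast; ring
  rw [ej] at hbase
  set e : ℤ := 2 * j + 2 * (n : ℤ) + 2 with he
  obtain ⟨κ, hκ, hdiag⟩ := Circuit.peel_diag_right hbi (e := e) (by omega)
    (d := C.winDim (2 * j) (n + 1) t) (d' := C.winDim (2 * j) n t)
    (by
      intro k hk
      simp only [Circuit.winDim]
      rw [regTime_eq t (i := 2 * n + 1 - k) (j := k + 1) (by omega) (by push_cast; omega),
        wireTime_eq t (i := 2 * n - k) (j := k + 1) (by omega) (by push_cast; omega),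
        show min t (min (2 * n + 1 - k) (k + 1)) = k + 1 by omega,
        show min t (min (2 * n - k) (k + 1)) = k + 1 by omega]
      exact ⟨Circuit.regDim_eq_of_step (by omega), rfl⟩)
    (by
      intro k hk
      simp only [Circuit.winDim]
      rw [regTime_eq t (i := 2 * n - k) (j := k) (by omega) (by omega),
        wireTime_eq t (i := 2 * n - 1 - k) (j := k) (by omega) (by omega),
        show min t (min (2 * n - k) k) = k by omega,
        show min t (min (2 * n - 1 - k) k) = k by omega]
      exact ⟨rfl, rfl⟩)
  refine ⟨κ₀ * κ, mul_ne_zero hκ₀ hκ, ?_⟩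
  set V : ℕ → ℕ → Cfg → ℂ := fun ξ ζ => C.evOp (2 * j) n (chainAt N j n ξ ζ) t with hV
  have hVi : ∀ i : Site, Sum.elim (fun c => e - 2 < c) (fun c => e - 2 ≤ c) i →
      ∀ ζ η, Indep i (V ζ η) := by
    intro i hi ζ η
    exact evOp_chainAt_indep (C := C) (N := N) t j n ζ η (i := i)
      (by rcases i with c | c <;> simp only [Sum.elim_inl, Sum.elim_inr] at hi ⊢ <;> omega)
  have e1 : 2 * j + 2 * (n : ℤ) + 1 = e - 1 := by omega
  have h1 := hdiag (outerAux N j (n + 1))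
    (fun a τ => ∑ ζ ∈ Finset.range (N (j + n)).leftAux, ampAt N (j + n) τ ζ a.2 * V a.1 ζ τ)
    (fun a τ => ∑ ζ ∈ Finset.range (N (j + n)).leftAux, ampAt N (j + n) τ ζ a.2 * V a.1 ζ τ)
    (fun τ τ' => ∑ a ∈ outerAux N j n, V a.1 a.2 τ * star (V a.1 a.2 τ')) κ₀
    (by
      have := hbase (Finset.range (N j).leftAux) (C.winDim (2 * j) (n + 1) t) V
        (hVi _ (by simp)) (hVi _ (by simp only [Sum.elim_inr]; omega))
        (by
          rw [hfit.rightReg, Circuit.winDim, regTime_eq t rfl (j := 0) (by push_cast; omega), ej]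
          simp [he])
        (by
          rw [hfit.rightWire, Circuit.winDim, wireTime_eq t rfl (j := 0) (by push_cast; omega), ej]
          simp)
      rw [e1] at this
      rw [outerAux, ea]
      exact this)
    (indep₂_sum fun a => hVi _ (by simp only [Sum.elim_inl]; omega) _ _)
    (indep₂_sum fun a => hVi _ (by simp) _ _)
  rw [show e - 1 - (t : ℤ) = y by omega, show e - 2 - (t : ℤ) = y - 1 by omega] at h1
  intro σ σ' hm hm1 hr hr' hw hw'
  have hF : (fun τ τ' : Cfg => ∑ a ∈ outerAux N j (n + 1),
      C.evOp (2 * j) (n + 1) (chainAt N j (n + 1) a.1 a.2) t τ *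
        star (C.evOp (2 * j) (n + 1) (chainAt N j (n + 1) a.1 a.2) t τ')) =
      fun τ τ' => ∑ a ∈ outerAux N j (n + 1),
        C.diagOp (fun s => e - 2 - (s : ℤ)) t (fun τ =>
          ∑ ζ ∈ Finset.range (N (j + n)).leftAux, ampAt N (j + n) τ ζ a.2 * V a.1 ζ τ) τ *
        star (C.diagOp (fun s => e - 2 - (s : ℤ)) t (fun τ =>
          ∑ ζ ∈ Finset.range (N (j + n)).leftAux, ampAt N (j + n) τ ζ a.2 * V a.1 ζ τ) τ') := by
    funext τ τ'
    refine Finset.sum_congr rfl fun a ha => ?_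
    rw [Circuit.evOp_succ_right ht]
    have : C.evOp (2 * j) n (chainAt N j (n + 1) a.1 a.2) t = fun τ =>
        ∑ ζ ∈ Finset.range (N (j + n)).leftAux, ampAt N (j + n) τ ζ a.2 * V a.1 ζ τ :=
      funext fun τ => evOp_chainAt_right t j n _ _ τ
    rw [this, show 2 * j + 2 * (n : ℤ) = e - 2 by omega]
  unfold Dform
  rw [env_eq_union hx hxy.le (by rw [ee]; omega),
    env_eq_union hx (by omega) (by omega), Finset.union_comm, Finset.union_comm (rightSites _ _),
    tr_union (disjoint_right_left hxy.le).symm,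
    tr_union (disjoint_right_left (by omega)).symm, ee, show 2 * j + 2 * (n : ℤ) = e - 2 by omega]
  rw [hF]
  rw [tr_congr_dim (d := C.winDim (2 * j) (n + 1) t) (d' := C.winDim (2 * j) n t)
    (S := leftSites (2 * j) x)]
  · rw [tr_congr (F' := fun τ τ' => (if σ (Sum.inl (y - 1)) = σ' (Sum.inl (y - 1)) ∧
        σ (Sum.inr (y - 1)) = σ' (Sum.inr (y - 1)) then κ₀ * κ else 0) *
        tr (rightSites (y - 1) (e - 2)) (C.winDim (2 * j) n t) (fun τ τ' =>
          ∑ a ∈ outerAux N j n, V a.1 a.2 τ * star (V a.1 a.2 τ')) τ τ'), tr_mul_left]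
    · split_ifs
      · rfl
      · rw [zero_mul]
    · intro τ τ' _ h2
      have hx0 := h2 (Sum.inl y) (by rw [inl_mem_leftSites]; omega)
      have hx1 := h2 (Sum.inl (y - 1)) (by rw [inl_mem_leftSites]; omega)
      have hx2 := h2 (Sum.inr (y - 1)) (by rw [inr_mem_leftSites]; omega)
      rw [h1 τ τ' (by rw [hx0.1, hx0.2, hm]) (by rwa [hx0.1]) (by rwa [hx1.1]) (by rwa [hx1.2])
        (by rwa [hx2.1]) (by rwa [hx2.2]), hx1.1, hx1.2, hx2.1, hx2.2]
      split_ifs <;> simp only [zero_mul]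
  · rintro (c | c) hc
    · rw [inl_mem_leftSites] at hc
      simp only [Circuit.winDim, regTime]; congr 1; push_cast; omega
    · rw [inr_mem_leftSites] at hc
      simp only [Circuit.winDim, wireTime]; congr 1; push_cast; omega

end

/-! ### Induction on the number of rows. -/

section

variable {C : Circuit} {N : ℤ → StateTensor}

/-- The labels of the regions `x, …, y` and of the wires between them are in range. -/
def InRange (rd wd : ℤ → ℕ) (x y : ℤ) (σ : Cfg) : Prop :=
  (∀ c, x ≤ c → c ≤ y → σ (Sum.inl c) < rd c) ∧ ∀ c, x ≤ c → c < y → σ (Sum.inr c) < wd c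

/-- Two labellings agree on the regions `x, …, y` and on the wires between them. -/
def Agree (x y : ℤ) (σ σ' : Cfg) : Prop :=
  (∀ c, x ≤ c → c ≤ y → σ (Sum.inl c) = σ' (Sum.inl c)) ∧
    ∀ c, x ≤ c → c < y → σ (Sum.inr c) = σ' (Sum.inr c)

open Classical in
/-- `G` is `κ` times the identity on the subsystem bounded by the regions `x` and `y`, whose
labels are common to both arguments. -/
def IsScalarOn (rd wd : ℤ → ℕ) (x y : ℤ) (κ : ℂ) (G : Cfg → Cfg → ℂ) : Prop :=
  ∀ σ σ' : Cfg, InRange rd wd x y σ → InRange rd wd x y σ' → σ (Sum.inl x) = σ' (Sum.inl x) →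
    σ (Sum.inl y) = σ' (Sum.inl y) → G σ σ' = if Agree x y σ σ' then κ else 0

theorem IsScalarOn.congr {rd wd rd' wd' : ℤ → ℕ} {x y : ℤ} {κ : ℂ} {G : Cfg → Cfg → ℂ}
    (h : IsScalarOn rd wd x y κ G) (hr : ∀ c, x ≤ c → c ≤ y → rd' c = rd c)
    (hw : ∀ c, x ≤ c → c < y → wd' c = wd c) : IsScalarOn rd' wd' x y κ G := by
  have hI : ∀ σ, InRange rd' wd' x y σ → InRange rd wd x y σ := fun σ hσ =>
    ⟨fun c h1 h2 => hr c h1 h2 ▸ hσ.1 c h1 h2, fun c h1 h2 => hw c h1 h2 ▸ hσ.2 c h1 h2⟩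
  exact fun σ σ' hσ hσ' => h σ σ' (hI σ hσ) (hI σ' hσ')

open Classical in
-- Conjugating the identity by a gate inside the subsystem gives `U Uᴴ = 1`. The neighbouring
-- regions belong to the subsystem or bound it, so where the other labels agree both copies of the
-- gate are the same unitary.
theorem IsScalarOn.gatePair {s : ℕ} {c : ℤ} (hb : C.IsBiunitaryAt s c) {rd wd : ℤ → ℕ} {x y : ℤ}
    (hx : x ≤ c - 1) (hy : c + 1 ≤ y) {κ : ℂ} {G : Cfg → Cfg → ℂ}
    (h : IsScalarOn rd wd x y κ G) (h1 : rd (c - 1) = C.regDim s (c - 1))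
    (h2 : rd c = C.regDim s c) (h3 : rd (c + 1) = C.regDim s (c + 1))
    (h4 : wd (c - 1) = C.wireDim s (c - 1)) (h5 : wd c = C.wireDim s c) :
    IsScalarOn (Function.update rd c (C.regDim (s + 1) c))
      (Function.update (Function.update wd (c - 1) (C.wireDim (s + 1) (c - 1))) c
        (C.wireDim (s + 1) c)) x y κ (C.gatePair s c G) := by
  intro σ σ' hσ hσ' hxx hyy
  have e1 : c - 1 ≠ c := by omega
  have e2 : c + 1 ≠ c := by omega
  have hrange : ∀ (σ : Cfg), InRange (Function.update rd c (C.regDim (s + 1) c))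
      (Function.update (Function.update wd (c - 1) (C.wireDim (s + 1) (c - 1))) c
        (C.wireDim (s + 1) c)) x y σ → ∀ z ∈ C.labels s c, InRange rd wd x y (setGate σ c z) := by
    intro σ hσ z hz
    simp only [Circuit.labels, Finset.mem_product, Finset.mem_range] at hz
    constructor
    · intro b hb1 hb2
      rw [setGate_inl]
      split_ifs with hbc
      · rw [hbc, h2]; exact hz.2.1
      · simpa [hbc] using hσ.1 b hb1 hb2
    · intro b hb1 hb2
      rw [setGate_inr]
      split_ifs with hbc hbc'
      · rw [hbc, h5]; exact hz.2.2
      · rw [hbc', h4]; exact hz.1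
      · simpa [hbc, hbc'] using hσ.2 b hb1 hb2
  have hlab : ∀ (σ : Cfg), InRange (Function.update rd c (C.regDim (s + 1) c))
      (Function.update (Function.update wd (c - 1) (C.wireDim (s + 1) (c - 1))) c
        (C.wireDim (s + 1) c)) x y σ →
      (σ (Sum.inr (c - 1)), σ (Sum.inl c), σ (Sum.inr c)) ∈ C.labels (s + 1) c := by
    intro σ hσ
    have a1 := hσ.1 c (by omega) (by omega)
    have a2 := hσ.2 (c - 1) (by omega) (by omega)
    have a3 := hσ.2 c (by omega) (by omega)
    simp only [Function.update_self, Function.update_of_ne e1] at a1 a2 a3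
    simp only [Circuit.labels, Finset.mem_product, Finset.mem_range]
    exact ⟨a2, a1, a3⟩
  -- agreement off the sites of the gate
  set Q : Prop := (∀ b, x ≤ b → b ≤ y → b ≠ c → σ (Sum.inl b) = σ' (Sum.inl b)) ∧
    ∀ b, x ≤ b → b < y → b ≠ c → b ≠ c - 1 → σ (Sum.inr b) = σ' (Sum.inr b) with hQ
  have hagree : ∀ z z' : ℕ × ℕ × ℕ,
      Agree x y (setGate σ c z) (setGate σ' c z') ↔ Q ∧ z = z' := by
    intro z z'
    constructor
    · rintro ⟨ha, hw⟩
      refine ⟨⟨fun b hb1 hb2 hb3 => ?_, fun b hb1 hb2 hb3 hb4 => ?_⟩, ?_⟩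
      · simpa [setGate_inl, hb3] using ha b hb1 hb2
      · simpa [setGate_inr, hb3, hb4] using hw b hb1 hb2
      · have a1 := ha c (by omega) (by omega)
        have a2 := hw (c - 1) (by omega) (by omega)
        have a3 := hw c (by omega) (by omega)
        simp only [setGate_inl, setGate_inr, if_true, e1, if_false] at a1 a2 a3
        exact Prod.ext a2 (Prod.ext a1 a3)
    · rintro ⟨⟨ha, hw⟩, rfl⟩
      refine ⟨fun b hb1 hb2 => ?_, fun b hb1 hb2 => ?_⟩
      · rw [setGate_inl, setGate_inl]
        split_ifs with hbc
        · rfl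
        · exact ha b hb1 hb2 hbc
      · rw [setGate_inr, setGate_inr]
        split_ifs with hbc hbc'
        · rfl
        · rfl
        · exact hw b hb1 hb2 hbc hbc'
  have hagree' : Agree x y σ σ' ↔ Q ∧ (σ (Sum.inr (c - 1)), σ (Sum.inl c), σ (Sum.inr c)) =
      (σ' (Sum.inr (c - 1)), σ' (Sum.inl c), σ' (Sum.inr c)) := by
    have hself : ∀ σ : Cfg, setGate σ c (σ (Sum.inr (c - 1)), σ (Sum.inl c), σ (Sum.inr c)) = σ := by
      intro σ
      funext i
      rcases i with b | b
      · rw [setGate_inl]; split_ifs with hb <;> simp [hb]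
      · rw [setGate_inr]; split_ifs <;> simp_all
    rw [← hagree, hself, hself]
  have hG : ∀ z ∈ C.labels s c, ∀ z' ∈ C.labels s c, G (setGate σ c z) (setGate σ' c z') =
      if Q ∧ z = z' then κ else 0 := by
    intro z hz z' hz'
    rw [h _ _ (hrange σ hσ z hz) (hrange σ' hσ' z' hz')]
    · simp only [hagree]
    · simpa [setGate_inl, show x ≠ c by omega] using hxx
    · simpa [setGate_inl, show y ≠ c by omega] using hyy
  rw [Circuit.gatePair, Finset.sum_congr rfl fun z hz => Finset.sum_congr rfl fun z' hz' => by
    rw [hG z hz z' hz']]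
  simp only [hagree']
  by_cases hq : Q
  · simp only [hq, true_and, mul_ite, mul_zero]
    rw [Finset.sum_congr rfl fun z hz => by rw [Finset.sum_ite_eq, if_pos hz]]
    have hl := hq.1 (c - 1) (by omega) (by omega) e1
    have hr := hq.1 (c + 1) (by omega) (by omega) e2
    have hl' := hσ.1 (c - 1) (by omega) (by omega)
    have hr' := hσ.1 (c + 1) (by omega) (by omega)
    rw [Function.update_of_ne e1, h1] at hl'
    rw [Function.update_of_ne e2, h3] at hr'
    rw [← Finset.sum_mul, ← hl, ← hr, hb.vert_coisometry hl' hr' (hlab σ hσ) (hlab σ' hσ'),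
      ite_mul, one_mul, zero_mul]
  · simp [hq]

variable (C) in
/-- Successive action of `k` gates of a row and of their conjugates. -/
def Circuit.rowPair (s : ℕ) (c : ℤ) : ℕ → (Cfg → Cfg → ℂ) → Cfg → Cfg → ℂ
  | 0, G => G
  | k + 1, G => C.gatePair s (c + 2 * (k : ℤ)) (rowPair s c k G)

theorem Circuit.rowPair_sum_mul_star {α : Type*} (I : Finset α) (ψ : α → Cfg → ℂ) (s : ℕ) (c : ℤ)
    (k : ℕ) : C.rowPair s c k (fun τ τ' => ∑ a ∈ I, ψ a τ * star (ψ a τ')) =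
      fun τ τ' => ∑ a ∈ I, C.rowOp s c k (ψ a) τ * star (C.rowOp s c k (ψ a) τ') := by
  induction k with
  | zero => rfl
  | succ k ih => rw [rowPair, ih, gatePair_sum_mul_star]; rfl

theorem Circuit.tr_rowPair {s : ℕ} {c : ℤ} {k : ℕ} {c₀ : ℤ} {n : ℕ} {x y : ℤ} (hx : x ≤ c - 1)
    (hy : c + 2 * (k : ℤ) - 1 ≤ y) (d : Site → ℕ) (G : Cfg → Cfg → ℂ) :
    tr (env c₀ n x y) d (C.rowPair s c k G) = C.rowPair s c k (tr (env c₀ n x y) d G) := by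
  induction k with
  | zero => rfl
  | succ k ih =>
    push_cast at hy
    rw [rowPair, tr_gatePair, ih (by omega), rowPair]
    · rw [Finset.disjoint_left]
      intro i hi
      simp only [gateSites, Finset.mem_insert, Finset.mem_singleton] at hi
      rcases hi with rfl | rfl | rfl
      · rw [inr_mem_env]; omega
      · rw [inr_mem_env]; omega
      · rw [inl_mem_env]; omega
    · rw [inl_mem_env]; omega
    · rw [inl_mem_env]; omega

/-- Within a row the label sets are mixed: to the left of `x + 2k` those after the row, elsewhere
those before it. The parity condition makes the regions between the gates insensitive to this. -/
theorem IsScalarOn.rowPair {s k : ℕ} {x : ℤ} (hb : ∀ i < k, C.IsBiunitaryAt s (x + 1 + 2 * (i : ℤ)))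
    (hpar : (x + (s : ℤ)) % 2 = 1) {y : ℤ} (hy : x + 2 * (k : ℤ) ≤ y) {κ : ℂ}
    {G : Cfg → Cfg → ℂ} (h : IsScalarOn (C.regDim s) (C.wireDim s) x y κ G) :
    IsScalarOn (fun b => if b < x + 2 * (k : ℤ) then C.regDim (s + 1) b else C.regDim s b)
      (fun b => if b < x + 2 * (k : ℤ) then C.wireDim (s + 1) b else C.wireDim s b) x y κ
      (C.rowPair s (x + 1) k G) := by
  induction k with
  | zero =>
    refine h.congr (fun c h1 _ => ?_) fun c h1 _ => ?_ <;>
      simp only [Nat.cast_zero, mul_zero, add_zero, if_neg (not_lt.2 h1)]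
  | succ k ih =>
    push_cast at hy
    have ih := ih (fun i hi => hb i (by omega)) (by omega)
    have hreg : ∀ b, (b + (s : ℤ)) % 2 = 1 → C.regDim (s + 1) b = C.regDim s b :=
      fun b hb => Circuit.regDim_eq_of_step (Or.inr ⟨rfl, hb⟩)
    have hstep := IsScalarOn.gatePair (hb k (by omega)) (by omega) (by omega) ih
      (by simp only [ite_eq_right_iff]; intro _; exact hreg _ (by omega))
      (if_neg (by omega)) (if_neg (by omega)) (if_neg (by omega)) (if_neg (by omega))
    refine hstep.congr (fun c _ _ => ?_) fun c _ _ => ?_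
    · simp only [Function.update_apply]
      by_cases h1 : c = x + 1 + 2 * (k : ℤ)
      · rw [if_pos h1, if_pos (by push_cast; omega), h1]
      · rw [if_neg h1]
        by_cases h2 : c < x + 2 * (k : ℤ)
        · rw [if_pos h2, if_pos (by push_cast; omega)]
        · by_cases h3 : c = x + 2 * (k : ℤ)
          · rw [if_neg h2, if_pos (by push_cast; omega)]
            exact hreg _ (by omega)
          · rw [if_neg h2, if_neg (by push_cast; omega)]
    · simp only [Function.update_apply]
      by_cases h1 : c = x + 1 + 2 * (k : ℤ)
      · rw [if_pos h1, if_pos (by push_cast; omega), h1]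
      · by_cases h1' : c = x + 1 + 2 * (k : ℤ) - 1
        · rw [if_neg h1, if_pos h1', if_pos (by push_cast; omega), h1']
        · rw [if_neg h1, if_neg h1']
          by_cases h2 : c < x + 2 * (k : ℤ)
          · rw [if_pos h2, if_pos (by push_cast; omega)]
          · rw [if_neg h2, if_neg (by push_cast; omega)]

/-- Extending the subsystem by one wire on either side. -/
theorem Dform_isScalarOn_extend (hfit : FitsBelow N C) (hu : ∀ j, (N j).IsHorizontallyUnitary)
    {s : ℕ} (hbi : C.IsBiunitary s) {j : ℤ} {κ : ℂ}
    (h : IsScalarOn (C.regDim s) (C.wireDim s) (2 * (j + 1) + s) (2 * (j + 1) + s + 2 * s) κ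
      (Dform C N s (2 * (j + 1) + s) (2 * (j + 1) + s + 2 * s) (j + 1) (2 * s))) (hκ : κ ≠ 0) :
    ∃ κ' : ℂ, κ' ≠ 0 ∧ IsScalarOn (C.regDim s) (C.wireDim s) (2 * j + s + 1)
      (2 * j + s + 1 + 2 * (s + 1)) κ'
      (Dform C N s (2 * j + s + 1) (2 * j + s + 1 + 2 * (s + 1)) j (2 * (s + 1))) := by
  classical
  set x : ℤ := 2 * j + s + 1 with hx
  set y : ℤ := x + 2 * (s + 1) with hy
  obtain ⟨κ₁, hκ₁, h₁⟩ := Dform_left (N := N) hfit hbi (hu j) (n := 2 * s + 1) (t := s) (by omega)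
    (x := x) (y := y) (by omega) (by omega) (by push_cast; omega)
  obtain ⟨κ₂, hκ₂, h₂⟩ := Dform_right (N := N) hfit hbi (j := j + 1) (n := 2 * s) (t := s)
    (hu _) (by omega) (x := x + 1) (y := y) (by push_cast; omega) (by omega) (by omega)
  rw [show 2 * (j + 1) + (s : ℤ) = x + 1 by omega, show x + 1 + 2 * (s : ℤ) = y - 1 by omega] at h
  refine ⟨κ₁ * κ₂ * κ, mul_ne_zero (mul_ne_zero hκ₁ hκ₂) hκ, ?_⟩
  intro σ σ' hσ hσ' hxx hyy
  rw [show 2 * (s + 1) = 2 * s + 1 + 1 by ring, h₁ σ σ' hxx (hσ.1 _ (by omega) (by omega))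
    (hσ.1 _ (by omega) (by omega)) (hσ'.1 _ (by omega) (by omega)) (hσ.2 _ (by omega) (by omega))
    (hσ'.2 _ (by omega) (by omega)), h₂ σ σ' hyy (hσ.1 _ (by omega) (by omega))
    (hσ.1 _ (by omega) (by omega)) (hσ'.1 _ (by omega) (by omega)) (hσ.2 _ (by omega) (by omega))
    (hσ'.2 _ (by omega) (by omega))]
  have hsub : ∀ τ, InRange (C.regDim s) (C.wireDim s) x y τ →
      InRange (C.regDim s) (C.wireDim s) (x + 1) (y - 1) τ := fun τ hτ =>
    ⟨fun c h1 h2 => hτ.1 c (by omega) (by omega), fun c h1 h2 => hτ.2 c (by omega) (by omega)⟩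
  by_cases hA : Agree x y σ σ'
  · rw [if_pos hA, if_pos ⟨hA.1 _ (by omega) (by omega), hA.2 _ (by omega) (by omega)⟩,
      if_pos ⟨hA.1 _ (by omega) (by omega), hA.2 _ (by omega) (by omega)⟩,
      h σ σ' (hsub σ hσ) (hsub σ' hσ') (hA.1 _ (by omega) (by omega))
        (hA.1 _ (by omega) (by omega)), if_pos, mul_assoc]
    exact ⟨fun c h1 h2 => hA.1 c (by omega) (by omega), fun c h1 h2 => hA.2 c (by omega) (by omega)⟩
  · rw [if_neg hA]
    split_ifs with p1 p2
    · rw [h σ σ' (hsub σ hσ) (hsub σ' hσ') p1.1 p2.1, if_neg, mul_zero, mul_zero]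
      rintro ⟨ha, hw⟩
      refine hA ⟨fun c h1 h2 => ?_, fun c h1 h2 => ?_⟩
      · rcases eq_or_ne c x with rfl | h3
        · exact hxx
        · rcases eq_or_ne c y with rfl | h4
          · exact hyy
          · exact ha c (by omega) (by omega)
      · rcases eq_or_ne c x with rfl | h3
        · exact p1.2
        · rcases eq_or_ne c (y - 1) with rfl | h4
          · exact p2.2
          · exact hw c (by omega) (by omega)
    · rw [mul_zero]
    · rfl

/-- In a window of `2 (s + 1)` vertices row `s` consists of `s + 1` gates, and all of them act
inside the subsystem. They commute with the partial trace and preserve the identity. -/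
theorem Dform_isScalarOn_succ {s : ℕ} (hbi : C.IsBiunitary (s + 1)) {j : ℤ} {κ : ℂ}
    (h : IsScalarOn (C.regDim s) (C.wireDim s) (2 * j + s + 1) (2 * j + s + 1 + 2 * (s + 1)) κ
      (Dform C N s (2 * j + s + 1) (2 * j + s + 1 + 2 * (s + 1)) j (2 * (s + 1)))) :
    IsScalarOn (C.regDim (s + 1)) (C.wireDim (s + 1)) (2 * j + s + 1)
      (2 * j + s + 1 + 2 * (s + 1)) κ
      (Dform C N (s + 1) (2 * j + s + 1) (2 * j + s + 1 + 2 * (s + 1)) j (2 * (s + 1))) := by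
  set x : ℤ := 2 * j + s + 1 with hx
  set y : ℤ := x + 2 * (s + 1) with hy
  have hrow := IsScalarOn.rowPair (C := C) (s := s) (k := s + 1) (x := x) (y := y)
    (fun i _ => hbi s (by omega) _ (by rw [Int.even_iff]; omega)) (by omega) (by push_cast; omega) h
  have e : Dform C N (s + 1) x y j (2 * (s + 1)) =
      C.rowPair s (x + 1) (s + 1) (Dform C N s x y j (2 * (s + 1))) := by
    unfold Dform
    rw [← Circuit.tr_rowPair (by omega) (by push_cast; omega), Circuit.rowPair_sum_mul_star]
    funext σ σ'
    simp only [Circuit.evOp]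
    rw [show 2 * j + 2 + (s : ℤ) = x + 1 by omega, show 2 * (s + 1) - 1 - s = s + 1 by omega]
    refine tr_congr_dim ?_ _ _ _
    rintro (c | c) hc
    · rw [inl_mem_env] at hc
      push_cast at hc
      simp only [Circuit.winDim, regTime]; congr 1; push_cast; omega
    · rw [inr_mem_env] at hc
      push_cast at hc
      simp only [Circuit.winDim, wireTime]; congr 1; push_cast; omega
  rw [e]
  have hreg : ∀ b, (b + (s : ℤ)) % 2 = 1 → C.regDim (s + 1) b = C.regDim s b :=
    fun b hb => Circuit.regDim_eq_of_step (Or.inr ⟨rfl, hb⟩)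
  refine hrow.congr (fun c _ _ => ?_) fun c _ _ => ?_
  · split_ifs with h1
    · rfl
    · push_cast at h1
      exact hreg c (by omega)
  · rw [if_pos (by push_cast; omega)]

/-- Each step widens the window by a vertex and the subsystem by a wire on both sides, with both
bounding regions on the light cone so that sideways peeling applies, and then lets the next row act
within the subsystem. -/
theorem Dform_isScalarOn (hfit : FitsBelow N C) (hu : ∀ j, (N j).IsHorizontallyUnitary)
    {s : ℕ} (hbi : C.IsBiunitary s) (j : ℤ) : ∃ κ : ℂ, κ ≠ 0 ∧
      IsScalarOn (C.regDim s) (C.wireDim s) (2 * j + s) (2 * j + s + 2 * s) κ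
        (Dform C N s (2 * j + s) (2 * j + s + 2 * s) j (2 * s)) := by
  induction s generalizing j with
  | zero =>
    -- Without rows the chain is empty and the subsystem has no wires; what is left is the trace of
    -- the identity on the auxiliary wire.
    refine ⟨(N j).leftAux, by exact_mod_cast (hfit.aux_pos j).ne', ?_⟩
    intro σ σ' hσ hσ' hxx hyy
    have henv : env (2 * j) (2 * 0) (2 * j + (0 : ℕ)) (2 * j + (0 : ℕ) + 2 * (0 : ℕ)) = ∅ := by
      simp [env]
    rw [if_pos, Dform, henv, tr_empty]
    · simp [outerAux, Finset.sum_product, Circuit.evOp, chainAt_zero]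
      rw [Finset.filter_true_of_mem fun x hx => Finset.mem_range.1 hx, Finset.card_range]
    · refine ⟨fun c h1 h2 => ?_, fun c h1 h2 => ?_⟩
      · obtain rfl : c = 2 * j + (0 : ℕ) := by push_cast at *; omega
        exact hxx
      · push_cast at *; omega
  | succ s ih =>
    obtain ⟨κ, hκ, h⟩ := ih (fun s hs => hbi s (by omega)) (j + 1)
    obtain ⟨κ', hκ', h'⟩ := Dform_isScalarOn_extend hfit hu (fun s hs => hbi s (by omega)) h hκ
    refine ⟨κ', hκ', ?_⟩
    have := Dform_isScalarOn_succ (N := N) hbi h'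
    rw [show 2 * j + ((s + 1 : ℕ) : ℤ) = 2 * j + s + 1 by push_cast; ring]
    exact_mod_cast this

end

/-! ### Reduction of large windows to a fixed one, and normalization. -/

section

variable {C : Circuit} {N : ℤ → StateTensor}

theorem Tform_congr (hfit : FitsBelow N C) {t : ℕ} {x y j : ℤ} {n : ℕ} (hx : 2 * j < x)
    (hy : y < 2 * j + 2 * n) {X X' : Kernel}
    (h : ∀ z ∈ cutLabels N j, ∀ w ∈ cutLabels N (j + n), X z w = X' z w) (σ σ' : Cfg) :
    Tform C N t x y j n X σ σ' = Tform C N t x y j n X' σ σ' := by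
  refine tr_congr fun τ τ' hτ _ => ?_
  have h1 := (hτ (Sum.inl (2 * j)) (by rw [inl_mem_env]; omega)).2
  have h2 := (hτ (Sum.inl (2 * j + 2 * n)) (by rw [inl_mem_env]; omega)).2
  rw [Circuit.winDim, regTime_eq t (i := 0) (by omega) rfl, zero_min, min_zero,
    ← hfit.leftReg] at h1
  rw [Circuit.winDim, regTime_eq t rfl (j := 0) (by omega), min_zero, min_zero,
    show 2 * j + 2 * (n : ℤ) = 2 * (j + n) by ring, ← hfit.leftReg] at h2
  rw [show 2 * j + 2 * (n : ℤ) = 2 * (j + n) by ring]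
  refine Finset.sum_congr rfl fun p hp => Finset.sum_congr rfl fun q hq => ?_
  rw [h _ (by simp only [cutLabels, Finset.mem_product, Finset.mem_range]; exact ⟨h1, hp⟩)
    _ (by simp only [cutLabels, Finset.mem_product, Finset.mem_range]; exact ⟨h2, hq⟩)]

theorem path_zero (j : ℤ) (y x : ℕ × ℕ × ℕ) : path N j 0 y x = if y = x then 1 else 0 := rfl

section LightCone

variable {t : ℕ} {x y : ℤ} {σ σ' : Cfg}

theorem Tform_add_right (ht : 0 < t) (hfit : FitsBelow N C) (hbi : C.IsBiunitary t) (hxy : x < y)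
    {j : ℤ} {n : ℕ} (hx : 2 * j + (t : ℤ) ≤ x) (hy : y + (t : ℤ) ≤ 2 * j + 2 * n)
    (hσy : σ (Sum.inl y) = σ' (Sum.inl y)) (hσy' : σ (Sum.inl y) < C.regDim t y) (k : ℕ)
    (X : Kernel) : Tform C N t x y j (n + k) X σ σ' = Tform C N t x y j n
      (fun z w => ∑ v ∈ cutLabels N (j + n + k), X z v * path N (j + n) k w v) σ σ' := by
  induction k generalizing X with
  | zero =>
    refine Tform_congr hfit (by omega) (by omega) (fun z _ w hw => ?_) σ σ'
    have hw' : w ∈ cutLabels N (j + n) := hw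
    simp [path_zero, hw']
  | succ k ih =>
    rw [← add_assoc, Tform_right ht hfit hbi hxy hx (by push_cast; omega) hσy hσy', ih]
    congr 1
    funext z w
    simp only [path_succ, Finset.mul_sum, Finset.sum_mul]
    rw [Finset.sum_comm]
    push_cast
    simp only [← add_assoc]
    exact Finset.sum_congr rfl fun _ _ => Finset.sum_congr rfl fun _ _ => by ring

theorem Tform_add_left (ht : 0 < t) (hfit : FitsBelow N C) (hbi : C.IsBiunitary t) (hxy : x < y)
    {j : ℤ} {n : ℕ} (hx : 2 * j + (t : ℤ) ≤ x) (hy : y + (t : ℤ) ≤ 2 * j + 2 * n)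
    (hσx : σ (Sum.inl x) = σ' (Sum.inl x)) (hσx' : σ (Sum.inl x) < C.regDim t x) (k : ℕ)
    (X : Kernel) : Tform C N t x y (j - k) (n + k) X σ σ' = Tform C N t x y j n
      (fun z w => ∑ v ∈ cutLabels N (j - k), X v w * path N (j - k) k v z) σ σ' := by
  induction k generalizing X with
  | zero =>
    rw [Nat.cast_zero, sub_zero]
    refine Tform_congr hfit (by omega) (by omega) (fun z hz w _ => ?_) σ σ'
    simp [path_zero, hz]
  | succ k ih =>
    have e : j - ((k + 1 : ℕ) : ℤ) + 1 = j - k := by push_cast; ring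
    rw [← add_assoc, Tform_left ht hfit hbi hxy (by push_cast; omega) (by push_cast; omega)
      hσx hσx', e, ih]
    refine Tform_congr hfit (by omega) (by omega) (fun z hz w _ => ?_) σ σ'
    simp only [Finset.sum_mul]
    rw [Finset.sum_comm]
    refine Finset.sum_congr rfl fun v hv => ?_
    rw [path_succ_left k hv (by rw [e, sub_add_cancel]; exact hz), e, Finset.mul_sum]
    exact Finset.sum_congr rfl fun _ _ => by ring

/-- Beyond the light cone the vertices enter only through their transfer matrices, so the whole
dependence on the window and on `B` is carried by the kernel on two fixed cuts. -/
theorem Tform_pushKernel (ht : 0 < t) (hfit : FitsBelow N C) (hbi : C.IsBiunitary t) (hxy : x < y)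
    {j : ℤ} {n : ℕ} (hx : 2 * j + (t : ℤ) ≤ x) (hy : y + (t : ℤ) ≤ 2 * j + 2 * n)
    (hσx : σ (Sum.inl x) = σ' (Sum.inl x)) (hσx' : σ (Sum.inl x) < C.regDim t x)
    (hσy : σ (Sum.inl y) = σ' (Sum.inl y)) (hσy' : σ (Sum.inl y) < C.regDim t y) (k k' : ℕ)
    (X : Kernel) : Tform C N t x y (j - k) (n + k + k') X σ σ' =
      Tform C N t x y j n (pushKernel N j (j + n) k k' X) σ σ' := by
  have e : j - k + ((n + k : ℕ) : ℤ) = j + n := by push_cast; ring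
  rw [Tform_add_right ht hfit hbi hxy (by omega) (by push_cast; omega) hσy hσy', e,
    Tform_add_left ht hfit hbi hxy hx hy hσx hσx']
  congr 1
  funext z w
  simp only [pushKernel, Finset.sum_mul]
  exact Finset.sum_congr rfl fun _ _ => Finset.sum_congr rfl fun _ _ => by ring

end LightCone

theorem Tform_sub_smul (t : ℕ) (x y j : ℤ) (n : ℕ) (X X' : Kernel) (c : ℂ) (σ σ' : Cfg) :
    Tform C N t x y j n (fun z w => X z w - c * X' z w) σ σ' =
      Tform C N t x y j n X σ σ' - c * Tform C N t x y j n X' σ σ' := by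
  simp only [Tform, tr, Finset.mul_sum, ← Finset.sum_sub_distrib]
  refine Finset.sum_congr rfl fun _ _ => Finset.sum_congr rfl fun _ _ =>
    Finset.sum_congr rfl fun _ _ => by ring

/-- A linear functional of finitely many kernel entries is bounded. This transports the kernel
estimate of `joint_limit` to the entries of the density matrix; off the cut labels the kernel is not
controlled and is cut off by zero. -/
theorem exists_norm_Tform_le (hfit : FitsBelow N C) (t : ℕ) {x y j : ℤ} {n : ℕ} (hx : 2 * j < x)
    (hy : y < 2 * j + 2 * n) (σ σ' : Cfg) : ∃ M : ℝ, 0 ≤ M ∧ ∀ (X : Kernel) (δ : ℝ),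
      (∀ z ∈ cutLabels N j, ∀ w ∈ cutLabels N (j + n), ‖X z w‖ ≤ δ) → 0 ≤ δ →
      ‖Tform C N t x y j n X σ σ'‖ ≤ δ * M := by
  classical
  refine ⟨∑ e : (i : {i // i ∈ env (2 * j) n x y}) → Fin (C.winDim (2 * j) n t i),
    ∑ p ∈ auxPairs N j, ∑ q ∈ auxPairs N (j + n),
      ‖C.evOp (2 * j) n (chainAt N j n p.1 q.1) t (assign _ _ e σ) *
        star (C.evOp (2 * j) n (chainAt N j n p.2 q.2) t (assign _ _ e σ'))‖, by positivity,
    fun X δ hX hδ => ?_⟩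
  rw [Tform_congr (X' := fun z w => if z ∈ cutLabels N j ∧ w ∈ cutLabels N (j + n) then X z w
    else 0) hfit hx hy (fun z hz w hw => by simp [hz, hw])]
  simp only [Tform, tr, Finset.mul_sum]
  refine (norm_sum_le _ _).trans (Finset.sum_le_sum fun _ _ => (norm_sum_le _ _).trans
    (Finset.sum_le_sum fun _ _ => (norm_sum_le _ _).trans (Finset.sum_le_sum fun _ _ => ?_)))
  rw [norm_mul]
  refine mul_le_mul_of_nonneg_right ?_ (norm_nonneg _)
  split_ifs with h
  · exact hX _ h.1 _ h.2
  · simpa using hδ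

/-- A partial trace of a multiple of the identity is again one, multiplied by the number of labels
of the newly traced sites. These all lie where the full `t` rows have acted. -/
theorem IsScalarOn.restrict {t : ℕ} {x y x' y' j : ℤ} {n : ℕ} {κ : ℂ}
    (h : IsScalarOn (C.regDim t) (C.wireDim t) x' y' κ (Dform C N t x' y' j n)) (hκ : κ ≠ 0)
    (hx' : 2 * j + t ≤ x') (hx : x' ≤ x) (hxy : x < y) (hy : y ≤ y')
    (hy' : y' + t ≤ 2 * j + 2 * n) : ∃ κ' : ℂ, κ' ≠ 0 ∧
      IsScalarOn (C.regDim t) (C.wireDim t) x y κ' (Dform C N t x y j n) := by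
  classical
  set S : Finset Site := env (2 * j) n x y \ env (2 * j) n x' y' with hS
  have hsub : env (2 * j) n x' y' ⊆ env (2 * j) n x y := by
    rintro (c | c)
    · rw [inl_mem_env, inl_mem_env]; omega
    · rw [inr_mem_env, inr_mem_env]; omega
  have hpos : ∀ i, 0 < C.winDim (2 * j) n t i := by
    rintro (c | c)
    · exact C.regDim_pos _ _
    · exact C.wireDim_pos _ _
  have hl : ∀ c, Sum.inl c ∈ S ↔ (x' ≤ c ∧ c ≤ y') ∧ ¬ (x ≤ c ∧ c ≤ y) := by
    intro c; rw [hS, Finset.mem_sdiff, inl_mem_env, inl_mem_env]; omega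
  have hr : ∀ c, Sum.inr c ∈ S ↔ (x' ≤ c ∧ c < y') ∧ ¬ (x ≤ c ∧ c < y) := by
    intro c; rw [hS, Finset.mem_sdiff, inr_mem_env, inr_mem_env]; omega
  have hdl : ∀ c, x' ≤ c → c ≤ y' → C.winDim (2 * j) n t (Sum.inl c) = C.regDim t c := by
    intro c h1 h2; simp only [Circuit.winDim, regTime]; congr 1; omega
  have hdr : ∀ c, x' ≤ c → c < y' → C.winDim (2 * j) n t (Sum.inr c) = C.wireDim t c := by
    intro c h1 h2; simp only [Circuit.winDim, wireTime]; congr 1; omega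
  refine ⟨(Fintype.card ((i : {i // i ∈ S}) → Fin (C.winDim (2 * j) n t i)) : ℂ) * κ,
    mul_ne_zero ?_ hκ, ?_⟩
  · have : ∀ i : {i // i ∈ S}, Nonempty (Fin (C.winDim (2 * j) n t i)) := fun i => ⟨⟨0, hpos _⟩⟩
    exact_mod_cast Fintype.card_ne_zero
  · intro σ σ' hσ hσ' hxx hyy
    rw [Dform, ← Finset.sdiff_union_of_subset hsub, tr_union Finset.sdiff_disjoint, ← hS]
    have key : tr S (C.winDim (2 * j) n t) (Dform C N t x' y' j n) σ σ' =
        tr S (C.winDim (2 * j) n t) (fun _ _ => if Agree x y σ σ' then κ else 0) σ σ' := by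
      refine tr_congr fun τ τ' h1 h2 => ?_
      have hτl : ∀ c, x' ≤ c → c ≤ y' → τ (Sum.inl c) < C.regDim t c ∧
          τ' (Sum.inl c) < C.regDim t c := by
        intro c hc1 hc2
        by_cases hc : Sum.inl c ∈ S
        · have := h1 _ hc
          rw [hdl c hc1 hc2] at this
          exact ⟨this.2, this.1 ▸ this.2⟩
        · have := h2 _ hc
          rw [hl] at hc
          rw [this.1, this.2]
          exact ⟨hσ.1 c (by omega) (by omega), hσ'.1 c (by omega) (by omega)⟩
      have hτr : ∀ c, x' ≤ c → c < y' → τ (Sum.inr c) < C.wireDim t c ∧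
          τ' (Sum.inr c) < C.wireDim t c := by
        intro c hc1 hc2
        by_cases hc : Sum.inr c ∈ S
        · have := h1 _ hc
          rw [hdr c hc1 hc2] at this
          exact ⟨this.2, this.1 ▸ this.2⟩
        · have := h2 _ hc
          rw [hr] at hc
          rw [this.1, this.2]
          exact ⟨hσ.2 c (by omega) (by omega), hσ'.2 c (by omega) (by omega)⟩
      have hout : ∀ c, x' ≤ c → c ≤ y' → ¬ (x < c ∧ c < y) → τ (Sum.inl c) = τ' (Sum.inl c) := by
        intro c hc1 hc2 hc3
        by_cases hc : Sum.inl c ∈ S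
        · exact (h1 _ hc).1
        · have := h2 _ hc
          rw [hl] at hc
          rw [this.1, this.2]
          rcases eq_or_ne c x with rfl | h4
          · exact hxx
          · obtain rfl : c = y := by omega
            exact hyy
      rw [h τ τ' ⟨fun c a b => (hτl c a b).1, fun c a b => (hτr c a b).1⟩
        ⟨fun c a b => (hτl c a b).2, fun c a b => (hτr c a b).2⟩
        (hout _ le_rfl (by omega) (by omega)) (hout _ (by omega) le_rfl (by omega))]
      congr 1
      rw [eq_iff_iff]
      constructor
      · rintro ⟨ha, hw⟩
        refine ⟨fun c a b => ?_, fun c a b => ?_⟩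
        · have := h2 (Sum.inl c) (by rw [hl]; omega)
          rw [← this.1, ← this.2]; exact ha c (by omega) (by omega)
        · have := h2 (Sum.inr c) (by rw [hr]; omega)
          rw [← this.1, ← this.2]; exact hw c (by omega) (by omega)
      · rintro ⟨ha, hw⟩
        refine ⟨fun c a b => ?_, fun c a b => ?_⟩
        · by_cases hc : Sum.inl c ∈ S
          · exact (h1 _ hc).1
          · have := h2 _ hc
            rw [hl] at hc
            rw [this.1, this.2]; exact ha c (by omega) (by omega)
        · by_cases hc : Sum.inr c ∈ S
          · exact (h1 _ hc).1
          · have := h2 _ hc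
            rw [hr] at hc
            rw [this.1, this.2]; exact hw c (by omega) (by omega)
    refine key.trans ?_
    rw [tr, Finset.sum_const, Finset.card_univ, nsmul_eq_mul]
    split_ifs <;> simp

/-- The subsystem between the regions `x` and `x + ℓ` is maximally mixed in a window whose outer
regions and auxiliary wires are traced out. -/
theorem exists_Dform_isScalarOn (hfit : FitsBelow N C) (hu : ∀ j, (N j).IsHorizontallyUnitary)
    {t ℓ : ℕ} (hbi : C.IsBiunitary t) (x : ℤ) (hℓ : 1 ≤ ℓ) (ht : ℓ ≤ 2 * t) :
    ∃ (j : ℤ) (n : ℕ) (κ : ℂ), 2 * j + t ≤ x ∧ x + ℓ + t ≤ 2 * j + 2 * n ∧ κ ≠ 0 ∧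
      IsScalarOn (C.regDim t) (C.wireDim t) x (x + ℓ) κ (Dform C N t x (x + ℓ) j n) := by
  -- Peeling fixes the parity of the left end of the large subsystem, so `x` may be one column off;
  -- the `2t + 2` wires obtained below by extending leave room for this, since `ℓ ≤ 2t`.
  obtain ⟨j, hj⟩ : ∃ j : ℤ, x = 2 * j + t + 1 ∨ x = 2 * j + t + 2 :=
    ⟨(x - t - 1) / 2, by omega⟩
  obtain ⟨κ, hκ, h⟩ := Dform_isScalarOn hfit hu hbi (j + 1)
  obtain ⟨κ', hκ', h'⟩ := Dform_isScalarOn_extend hfit hu hbi h hκ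
  obtain ⟨κ'', hκ'', h''⟩ := h'.restrict hκ' (x := x) (y := x + ℓ) (by omega) (by omega) (by omega)
    (by omega) (by push_cast; omega)
  exact ⟨j, 2 * (t + 1), κ'', by omega, by push_cast; omega, hκ'', h''⟩

/-- Division by the trace is continuous at `κ • 1`, whose trace is nonzero, and invariant under
positive scaling; the scale `Λ`, which varies with the window, drops out. -/
theorem tendsto_normalized {ι W : Type*} [Fintype ι] [DecidableEq ι] [Nonempty ι] {f : Filter W}
    {A : W → Matrix ι ι ℂ} {κ : ℂ} (hκ : κ ≠ 0)
    (hA : ∀ ε > 0, ∀ᶠ w in f, ∃ Λ : ℝ, 0 < Λ ∧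
      ∀ i i', ‖A w i i' - Λ * (if i = i' then κ else 0)‖ ≤ ε * Λ) :
    Tendsto (fun w => (A w).trace⁻¹ • A w) f (𝓝 ((1 / (Fintype.card ι : ℂ)) • 1)) := by
  have hcard : (Fintype.card ι : ℂ) ≠ 0 := by exact_mod_cast Fintype.card_ne_zero
  have hg : Tendsto (fun M : ι → ι → ℂ => (Matrix.trace (Matrix.of M))⁻¹ • Matrix.of M)
      (𝓝 (fun i i' => if i = i' then κ else 0))
      (𝓝 ((1 / (Fintype.card ι : ℂ)) • (1 : Matrix ι ι ℂ))) := by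
    have h0 : (Matrix.of fun i i' : ι => if i = i' then κ else 0) = κ • (1 : Matrix ι ι ℂ) := by
      ext i i'; simp [Matrix.one_apply]
    have h1 : (1 / (Fintype.card ι : ℂ)) • (1 : Matrix ι ι ℂ) =
        (Matrix.trace (Matrix.of fun i i' : ι => if i = i' then κ else 0))⁻¹ •
          (Matrix.of fun i i' : ι => if i = i' then κ else 0) := by
      rw [h0, Matrix.trace_smul, Matrix.trace_one, smul_smul]
      congr 1
      rw [smul_eq_mul]
      field_simp
    rw [h1]
    have hc : Continuous fun M : ι → ι → ℂ => Matrix.of M := continuous_id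
    refine Tendsto.smul (Tendsto.inv₀ (hc.matrix_trace.tendsto _) ?_) (hc.tendsto _)
    rw [h0, Matrix.trace_smul, Matrix.trace_one]
    exact mul_ne_zero hκ hcard
  rw [tendsto_iff_forall_eventually_mem]
  intro U hU
  obtain ⟨ε, hε, hball⟩ := (Metric.nhds_basis_closedBall.mem_iff).1 (hg hU)
  filter_upwards [hA ε hε] with w hw
  obtain ⟨Λ, hΛ, hw⟩ := hw
  have hΛc : (Λ : ℂ) ≠ 0 := by exact_mod_cast hΛ.ne'
  have hM : (fun i i' => (Λ : ℂ)⁻¹ * A w i i') ∈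
      Metric.closedBall (fun i i' : ι => if i = i' then κ else 0) ε := by
    rw [Metric.mem_closedBall, dist_pi_le_iff hε.le]
    intro i
    rw [dist_pi_le_iff hε.le]
    intro i'
    rw [dist_eq_norm, show (Λ : ℂ)⁻¹ * A w i i' - (if i = i' then κ else 0) =
      (Λ : ℂ)⁻¹ * (A w i i' - Λ * (if i = i' then κ else 0)) by field_simp, norm_mul, norm_inv,
      Complex.norm_real, Real.norm_of_nonneg hΛ.le, inv_mul_le_iff₀ hΛ]
    linarith [hw i i']
  have := hball hM
  have e : (Matrix.of fun i i' => (Λ : ℂ)⁻¹ * A w i i') = (Λ : ℂ)⁻¹ • A w := by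
    ext i i'; simp
  rw [Set.mem_preimage, e, Matrix.trace_smul, smul_smul] at this
  convert this using 2
  rw [smul_eq_mul, mul_inv, inv_inv, mul_comm (Λ : ℂ), mul_assoc, mul_inv_cancel₀ hΛc, mul_one]

end

/-! ### The reduced density matrices of the statement. -/

section

variable {C : Circuit} {N : ℤ → StateTensor}

/-- A wave function on pairs of labellings as a function of one labelling of all sites. -/
def onCfg (ψ : (ℤ → ℕ) → (ℤ → ℕ) → ℂ) (σ : Cfg) : ℂ :=
  ψ (fun c => σ (Sum.inl c)) fun c => σ (Sum.inr c)

theorem onCfg_applyGate (s : ℕ) (c : ℤ) (ψ : (ℤ → ℕ) → (ℤ → ℕ) → ℂ) :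
    onCfg (C.applyGate s c ψ) = C.gateOp s c (onCfg ψ) := by
  funext σ
  refine Finset.sum_congr rfl fun x _ => ?_
  congr 1
  unfold onCfg
  congr 1
  · funext b
    rw [setGate_inl, Function.update_apply]
  · funext b
    rw [setGate_inr, Function.update_apply, Function.update_apply]

theorem onCfg_applyRow (s : ℕ) (c : ℤ) (k : ℕ) (ψ : (ℤ → ℕ) → (ℤ → ℕ) → ℂ) :
    onCfg (C.applyRow s c k ψ) = C.rowOp s c k (onCfg ψ) := by
  induction k with
  | zero => rfl
  | succ k ih => rw [Circuit.applyRow, onCfg_applyGate, ih]; rfl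

theorem onCfg_evolve (a b : ℕ) (ψ : (ℤ → ℕ) → (ℤ → ℕ) → ℂ) (t : ℕ) :
    onCfg (C.evolve a b ψ t) = C.evOp (2 * (-(a : ℤ))) (a + b) (onCfg ψ) t := by
  induction t with
  | zero => rfl
  | succ s ih =>
    rw [Circuit.evolve, onCfg_applyRow, ih, Circuit.evOp,
      show -2 * (a : ℤ) = 2 * (-(a : ℤ)) by ring]

theorem onCfg_evolve_windowState (a b : ℕ) (B : ℕ → ℕ → ℕ → ℕ → ℂ) (t : ℕ) (σ : Cfg) :
    onCfg (C.evolve a b (windowState N a b B) t) σ =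
      ∑ ξ ∈ Finset.range (N (-(a : ℤ))).leftAux, ∑ η ∈ Finset.range (N (b : ℤ)).leftAux,
        B (σ (Sum.inl (2 * (-(a : ℤ))))) ξ η (σ (Sum.inl (2 * (b : ℤ)))) *
          C.evOp (2 * (-(a : ℤ))) (a + b) (chainAt N (-(a : ℤ)) (a + b) ξ η) t σ := by
  rw [onCfg_evolve]
  have h : onCfg (windowState N a b B) = fun σ =>
      ∑ ξ ∈ Finset.range (N (-(a : ℤ))).leftAux, ∑ η ∈ Finset.range (N (b : ℤ)).leftAux,
        B (σ (Sum.inl (2 * (-(a : ℤ))))) ξ η (σ (Sum.inl (2 * (b : ℤ)))) *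
          chainAt N (-(a : ℤ)) (a + b) ξ η σ := by
    funext σ
    simp only [onCfg, windowState, chainAt, show -2 * (a : ℤ) = 2 * (-(a : ℤ)) by ring]
  rw [h]
  simp only [Circuit.evOp_sum]
  refine Finset.sum_congr rfl fun ξ _ => Finset.sum_congr rfl fun η _ => ?_
  rw [Circuit.evOp_mul]
  intro c h1 h2 σ x
  push_cast at h2
  rw [setGate_inl, setGate_inl, if_neg (by omega), if_neg (by omega)]

section Labels

variable (C) (t : ℕ) (x : ℤ) (ℓ : ℕ)

/-- The labelling of the subsystem given by `u` and `v`, with label `0` elsewhere. -/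
def subsystemCfg (u : InnerLabels C t x ℓ) (v : OuterLabels C t x ℓ) : Cfg :=
  Sum.elim
    (fun c => if c = x then v.1 else if c = x + ℓ then v.2
      else if h : (c - x - 1).toNat < ℓ - 1 ∧ x < c then u.1 ⟨(c - x - 1).toNat, h.1⟩ else 0)
    (fun c => if h : (c - x).toNat < ℓ ∧ x ≤ c then u.2 ⟨(c - x).toNat, h.1⟩ else 0)

variable {C t x ℓ}

theorem subsystemCfg_inl_left (u : InnerLabels C t x ℓ) (v : OuterLabels C t x ℓ) :
    subsystemCfg C t x ℓ u v (Sum.inl x) = v.1 := by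
  simp [subsystemCfg]

theorem subsystemCfg_inl_right (hℓ : 1 ≤ ℓ) (u : InnerLabels C t x ℓ) (v : OuterLabels C t x ℓ) :
    subsystemCfg C t x ℓ u v (Sum.inl (x + ℓ)) = v.2 := by
  have : x + (ℓ : ℤ) ≠ x := by omega
  simp [subsystemCfg, this]

theorem subsystemCfg_inl_inner (u : InnerLabels C t x ℓ) (v : OuterLabels C t x ℓ)
    (i : Fin (ℓ - 1)) : subsystemCfg C t x ℓ u v (Sum.inl (x + 1 + (i : ℕ))) = u.1 i := by
  have hi := i.2
  have e : (x + 1 + ((i : ℕ) : ℤ) - x - 1).toNat = i := by omega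
  rw [subsystemCfg, Sum.elim_inl, if_neg (by omega), if_neg (by omega), dif_pos (by omega)]
  have : (⟨(x + 1 + ((i : ℕ) : ℤ) - x - 1).toNat, by omega⟩ : Fin (ℓ - 1)) = i := Fin.ext e
  rw [this]

theorem subsystemCfg_inr (u : InnerLabels C t x ℓ) (v : OuterLabels C t x ℓ)
    (i : Fin ℓ) : subsystemCfg C t x ℓ u v (Sum.inr (x + (i : ℕ))) = u.2 i := by
  have hi := i.2
  have e : (x + ((i : ℕ) : ℤ) - x).toNat = i := by omega
  rw [subsystemCfg, Sum.elim_inr, dif_pos (by omega)]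
  have : (⟨(x + ((i : ℕ) : ℤ) - x).toNat, by omega⟩ : Fin ℓ) = i := Fin.ext e
  rw [this]

theorem inRange_subsystemCfg (hℓ : 1 ≤ ℓ) (u : InnerLabels C t x ℓ) (v : OuterLabels C t x ℓ) :
    InRange (C.regDim t) (C.wireDim t) x (x + ℓ) (subsystemCfg C t x ℓ u v) := by
  refine ⟨fun c h1 h2 => ?_, fun c h1 h2 => ?_⟩
  · rcases eq_or_ne c x with rfl | h3
    · rw [subsystemCfg_inl_left]; exact v.1.2
    · rcases eq_or_ne c (x + ℓ) with rfl | h4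
      · rw [subsystemCfg_inl_right hℓ]; exact v.2.2
      · obtain ⟨i, hi, rfl⟩ : ∃ i : ℕ, i < ℓ - 1 ∧ c = x + 1 + i :=
          ⟨(c - x - 1).toNat, by omega, by omega⟩
        have := subsystemCfg_inl_inner u v ⟨i, hi⟩
        rw [this]
        exact (u.1 ⟨i, hi⟩).2
  · obtain ⟨i, hi, rfl⟩ : ∃ i : ℕ, i < ℓ ∧ c = x + i := ⟨(c - x).toNat, by omega, by omega⟩
    have := subsystemCfg_inr u v ⟨i, hi⟩
    rw [this]
    exact (u.2 ⟨i, hi⟩).2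

theorem agree_subsystemCfg (hℓ : 1 ≤ ℓ) (u u' : InnerLabels C t x ℓ) (v : OuterLabels C t x ℓ) :
    Agree x (x + ℓ) (subsystemCfg C t x ℓ u v) (subsystemCfg C t x ℓ u' v) ↔ u = u' := by
  constructor
  · rintro ⟨h1, h2⟩
    refine Prod.ext (funext fun i => Fin.ext ?_) (funext fun i => Fin.ext ?_)
    · rw [← subsystemCfg_inl_inner u v, ← subsystemCfg_inl_inner u' v]
      exact h1 _ (by omega) (by have := i.2; omega)
    · rw [← subsystemCfg_inr u v, ← subsystemCfg_inr u' v]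
      exact h2 _ (by omega) (by have := i.2; omega)
  · rintro rfl
    exact ⟨fun _ _ _ => rfl, fun _ _ _ => rfl⟩

end Labels

/-- A translation between the two descriptions of labels. Its only content is that the outermost
regions lie outside the subsystem and are traced, hence common to the state and its conjugate, so
that `B` and its conjugate combine to `bdKernel B`. -/
theorem tracedBlock_eq_Tform (a b : ℕ) (B : ℕ → ℕ → ℕ → ℕ → ℂ) (t : ℕ) (x : ℤ) (ℓ : ℕ)
    (hℓ : 1 ≤ ℓ) (ha : 2 * (-(a : ℤ)) < x) (hb : x + ℓ < 2 * (b : ℤ)) (v : OuterLabels C t x ℓ)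
    (u u' : InnerLabels C t x ℓ) : tracedBlock C N a b B t x ℓ v u u' =
      Tform C N t x (x + ℓ) (-(a : ℤ)) (a + b) (bdKernel B) (subsystemCfg C t x ℓ u v)
        (subsystemCfg C t x ℓ u' v) := by
  have ea : -2 * (a : ℤ) = 2 * (-(a : ℤ)) := by ring
  have eb : 2 * (b : ℤ) = 2 * (-(a : ℤ)) + 2 * ((a + b : ℕ) : ℤ) := by push_cast; ring
  have eb' : (b : ℤ) = -(a : ℤ) + ((a + b : ℕ) : ℤ) := by push_cast; ring
  have hR : ∀ c, c ∈ Finset.Icc (-2 * (a : ℤ)) (2 * (b : ℤ)) \ Finset.Icc x (x + ℓ) ↔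
      Sum.inl c ∈ env (2 * (-(a : ℤ))) (a + b) x (x + ℓ) := by
    intro c
    rw [inl_mem_env, Finset.mem_sdiff, Finset.mem_Icc, Finset.mem_Icc, ea, eb]
  have hW : ∀ c, c ∈ Finset.Ico (-2 * (a : ℤ)) (2 * (b : ℤ)) \ Finset.Ico x (x + ℓ) ↔
      Sum.inr c ∈ env (2 * (-(a : ℤ))) (a + b) x (x + ℓ) := by
    intro c
    rw [inr_mem_env, Finset.mem_sdiff, Finset.mem_Ico, Finset.mem_Ico, ea, eb]
  have hdR : ∀ c, C.outRegDim a b t c = C.winDim (2 * (-(a : ℤ))) (a + b) t (Sum.inl c) := by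
    intro c
    simp only [Circuit.outRegDim, Circuit.winDim, regTime]
    congr 3 <;> omega
  have hdW : ∀ c, C.outWireDim a b t c = C.winDim (2 * (-(a : ℤ))) (a + b) t (Sum.inr c) := by
    intro c
    simp only [Circuit.outWireDim, Circuit.winDim, wireTime]
    congr 3 <;> omega
  let E : EnvRegions C a b t x ℓ × EnvWires C a b t x ℓ ≃
      ((i : {i // i ∈ env (2 * (-(a : ℤ))) (a + b) x (x + ℓ)}) →
        Fin (C.winDim (2 * (-(a : ℤ))) (a + b) t i)) :=
    { toFun := fun p i => match i with
        | ⟨Sum.inl c, h⟩ => Fin.cast (hdR c) (p.1 ⟨c, (hR c).2 h⟩)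
        | ⟨Sum.inr c, h⟩ => Fin.cast (hdW c) (p.2 ⟨c, (hW c).2 h⟩)
      invFun := fun g => (fun c => Fin.cast (hdR c).symm (g ⟨Sum.inl c, (hR c).1 c.2⟩),
        fun c => Fin.cast (hdW c).symm (g ⟨Sum.inr c, (hW c).1 c.2⟩))
      left_inv := by
        rintro ⟨e, f⟩
        rfl
      right_inv := by
        intro g
        funext ⟨i, hi⟩
        rcases i with c | c <;> rfl }
  have hE : ∀ u e f, onCfg (fun r w => C.evolve a b (windowState N a b B) t r w)
      (assign (env (2 * (-(a : ℤ))) (a + b) x (x + ℓ)) (C.winDim (2 * (-(a : ℤ))) (a + b) t)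
        (E (e, f)) (subsystemCfg C t x ℓ u v)) = evolvedAmp C N a b B t x ℓ u v e f := by
    intro u e f
    unfold onCfg evolvedAmp
    congr 1
    · funext c
      by_cases hc : c ∈ Finset.Icc (-2 * (a : ℤ)) (2 * (b : ℤ)) \ Finset.Icc x (x + ℓ)
      · have hc' := (hR c).1 hc
        have hc2 := inl_mem_env.1 hc'
        rw [assign, dif_pos hc', allRegions, if_neg (by omega), if_neg (by omega),
          dif_neg (by omega), dif_pos hc]
        rfl
      · have hc' := fun h => hc ((hR c).2 h)
        rw [assign, dif_neg hc', allRegions, dif_neg hc]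
        rfl
    · funext c
      by_cases hc : c ∈ Finset.Ico (-2 * (a : ℤ)) (2 * (b : ℤ)) \ Finset.Ico x (x + ℓ)
      · have hc' := (hW c).1 hc
        have hc2 := inr_mem_env.1 hc'
        rw [assign, dif_pos hc', allWires, dif_neg (by omega), dif_pos hc]
        rfl
      · have hc' := fun h => hc ((hW c).2 h)
        rw [assign, dif_neg hc', allWires, dif_neg hc]
        rfl
  have h1 : tracedBlock C N a b B t x ℓ v u u' =
      tr (env (2 * (-(a : ℤ))) (a + b) x (x + ℓ)) (C.winDim (2 * (-(a : ℤ))) (a + b) t)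
        (fun τ τ' => onCfg (C.evolve a b (windowState N a b B) t) τ *
          star (onCfg (C.evolve a b (windowState N a b B) t) τ'))
        (subsystemCfg C t x ℓ u v) (subsystemCfg C t x ℓ u' v) := by
    rw [tr, ← E.sum_comp, Fintype.sum_prod_type, tracedBlock, Matrix.of_apply]
    refine Fintype.sum_congr _ _ fun e => Fintype.sum_congr _ _ fun f => ?_
    rw [← hE u e f, ← hE u' e f]
  rw [h1]
  refine tr_congr fun τ τ' hτ _ => ?_
  have hl := (hτ (Sum.inl (2 * (-(a : ℤ)))) (by rw [inl_mem_env]; omega)).1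
  have hr := (hτ (Sum.inl (2 * (b : ℤ))) (by rw [inl_mem_env]; omega)).1
  rw [onCfg_evolve_windowState, onCfg_evolve_windowState, ← hl, ← hr, ← eb, ← eb']
  simp only [auxPairs, Finset.sum_product, star_sum, Finset.sum_mul_sum, bdKernel]
  refine Finset.sum_congr rfl fun ξ _ => Finset.sum_congr rfl fun ξ' _ =>
    Finset.sum_congr rfl fun η _ => Finset.sum_congr rfl fun η' _ => ?_
  rw [star_mul']
  ring

/-- Both `κ` and `Λ` are the same for all labels `v` of the bounding regions. This makes the direct
sum over `v`, as well as the sum over `v`, asymptotically proportional to the identity. -/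
theorem tracedBlock_estimate (hfit : FitsBelow N C) (hsolv : IsSolvable N) {t : ℕ}
    (hbi : C.IsBiunitary t) (x : ℤ) {ℓ : ℕ} (hℓ : 1 ≤ ℓ) (ht : ℓ ≤ 2 * t)
    (B : ℕ × ℕ → ℕ → ℕ → ℕ → ℕ → ℂ) (hB : ∀ w : ℕ × ℕ, BoundaryNonzero N w.1 w.2 (B w)) :
    ∃ κ : ℂ, κ ≠ 0 ∧ ∀ ε > 0, ∀ᶠ w in (atTop : Filter (ℕ × ℕ)), ∃ Λ : ℝ, 0 < Λ ∧
      ∀ v u u', ‖tracedBlock C N w.1 w.2 (B w) t x ℓ v u u' - Λ * (if u = u' then κ else 0)‖ ≤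
        ε * Λ := by
  obtain ⟨j, n, κ, hx, hy, hκ, hD⟩ := exists_Dform_isScalarOn hfit hsolv.unitary hbi x hℓ ht
  refine ⟨κ, hκ, fun ε hε => ?_⟩
  choose M hM0 hM using fun p : OuterLabels C t x ℓ × InnerLabels C t x ℓ × InnerLabels C t x ℓ =>
    exists_norm_Tform_le (C := C) (N := N) hfit t (x := x) (y := x + ℓ) (j := j) (n := n)
      (by omega) (by omega) (subsystemCfg C t x ℓ p.2.1 p.1) (subsystemCfg C t x ℓ p.2.2 p.1)
  -- A common bound for the finitely many matrix entries, so that a single window size serves all of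
  -- them.
  set M₀ : ℝ := ∑ p, M p with hM₀
  have hMle : ∀ p, M p ≤ M₀ := fun p =>
    Finset.single_le_sum (f := M) (fun p _ => hM0 p) (Finset.mem_univ p)
  have hM₀0 : 0 ≤ M₀ := Finset.sum_nonneg fun p _ => hM0 p
  obtain ⟨k₀, k₀', hjoint⟩ := joint_limit hfit hsolv j (j + n) (ε := ε / (M₀ + 1)) (by positivity)
  filter_upwards [eventually_ge_atTop ((k₀ + j.natAbs, k₀' + (j + n).natAbs) : ℕ × ℕ)] with w hw
  obtain ⟨a, b⟩ := w
  obtain ⟨hwa, hwb⟩ : k₀ + j.natAbs ≤ a ∧ k₀' + (j + n).natAbs ≤ b := hw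
  obtain ⟨k, hk⟩ : ∃ k : ℕ, j - k = -(a : ℤ) := ⟨(j + a).toNat, by omega⟩
  obtain ⟨k', hk'⟩ : ∃ k' : ℕ, j + n + k' = (b : ℤ) := ⟨(b - j - n).toNat, by omega⟩
  obtain ⟨Λ, hΛ, hjoint⟩ := hjoint k (by omega) k' (by omega) (B (a, b)) (by
    obtain ⟨l, hl, ξ, hξ, η, hη, r, hr, h⟩ := hB (a, b)
    rw [hk, hk']
    exact ⟨l, hl, ξ, hξ, η, hη, r, hr, h⟩)
  refine ⟨Λ, hΛ, fun v u u' => ?_⟩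
  have hu := inRange_subsystemCfg hℓ u v
  have hu' := inRange_subsystemCfg hℓ u' v
  have hxx : subsystemCfg C t x ℓ u v (Sum.inl x) = subsystemCfg C t x ℓ u' v (Sum.inl x) := by
    rw [subsystemCfg_inl_left, subsystemCfg_inl_left]
  have hyy : subsystemCfg C t x ℓ u v (Sum.inl (x + ℓ)) =
      subsystemCfg C t x ℓ u' v (Sum.inl (x + ℓ)) := by
    rw [subsystemCfg_inl_right hℓ, subsystemCfg_inl_right hℓ]
  have e1 : tracedBlock C N a b (B (a, b)) t x ℓ v u u' =
      Tform C N t x (x + ℓ) j n (pushKernel N j (j + n) k k' (bdKernel (B (a, b))))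
        (subsystemCfg C t x ℓ u v) (subsystemCfg C t x ℓ u' v) := by
    rw [tracedBlock_eq_Tform a b _ t x ℓ hℓ (by omega) (by omega), ← hk,
      show a + b = n + k + k' by omega]
    exact Tform_pushKernel (by omega) hfit hbi (by omega) hx hy hxx
      (hu.1 _ le_rfl (by omega)) hyy (hu.1 _ (by omega) le_rfl) k k' _
  have e2 : (if u = u' then κ else 0) = Tform C N t x (x + ℓ) j n (fun z w => diag z * diag w)
      (subsystemCfg C t x ℓ u v) (subsystemCfg C t x ℓ u' v) := by
    classical
    rw [Tform_diag, hD _ _ hu hu' hxx hyy]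
    exact if_congr (agree_subsystemCfg hℓ u u' v).symm rfl rfl
  rw [e1, e2, ← Tform_sub_smul]
  refine (hM (v, u, u') _ (ε / (M₀ + 1) * Λ) (fun z hz w hw => hjoint z hz w hw)
    (by positivity)).trans ?_
  calc ε / (M₀ + 1) * Λ * M (v, u, u') ≤ ε / (M₀ + 1) * Λ * (M₀ + 1) := by
        refine mul_le_mul_of_nonneg_left ?_ (by positivity)
        linarith [hMle (v, u, u')]
    _ = ε * Λ := by field_simp

theorem tendsto_reducedDensity (hfit : FitsBelow N C) (hsolv : IsSolvable N) {t : ℕ}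
    (hbi : C.IsBiunitary t) (x : ℤ) {ℓ : ℕ} (hℓ : 1 ≤ ℓ) (ht : ℓ ≤ 2 * t)
    (B : ℕ × ℕ → ℕ → ℕ → ℕ → ℕ → ℂ) (hB : ∀ w : ℕ × ℕ, BoundaryNonzero N w.1 w.2 (B w))
    [Nonempty (InnerLabels C t x ℓ)] [Nonempty (OuterLabels C t x ℓ)] :
    Tendsto (fun w : ℕ × ℕ => reducedDensity C N w.1 w.2 (B w) t x ℓ) atTop
      (𝓝 ((1 / (Fintype.card (InnerLabels C t x ℓ × OuterLabels C t x ℓ) : ℂ)) • 1)) := by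
  obtain ⟨κ, hκ, h⟩ := tracedBlock_estimate hfit hsolv hbi x hℓ ht B hB
  refine tendsto_normalized hκ fun ε hε => ?_
  filter_upwards [h ε hε] with w hw
  obtain ⟨Λ, hΛ, hw⟩ := hw
  refine ⟨Λ, hΛ, ?_⟩
  rintro ⟨u, v⟩ ⟨u', v'⟩
  rw [Matrix.blockDiagonal_apply]
  by_cases hv : v = v'
  · subst hv
    simpa using hw v u u'
  · simp only [hv, if_false, Prod.mk.injEq, and_false, mul_zero, sub_zero, norm_zero]
    positivity

theorem tendsto_innerReducedDensity (hfit : FitsBelow N C) (hsolv : IsSolvable N) {t : ℕ}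
    (hbi : C.IsBiunitary t) (x : ℤ) {ℓ : ℕ} (hℓ : 1 ≤ ℓ) (ht : ℓ ≤ 2 * t)
    (B : ℕ × ℕ → ℕ → ℕ → ℕ → ℕ → ℂ) (hB : ∀ w : ℕ × ℕ, BoundaryNonzero N w.1 w.2 (B w))
    [Nonempty (InnerLabels C t x ℓ)] [Nonempty (OuterLabels C t x ℓ)] :
    Tendsto (fun w : ℕ × ℕ => innerReducedDensity C N w.1 w.2 (B w) t x ℓ) atTop
      (𝓝 ((1 / (Fintype.card (InnerLabels C t x ℓ) : ℂ)) • 1)) := by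
  obtain ⟨κ, hκ, h⟩ := tracedBlock_estimate hfit hsolv hbi x hℓ ht B hB
  have hcard : (Fintype.card (OuterLabels C t x ℓ) : ℂ) ≠ 0 := by
    exact_mod_cast Fintype.card_ne_zero
  have hcard' : (0 : ℝ) < Fintype.card (OuterLabels C t x ℓ) := by
    exact_mod_cast Fintype.card_pos
  refine tendsto_normalized (mul_ne_zero hcard hκ) fun ε hε => ?_
  -- Tracing out the bounding regions adds up one error for each of their labels.
  filter_upwards [h (ε / Fintype.card (OuterLabels C t x ℓ)) (by positivity)] with w hw
  obtain ⟨Λ, hΛ, hw⟩ := hw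
  refine ⟨Λ, hΛ, fun u u' => ?_⟩
  have e : (∑ v, tracedBlock C N w.1 w.2 (B w) t x ℓ v) u u' -
      Λ * (if u = u' then (Fintype.card (OuterLabels C t x ℓ) : ℂ) * κ else 0) =
      ∑ v, (tracedBlock C N w.1 w.2 (B w) t x ℓ v u u' - Λ * (if u = u' then κ else 0)) := by
    rw [Finset.sum_sub_distrib, Finset.sum_const, Finset.card_univ, nsmul_eq_mul,
      Matrix.sum_apply]
    split_ifs <;> ring
  rw [e]
  calc _ ≤ ∑ _v : OuterLabels C t x ℓ, ε / Fintype.card (OuterLabels C t x ℓ) * Λ :=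
        (norm_sum_le _ _).trans (Finset.sum_le_sum fun v _ => hw v u u')
    _ = ε * Λ := by
        rw [Finset.sum_const, Finset.card_univ, nsmul_eq_mul]
        field_simp

end

end Biunitary

end

theorem mainTheorem2 (C : Biunitary.Circuit) (N : ℤ → Biunitary.StateTensor)
    (hfit : Biunitary.FitsBelow N C) (hsolv : Biunitary.IsSolvable N)
    (t : ℕ) (hbi : C.IsBiunitary t)
    (x : ℤ) (ℓ : ℕ) (hℓ : 1 ≤ ℓ) (ht : (ℓ : ℝ) / 2 ≤ (t : ℝ))
    (B : ℕ × ℕ → ℕ → ℕ → ℕ → ℕ → ℂ)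
    (hB : ∀ w : ℕ × ℕ, Biunitary.BoundaryNonzero N w.1 w.2 (B w)) :
    (∃ ρA : Matrix (Biunitary.InnerLabels C t x ℓ × Biunitary.OuterLabels C t x ℓ)
          (Biunitary.InnerLabels C t x ℓ × Biunitary.OuterLabels C t x ℓ) ℂ,
        Filter.Tendsto
          (fun w : ℕ × ℕ => Biunitary.reducedDensity C N w.1 w.2 (B w) t x ℓ)
          Filter.atTop (nhds ρA) ∧
        Biunitary.IsThermal ρA) ∧
    (∃ ρA : Matrix (Biunitary.InnerLabels C t x ℓ) (Biunitary.InnerLabels C t x ℓ) ℂ,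
        Filter.Tendsto
          (fun w : ℕ × ℕ => Biunitary.innerReducedDensity C N w.1 w.2 (B w) t x ℓ)
          Filter.atTop (nhds ρA) ∧
        Biunitary.IsThermal ρA) := by
  have ht' : ℓ ≤ 2 * t := by
    have : (ℓ : ℝ) ≤ 2 * t := by linarith
    exact_mod_cast this
  have : Nonempty (Biunitary.InnerLabels C t x ℓ) :=
    ⟨(fun _ => ⟨0, C.regDim_pos _ _⟩, fun _ => ⟨0, C.wireDim_pos _ _⟩)⟩
  have : Nonempty (Biunitary.OuterLabels C t x ℓ) :=
    ⟨(⟨0, C.regDim_pos _ _⟩, ⟨0, C.regDim_pos _ _⟩)⟩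
  exact ⟨⟨_, Biunitary.tendsto_reducedDensity hfit hsolv hbi x hℓ ht' B hB,
      Biunitary.isThermal_maximallyMixed⟩,
    ⟨_, Biunitary.tendsto_innerReducedDensity hfit hsolv hbi x hℓ ht' B hB,
      Biunitary.isThermal_maximallyMixed⟩⟩
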